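/- **Proposition (Two Stores).** Consider a concurrent program: a finite set of threads, each with an initial label, local registers and a finite set of labelled instructions $\ell\colon \mathit{inst};\ \mathtt{goto}\ \ell'$ (several may share a label), over a domain $\mathrm{DOM}\ni 0$ of values, which also serve as memory addresses. Instructions are loads, stores, register assignments, $\mathtt{assert}$, $\mathtt{scfence}$ and $\mathtt{fence}\ a_1\dots a_k$; their operands are functions of register contents. *Relaxed semantics.* Every thread $t$ has a FIFO buffer for each address, and one FIFO buffer for all addresses. A store to $a$ is issued (action $\mathrm{isu}$ of $t$) into $t$'s buffer for $a$, advances silently to $t$'s all-addresses buffer, and from there reaches the memory (action $(t,\mathrm{st},a,v)$). A load (action $(t,\mathrm{ld},a,v)$) reads the youngest store to its address in the buffers of its own thread, where the per-address buffer has priority, and the memory if there is none. $\mathtt{scfence}$ is executable only if all buffers of the thread are empty. $\mathtt{fence}\ a_1\dots a_k$ can be issued (action $\mathrm{isu}$) only if the thread's per-address buffers for $a_1,\dots,a_k$ are empty, and then passes through its all-addresses buffer, leaving it with a $\mathrm{fence}$ action. An $\mathtt{assert}$ is executable only if its expression is not $0$. A *computation* is the sequence of actions of a run that starts with all registers and addresses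 $0$ and all buffers empty, and ends with all buffers empty; for each store or fence $x$ in it, the corresponding issue $\mathrm{isu}_x$ is part of the data. It is *sequentially consistent* (SC) if every store and fence immediately follows its issue. *Traces.* The happens-before trace of a computation $\tau$ is the graph whose nodes are its actions, $\mathrm{isu}_x$ and $x$ being one node labelled $x$, with four edge relations. Program order: immediate succession, within one thread, of the actions other than stores and fences, where $\mathrm{isu}_x$ stands for $x$. Store order: immediate succession, in $\tau$, of the stores to one address. Source: a load $l$ of thread $t$ from $a$ reads from the store of $t$ to $a$ that is issued last among those issued before $l$ and reaching memory after $l$; if there is none, from the last store to $a$ reaching memory before $l$, if any. Conflict: $l\to s$ if $l$ reads from some $s'$ and $s$ succeeds $s'$ in store order, or if $l$ has no source and $s$ is the first store to the address of $l$. A *violation* is a computation whose trace differs (up to isomorphism of labelled graphs) from the traces of all SC computations of the program. *Cost.* For a store or fence $x$ of thread $t$ in $\tau=\tau_1\cdot\mathrm{isu}_x\cdot\tau_2\cdot x\cdot\tau_3$, the number of delays of $x$ is the number of actions of $t$ in $\tau_2$, and the number of reorders of $x$ is the number of stores and fences $y$ of $t$ such that both $\mathrm{isu}_y$ and $y$ occur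 in $\tau_2$. The cost of $\tau$ is the triple (sum of all delays, sum of all reorders, length of $\tau$), compared lexicographically. A *minimal violation* is a violation whose cost is minimal among all violations of the program. **Claim.** If the program contains no $\mathtt{fence}$ instruction ($\mathtt{scfence}$ is allowed), then it has no minimal violation of the form $\tau_1\cdot\mathrm{st}_1\cdot\mathrm{st}_2\cdot\tau_2$ where $\mathrm{st}_1$ and $\mathrm{st}_2$ are store actions of the same thread. -/

import Mathlib

/-!
Programs over a shared memory, their relaxed store-atomic operational semantics with per-address
and all-addresses store buffers, happens-before traces, robustness violations, and the cost
function (delays, reorders, length) that singles out the minimal violations.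
-/

namespace StoreAtomic

/-! ### Syntax -/

/-- An expression `f(r₁, …, rₖ)`: a function applied to the contents of a list of registers. -/
structure Expr (DOM REG : Type*) where
  fn : List DOM → DOM
  args : List REG

/-- The commands of the language. -/
inductive Instr (DOM REG : Type*) where
  /-- `r ← mem[e]` -/
  | load (r : REG) (e : Expr DOM REG)
  /-- `mem[e] ← e'` -/
  | store (e e' : Expr DOM REG)
  /-- `r ← e` -/
  | assign (r : REG) (e : Expr DOM REG)
  /-- `assert e` -/
  | assert (e : Expr DOM REG)
  /-- `scfence` -/
  | scfence
  /-- `fence e₁ … eₖ` -/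
  | fence (es : List (Expr DOM REG))

/-- A labelled instruction `src: inst; goto tgt`. -/
structure LInstr (DOM REG LAB : Type*) where
  src : LAB
  inst : Instr DOM REG
  tgt : LAB

/-- A concurrent program with thread names `THRD`. Every thread has an initial label and a finite
set of labelled instructions; several instructions may carry the same label. Every thread has its
own copy of the registers `REG`. -/
structure Program (DOM THRD REG LAB : Type*) where
  init : THRD → LAB
  code : THRD → Finset (LInstr DOM REG LAB)

/-- The program does not use the `fence` command (`scfence` is allowed). -/
def Program.FenceFree {DOM THRD REG LAB : Type*} (P : Program DOM THRD REG LAB) : Prop :=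
  ∀ t, ∀ c ∈ P.code t, ∀ es, c.inst ≠ Instr.fence es

/-! ### Actions -/

/-- The actions. -/
inductive Act (DOM THRD : Type*) where
  | st (t : THRD) (a v : DOM)
  | ld (t : THRD) (a v : DOM)
  | isu (t : THRD)
  | loc (t : THRD)
  | scfence (t : THRD)
  | fence (t : THRD) (as : List DOM)

/-- The thread executing an action. -/
def Act.thread {DOM THRD : Type*} : Act DOM THRD → THRD
  | .st t _ _ => t
  | .ld t _ _ => t
  | .isu t => t
  | .loc t => t
  | .scfence t => t
  | .fence t _ => t

/-- The action is a store. -/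
def Act.IsStore {DOM THRD : Type*} (x : Act DOM THRD) : Prop :=
  ∃ t a v, x = .st t a v

/-- `true` on the actions that have a separate issue action: stores and fences. -/
def Act.isIssued {DOM THRD : Type*} : Act DOM THRD → Bool
  | .st _ _ _ => true
  | .fence _ _ => true
  | _ => false

/-- An occurrence of an action in a computation. For a store or a fence `x`, `iss` is the position
in the computation of the corresponding issue action `isu_x`. For every other action, `iss` is the
position of the action itself. (The bare action sequence does not determine which issue belongs to
which store, as an issue action does not show what is issued.) -/
structure Event (DOM THRD : Type*) where
  act : Act DOM THRD
  iss : ℕ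

/-- The thread executing an event. -/
def Event.thread {DOM THRD : Type*} (e : Event DOM THRD) : THRD := e.act.thread

/-! ### Operational semantics -/

/-- Entries of the all-addresses buffers, tagged with the position of their issue. -/
inductive Entry (DOM : Type*) where
  | store (i : ℕ) (a v : DOM)
  | fence (i : ℕ) (as : List DOM)

/-- The value of a buffered store to address `a`; `none` on all other buffer entries. -/
def Entry.valueAt {DOM : Type*} [DecidableEq DOM] (a : DOM) : Entry DOM → Option DOM
  | .store _ b v => if b = a then some v else none
  | .fence _ _ => none

/-- States: program counters, register and memory valuation, the per-thread and per-address buffers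
`buf₁` (oldest entry first, tagged with the position of the issue), and the per-thread
all-addresses buffers `buf₂` (oldest entry first). -/
structure State (DOM THRD REG LAB : Type*) where
  pc : THRD → LAB
  reg : THRD → REG → DOM
  mem : DOM → DOM
  buf₁ : THRD → DOM → List (ℕ × DOM)
  buf₂ : THRD → List (Entry DOM)

/-- Evaluation of an expression. -/
def Expr.eval {DOM REG : Type*} (e : Expr DOM REG) (ρ : REG → DOM) : DOM :=
  e.fn (e.args.map ρ)

section Semantics

variable {DOM THRD REG LAB : Type*} [Zero DOM] [DecidableEq DOM] [DecidableEq THRD]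
  [DecidableEq REG]

/-- The initial state. -/
def Program.initState (P : Program DOM THRD REG LAB) : State DOM THRD REG LAB where
  pc := P.init
  reg := fun _ _ => 0
  mem := fun _ => 0
  buf₁ := fun _ _ => []
  buf₂ := fun _ => []

/-- Replace the per-address buffer of thread `t` and address `a`. -/
def State.setBuf₁ (s : State DOM THRD REG LAB) (t : THRD) (a : DOM) (β : List (ℕ × DOM)) :
    State DOM THRD REG LAB :=
  { s with buf₁ := Function.update s.buf₁ t (Function.update (s.buf₁ t) a β) }

/-- Replace the all-addresses buffer of thread `t`. -/
def State.setBuf₂ (s : State DOM THRD REG LAB) (t : THRD) (β : List (Entry DOM)) :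
    State DOM THRD REG LAB :=
  { s with buf₂ := Function.update s.buf₂ t β }

/-- Assign `v` to register `r` of thread `t`. -/
def State.setReg (s : State DOM THRD REG LAB) (t : THRD) (r : REG) (v : DOM) :
    State DOM THRD REG LAB :=
  { s with reg := Function.update s.reg t (Function.update (s.reg t) r v) }

/-- Assign `v` to the memory address `a`. -/
def State.setMem (s : State DOM THRD REG LAB) (a v : DOM) : State DOM THRD REG LAB :=
  { s with mem := Function.update s.mem a v }

/-- Move the program counter of thread `t` to `l`. -/
def State.goto (s : State DOM THRD REG LAB) (t : THRD) (l : LAB) : State DOM THRD REG LAB :=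
  { s with pc := Function.update s.pc t l }

/-- In state `s`, thread `t` may execute `inst` and continue at label `l`. -/
def Program.Fetch (P : Program DOM THRD REG LAB) (s : State DOM THRD REG LAB) (t : THRD)
    (inst : Instr DOM REG) (l : LAB) : Prop :=
  (⟨s.pc t, inst, l⟩ : LInstr DOM REG LAB) ∈ P.code t

/-- `Step P n s o s'`: a transition from `s` to `s'` when `n` actions have been executed so far.
`o` is the event of the transition, or `none` for an `ε`-transition. -/
inductive Step (P : Program DOM THRD REG LAB) (n : ℕ) :
    State DOM THRD REG LAB → Option (Event DOM THRD) → State DOM THRD REG LAB → Prop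
  /-- The load reads the youngest entry of the per-address buffer. -/
  | earlyRead₁ {s : State DOM THRD REG LAB} {t : THRD} {r : REG} {e : Expr DOM REG} {l : LAB}
      {a v : DOM} {i : ℕ} {β : List (ℕ × DOM)}
      (h : P.Fetch s t (.load r e) l) (ha : a = e.eval (s.reg t))
      (hb : s.buf₁ t a = β ++ [(i, v)]) :
      Step P n s (some ⟨.ld t a v, n⟩) ((s.setReg t r v).goto t l)
  /-- The per-address buffer is empty; the load reads the youngest store to the address in the
  all-addresses buffer. -/
  | earlyRead₂ {s : State DOM THRD REG LAB} {t : THRD} {r : REG} {e : Expr DOM REG} {l : LAB}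
      {a v : DOM} {β : List DOM}
      (h : P.Fetch s t (.load r e) l) (ha : a = e.eval (s.reg t))
      (hb₁ : s.buf₁ t a = []) (hb₂ : (s.buf₂ t).filterMap (Entry.valueAt a) = β ++ [v]) :
      Step P n s (some ⟨.ld t a v, n⟩) ((s.setReg t r v).goto t l)
  | readMemory {s : State DOM THRD REG LAB} {t : THRD} {r : REG} {e : Expr DOM REG} {l : LAB}
      {a v : DOM}
      (h : P.Fetch s t (.load r e) l) (ha : a = e.eval (s.reg t))
      (hb₁ : s.buf₁ t a = []) (hb₂ : (s.buf₂ t).filterMap (Entry.valueAt a) = [])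
      (hv : v = s.mem a) :
      Step P n s (some ⟨.ld t a v, n⟩) ((s.setReg t r v).goto t l)
  | issueStore {s : State DOM THRD REG LAB} {t : THRD} {e e' : Expr DOM REG} {l : LAB}
      {a v : DOM}
      (h : P.Fetch s t (.store e e') l) (ha : a = e.eval (s.reg t)) (hv : v = e'.eval (s.reg t)) :
      Step P n s (some ⟨.isu t, n⟩) ((s.setBuf₁ t a (s.buf₁ t a ++ [(n, v)])).goto t l)
  | advanceBuffer {s : State DOM THRD REG LAB} {t : THRD} {a v : DOM} {i : ℕ}
      {β : List (ℕ × DOM)}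
      (hb : s.buf₁ t a = (i, v) :: β) :
      Step P n s none ((s.setBuf₁ t a β).setBuf₂ t (s.buf₂ t ++ [.store i a v]))
  | storeToMemory {s : State DOM THRD REG LAB} {t : THRD} {a v : DOM} {i : ℕ}
      {β : List (Entry DOM)}
      (hb : s.buf₂ t = .store i a v :: β) :
      Step P n s (some ⟨.st t a v, i⟩) ((s.setMem a v).setBuf₂ t β)
  | scfence {s : State DOM THRD REG LAB} {t : THRD} {l : LAB}
      (h : P.Fetch s t .scfence l) (hb₂ : s.buf₂ t = []) (hb₁ : ∀ a, s.buf₁ t a = []) :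
      Step P n s (some ⟨.scfence t, n⟩) (s.goto t l)
  | issueFence {s : State DOM THRD REG LAB} {t : THRD} {es : List (Expr DOM REG)} {l : LAB}
      {as : List DOM}
      (h : P.Fetch s t (.fence es) l) (has : as = es.map fun e => e.eval (s.reg t))
      (hb₁ : ∀ a ∈ as, s.buf₁ t a = []) :
      Step P n s (some ⟨.isu t, n⟩) ((s.setBuf₂ t (s.buf₂ t ++ [.fence n as])).goto t l)
  | fence {s : State DOM THRD REG LAB} {t : THRD} {as : List DOM} {i : ℕ} {β : List (Entry DOM)}
      (hb : s.buf₂ t = .fence i as :: β) :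
      Step P n s (some ⟨.fence t as, i⟩) (s.setBuf₂ t β)
  | localAssign {s : State DOM THRD REG LAB} {t : THRD} {r : REG} {e : Expr DOM REG} {l : LAB}
      (h : P.Fetch s t (.assign r e) l) :
      Step P n s (some ⟨.loc t, n⟩) ((s.setReg t r (e.eval (s.reg t))).goto t l)
  | localAssert {s : State DOM THRD REG LAB} {t : THRD} {e : Expr DOM REG} {l : LAB}
      (h : P.Fetch s t (.assert e) l) (he : e.eval (s.reg t) ≠ 0) :
      Step P n s (some ⟨.loc t, n⟩) (s.goto t l)

/-- `Run P τ s`: the event sequence `τ` leads from the initial state to `s`. -/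
inductive Run (P : Program DOM THRD REG LAB) :
    List (Event DOM THRD) → State DOM THRD REG LAB → Prop
  | nil : Run P [] P.initState
  | silent {τ : List (Event DOM THRD)} {s s' : State DOM THRD REG LAB}
      (h : Run P τ s) (hs : Step P τ.length s none s') : Run P τ s'
  | snoc {τ : List (Event DOM THRD)} {s s' : State DOM THRD REG LAB} {e : Event DOM THRD}
      (h : Run P τ s) (hs : Step P τ.length s (some e) s') : Run P (τ ++ [e]) s'

/-- The computations of the relaxed semantics: they start in the initial state and end with empty
buffers. -/
def Program.Computations (P : Program DOM THRD REG LAB) : Set (List (Event DOM THRD)) :=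
  {τ | ∃ s, Run P τ s ∧ (∀ t a, s.buf₁ t a = []) ∧ ∀ t, s.buf₂ t = []}

/-- The sequentially consistent computations: every store (and every fence) takes effect
immediately after its issue. -/
def Program.SCComputations (P : Program DOM THRD REG LAB) : Set (List (Event DOM THRD)) :=
  {τ | τ ∈ P.Computations ∧
    ∀ (p : ℕ) (e : Event DOM THRD), τ[p]? = some e → e.act.isIssued = true → p = e.iss + 1}

end Semantics

/-! ### Happens-before traces -/

section Traces

variable {DOM THRD : Type*}

/-- `i` is a node of the trace: a position of `τ` that holds neither a store nor a fence. A store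
or fence `x` is represented by the position of `isu_x`. -/
def IsNode (τ : List (Event DOM THRD)) (i : ℕ) : Prop :=
  ∃ e, τ[i]? = some e ∧ e.act.isIssued = false

/-- The node `i` stands for the action `x`. For an issue position this is the issued store or
fence. -/
def NodeAct (τ : List (Event DOM THRD)) (i : ℕ) (x : Act DOM THRD) : Prop :=
  ∃ p : ℕ, τ[p]? = some ⟨x, i⟩ ∧ ∀ t, x ≠ .isu t

/-- The position `i` of `τ` holds a not delayed action of thread `t`. -/
def NodeOfThread (τ : List (Event DOM THRD)) (t : THRD) (i : ℕ) : Prop :=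
  ∃ e, τ[i]? = some e ∧ e.act.isIssued = false ∧ e.thread = t

/-- Program order: `j` follows `i` in the projection of `τ` to the not delayed actions of one
thread. -/
def Po (τ : List (Event DOM THRD)) (i j : ℕ) : Prop :=
  ∃ t, NodeOfThread τ t i ∧ NodeOfThread τ t j ∧ i < j ∧
    ∀ k, i < k → k < j → ¬ NodeOfThread τ t k

/-- At position `p` of `τ` a store of thread `t` to address `a` with issue position `i` reaches
the memory. -/
def StoreAt (τ : List (Event DOM THRD)) (p : ℕ) (t : THRD) (a : DOM) (i : ℕ) : Prop :=
  ∃ v, τ[p]? = some ⟨.st t a v, i⟩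

/-- Store order: the store `j` follows the store `i` in the projection of `τ` to the stores to one
address. -/
def St (τ : List (Event DOM THRD)) (i j : ℕ) : Prop :=
  ∃ a p q, (∃ t, StoreAt τ p t a i) ∧ (∃ t, StoreAt τ q t a j) ∧ p < q ∧
    ∀ k, p < k → k < q → ¬ ∃ t i', StoreAt τ k t a i'

/-- Position `l` of `τ` holds a load of thread `t` from address `a`. -/
def LoadAt (τ : List (Event DOM THRD)) (l : ℕ) (t : THRD) (a : DOM) : Prop :=
  ∃ v i, τ[l]? = some ⟨.ld t a v, i⟩

/-- The store `i` of thread `t` to address `a` is issued before position `l` of `τ` and reaches the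
memory after position `l`. -/
def PendingAt (τ : List (Event DOM THRD)) (l : ℕ) (t : THRD) (a : DOM) (i : ℕ) : Prop :=
  i < l ∧ ∃ q, l < q ∧ StoreAt τ q t a i

/-- Source relation: the load `l` reads from the store `i`. This is the latest issued pending store
of the own thread to the address, or, if there is none, the last store to the address that has
reached the memory. -/
def Src (τ : List (Event DOM THRD)) (i l : ℕ) : Prop :=
  ∃ t a, LoadAt τ l t a ∧
    ((PendingAt τ l t a i ∧ ∀ i', PendingAt τ l t a i' → i' ≤ i) ∨
      ((∀ i', ¬ PendingAt τ l t a i') ∧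
        ∃ p, p < l ∧ (∃ u, StoreAt τ p u a i) ∧
          ∀ k, p < k → k < l → ¬ ∃ u i', StoreAt τ k u a i'))

/-- Conflict relation: the store `j` overwrites the value read by the load `l`. -/
def Cf (τ : List (Event DOM THRD)) (l j : ℕ) : Prop :=
  (∃ i, Src τ i l ∧ St τ i j) ∨
    ((∃ a, (∃ t, LoadAt τ l t a) ∧ ∃ q u, StoreAt τ q u a j) ∧
      (¬ ∃ i, Src τ i l) ∧ ¬ ∃ i, St τ i j)

/-- The computations `τ` and `σ` have the same happens-before trace: there is a bijection between
the nodes that preserves the actions and each of the four happens-before relations. -/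
def SameTrace (τ σ : List (Event DOM THRD)) : Prop :=
  ∃ f : {i // IsNode τ i} ≃ {i // IsNode σ i},
    (∀ i x, NodeAct τ i.1 x ↔ NodeAct σ (f i).1 x) ∧
    (∀ i j, Po τ i.1 j.1 ↔ Po σ (f i).1 (f j).1) ∧
    (∀ i j, St τ i.1 j.1 ↔ St σ (f i).1 (f j).1) ∧
    (∀ i j, Src τ i.1 j.1 ↔ Src σ (f i).1 (f j).1) ∧
    (∀ i j, Cf τ i.1 j.1 ↔ Cf σ (f i).1 (f j).1)

end Traces

/-! ### Cost -/

section Cost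

variable {DOM THRD : Type*} [DecidableEq THRD]

/-- The events of `τ` strictly between the positions `i` and `p` that belong to thread `t`, as the
set of their positions. -/
def between (τ : List (Event DOM THRD)) (t : THRD) (i p : ℕ) : Finset ℕ :=
  (Finset.Ioo i p).filter fun k => ∃ e ∈ τ[k]?, e.thread = t

/-- The number of delays of the store or fence `e` at position `p`: the number of actions of its
own thread that it overtakes. -/
def delaysAt (τ : List (Event DOM THRD)) (p : ℕ) (e : Event DOM THRD) : ℕ :=
  (between τ e.thread e.iss p).card

/-- The number of reorders of the store or fence `e` at position `p`: the number of stores and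
fences of its own thread that it overtakes together with their issue. -/
def reordersAt (τ : List (Event DOM THRD)) (p : ℕ) (e : Event DOM THRD) : ℕ :=
  ((between τ e.thread e.iss p).filter fun q =>
    ∃ y ∈ τ[q]?, y.act.isIssued = true ∧ e.iss < y.iss).card

/-- Sum of `f p e` over all stores and fences `e` in `τ`, where `p` is the position of `e`. -/
def sumIssued (τ : List (Event DOM THRD)) (f : ℕ → Event DOM THRD → ℕ) : ℕ :=
  ∑ p : Fin τ.length, if τ[p].act.isIssued then f p τ[p] else 0

/-- The number of delays. -/
def delays (τ : List (Event DOM THRD)) : ℕ := sumIssued τ (delaysAt τ)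

/-- The number of reorders. -/
def reorders (τ : List (Event DOM THRD)) : ℕ := sumIssued τ (reordersAt τ)

/-- The cost of a computation; the triples are compared lexicographically. -/
def cost (τ : List (Event DOM THRD)) : ℕ ×ₗ ℕ ×ₗ ℕ :=
  toLex (delays τ, toLex (reorders τ, τ.length))

end Cost

/-! ### Violations -/

section Violations

variable {DOM THRD REG LAB : Type*} [Zero DOM] [DecidableEq DOM] [DecidableEq THRD]
  [DecidableEq REG]

/-- `τ` is a violation of robustness: a computation whose trace is not the trace of a sequentially
consistent computation. -/
def Program.IsViolation (P : Program DOM THRD REG LAB) (τ : List (Event DOM THRD)) : Prop :=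
  τ ∈ P.Computations ∧ ¬ ∃ σ ∈ P.SCComputations, SameTrace τ σ

/-- `τ` is a violation whose cost is minimal among all violations. -/
def Program.IsMinimalViolation (P : Program DOM THRD REG LAB) (τ : List (Event DOM THRD)) :
    Prop :=
  P.IsViolation τ ∧ ∀ σ, P.IsViolation σ → cost τ ≤ cost σ

end Violations

end StoreAtomic

set_option linter.unusedSectionVars false

namespace StoreAtomic

/-! Without `fence`, the order of the all-addresses buffers imposes nothing: a store may wait in its
per-address buffer until just before it reaches the memory. Each thread thus behaves as if it had
one FIFO buffer per address. Computations are therefore encoded as lists of tagged events satisfying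
`Valid` (`exists_valid`, `Valid.ev_mem_computations`); tags, unlike positions, survive
rearrangement. Adjacent events without a direct dependency `Dep` can be exchanged without changing
the trace (`Valid.swap`, `SameData.sameTrace`). The trace of an SC computation is acyclic, expressed
by a rank that increases along all four relations (`exists_ranked`); a tagged computation whose
trace has a cycle is hence a violation.

Let a minimal violation contain adjacent stores st₁ · st₂ of thread t, to a₁ and a₂. If st₂ was
issued first, then a₁ ≠ a₂ by FIFO order. Exchanging the stores keeps the trace, does not increase
the delays and decreases the reorders (`Bad.exchange_stores`).

Otherwise st₁ was issued first. Let y be the last non-store event of t before st₁; it lies after the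
issue of st₁. Let `clos` collect y and everything that transitively depends on it. If nothing there
conflicts with st₁, this set can be gathered directly before st₁ and st₁ moved ahead of it, which
saves a delay (`Bad.exists_lt`). So some event there conflicts with st₁. This rules out that y is
the issue of st₂, because nothing in between depends on an issue (`clos_issue`); both stores are
thus issued before y.

Let z be the first event of the closure that conflicts with a₁ or a₂; it belongs to another thread.
Call x that one of the two stores with which z conflicts, and let g be the oldest pending store of t
to the other address. If a₁ = a₂, let x be st₂ and g the oldest pending store to the common address.
Stop the computation before z, execute g, then z (rereading its value if it is a load), and drain
the remaining buffers (`Valid.truncate`). There are no more delays than before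
(`Valid.dl_truncate_le`), and y → … → z → x → y is a cycle in the trace, so this is again a
violation. By the choice of z, nothing in the closure of y before z conflicts with g. So g can move
ahead of y, which saves a delay (`Bad.exists_lt_of_conf`), against minimality. -/

/-- Occurrences of actions in a computation, identified by arbitrary tags instead of positions. A
store carries the tag of its issue, an issue shows the issued store, and a load shows the tag and
the value of the store it reads from. -/
inductive TEvent (DOM THRD : Type*) where
  | st (t : THRD) (a v : DOM) (k : ℕ)
  | ld (t : THRD) (a : DOM) (k : ℕ) (s : Option (ℕ × DOM))
  | isu (t : THRD) (a v : DOM) (k : ℕ)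
  | loc (t : THRD) (k : ℕ)
  | scf (t : THRD) (k : ℕ)

namespace TEvent

variable {DOM THRD : Type*}

/-- The thread of a tagged event. -/
def thread : TEvent DOM THRD → THRD
  | .st t _ _ _ => t
  | .ld t _ _ _ => t
  | .isu t _ _ _ => t
  | .loc t _ => t
  | .scf t _ => t

/-- The tag of a tagged event. -/
def tag : TEvent DOM THRD → ℕ
  | .st _ _ _ k => k
  | .ld _ _ k _ => k
  | .isu _ _ _ k => k
  | .loc _ k => k
  | .scf _ k => k

/-- The tagged event is a store. -/
def isStore : TEvent DOM THRD → Bool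
  | .st _ _ _ _ => true
  | _ => false

/-- The issue of a store. -/
def issue : TEvent DOM THRD → TEvent DOM THRD
  | .st t a v k => .isu t a v k
  | e => e

theorem isStore_issue (x : TEvent DOM THRD) : x.issue.isStore = false := by
  cases x <;> rfl

theorem tag_issue (x : TEvent DOM THRD) : x.issue.tag = x.tag := by
  cases x <;> rfl

theorem thread_issue (x : TEvent DOM THRD) : x.issue.thread = x.thread := by
  cases x <;> rfl

variable [DecidableEq DOM] [DecidableEq THRD]

/-- Tag and value of an issue of thread `t` for address `a`. -/
def issueAt (t : THRD) (a : DOM) : TEvent DOM THRD → Option (ℕ × DOM)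
  | .isu t' a' v k => if t' = t ∧ a' = a then some (k, v) else none
  | _ => none

/-- Tag and value of a store of thread `t` to address `a`. -/
def commitAt (t : THRD) (a : DOM) : TEvent DOM THRD → Option (ℕ × DOM)
  | .st t' a' v k => if t' = t ∧ a' = a then some (k, v) else none
  | _ => none

/-- Tag and value of a store to address `a`. -/
def storeAt (a : DOM) : TEvent DOM THRD → Option (ℕ × DOM)
  | .st _ a' v k => if a' = a then some (k, v) else none
  | _ => none

end TEvent

/-- The value of an optional source; memory initially contains `0`. -/
def srcVal {DOM : Type*} [Zero DOM] (s : Option (ℕ × DOM)) : DOM := s.elim 0 Prod.snd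

/-! ### Buffers, memory and projections of tagged computations -/

section Defs

variable {DOM THRD : Type*} [DecidableEq DOM] [DecidableEq THRD]

/-- The issues of thread `t` for address `a`. -/
def isus (t : THRD) (a : DOM) (L : List (TEvent DOM THRD)) : List (ℕ × DOM) :=
  L.filterMap (TEvent.issueAt t a)

/-- The stores of thread `t` to address `a`. -/
def coms (t : THRD) (a : DOM) (L : List (TEvent DOM THRD)) : List (ℕ × DOM) :=
  L.filterMap (TEvent.commitAt t a)

/-- The stores to address `a`. -/
def stores (a : DOM) (L : List (TEvent DOM THRD)) : List (ℕ × DOM) :=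
  L.filterMap (TEvent.storeAt a)

/-- The projection to the non-store events of thread `t`. -/
def prog (t : THRD) (L : List (TEvent DOM THRD)) : List (TEvent DOM THRD) :=
  L.filter fun e => !e.isStore && decide (e.thread = t)

/-- The pending stores of thread `t` to address `a` after `L`. -/
def buf (t : THRD) (a : DOM) (L : List (TEvent DOM THRD)) : List (ℕ × DOM) :=
  (isus t a L).drop (coms t a L).length

/-- The store that a load of thread `t` from address `a` reads from after `L`. -/
def read (t : THRD) (a : DOM) (L : List (TEvent DOM THRD)) : Option (ℕ × DOM) :=
  (buf t a L).getLast?.or (stores a L).getLast?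

/-- The event is compatible with the buffers and the memory after `L`. -/
def MemOK (L : List (TEvent DOM THRD)) : TEvent DOM THRD → Prop
  | .st t a v k => coms t a L ++ [(k, v)] <+: isus t a L
  | .ld t a _ s => s = read t a L
  | .scf t _ => ∀ a, buf t a L = []
  | _ => True

/-- All events of the second list, executed after the first, are compatible with the buffers and
the memory. -/
def MemRun : List (TEvent DOM THRD) → List (TEvent DOM THRD) → Prop
  | _, [] => True
  | L, e :: R => MemOK L e ∧ MemRun (L ++ [e]) R

/-- The tags of the non-store events. -/
def nodeTags (L : List (TEvent DOM THRD)) : List ℕ :=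
  (L.filter fun e => !e.isStore).map TEvent.tag

@[simp] theorem isus_nil (t : THRD) (a : DOM) : isus t a ([] : List (TEvent DOM THRD)) = [] := rfl
@[simp] theorem coms_nil (t : THRD) (a : DOM) : coms t a ([] : List (TEvent DOM THRD)) = [] := rfl
@[simp] theorem stores_nil (a : DOM) : stores a ([] : List (TEvent DOM THRD)) = [] := rfl
@[simp] theorem prog_nil (t : THRD) : prog t ([] : List (TEvent DOM THRD)) = [] := rfl

theorem isus_append (t : THRD) (a : DOM) (L R : List (TEvent DOM THRD)) :
    isus t a (L ++ R) = isus t a L ++ isus t a R := List.filterMap_append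
theorem coms_append (t : THRD) (a : DOM) (L R : List (TEvent DOM THRD)) :
    coms t a (L ++ R) = coms t a L ++ coms t a R := List.filterMap_append
theorem stores_append (a : DOM) (L R : List (TEvent DOM THRD)) :
    stores a (L ++ R) = stores a L ++ stores a R := List.filterMap_append
theorem prog_append (t : THRD) (L R : List (TEvent DOM THRD)) :
    prog t (L ++ R) = prog t L ++ prog t R := List.filter_append ..
theorem nodeTags_append (L R : List (TEvent DOM THRD)) :
    nodeTags (L ++ R) = nodeTags L ++ nodeTags R := by simp [nodeTags]

theorem isus_cons (t : THRD) (a : DOM) (e : TEvent DOM THRD) (R : List (TEvent DOM THRD)) :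
    isus t a (e :: R) = (e.issueAt t a).toList ++ isus t a R := by
  unfold isus; cases h : e.issueAt t a <;> simp [h]
theorem coms_cons (t : THRD) (a : DOM) (e : TEvent DOM THRD) (R : List (TEvent DOM THRD)) :
    coms t a (e :: R) = (e.commitAt t a).toList ++ coms t a R := by
  unfold coms; cases h : e.commitAt t a <;> simp [h]
theorem stores_cons (a : DOM) (e : TEvent DOM THRD) (R : List (TEvent DOM THRD)) :
    stores a (e :: R) = (e.storeAt a).toList ++ stores a R := by
  unfold stores; cases h : e.storeAt a <;> simp [h]

theorem mem_isus {t : THRD} {a : DOM} {L : List (TEvent DOM THRD)} {p : ℕ × DOM} :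
    p ∈ isus t a L ↔ TEvent.isu t a p.2 p.1 ∈ L := by
  unfold isus
  rw [List.mem_filterMap]
  constructor
  · rintro ⟨e, he, h⟩
    cases e <;> simp [TEvent.issueAt] at h
    obtain ⟨⟨rfl, rfl⟩, rfl⟩ := h
    exact he
  · intro h
    exact ⟨_, h, by simp [TEvent.issueAt]⟩

theorem mem_coms {t : THRD} {a : DOM} {L : List (TEvent DOM THRD)} {p : ℕ × DOM} :
    p ∈ coms t a L ↔ TEvent.st t a p.2 p.1 ∈ L := by
  unfold coms
  rw [List.mem_filterMap]
  constructor
  · rintro ⟨e, he, h⟩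
    cases e <;> simp [TEvent.commitAt] at h
    obtain ⟨⟨rfl, rfl⟩, rfl⟩ := h
    exact he
  · intro h
    exact ⟨_, h, by simp [TEvent.commitAt]⟩

theorem mem_stores {a : DOM} {L : List (TEvent DOM THRD)} {p : ℕ × DOM} :
    p ∈ stores a L ↔ ∃ t, TEvent.st t a p.2 p.1 ∈ L := by
  unfold stores
  rw [List.mem_filterMap]
  constructor
  · rintro ⟨e, he, h⟩
    cases e <;> simp [TEvent.storeAt] at h
    obtain ⟨rfl, rfl⟩ := h
    exact ⟨_, he⟩
  · rintro ⟨t, h⟩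
    exact ⟨_, h, by simp [TEvent.storeAt]⟩

theorem mem_prog {t : THRD} {L : List (TEvent DOM THRD)} {e : TEvent DOM THRD} :
    e ∈ prog t L ↔ e ∈ L ∧ e.isStore = false ∧ e.thread = t := by
  simp [prog]

theorem mem_nodeTags {L : List (TEvent DOM THRD)} {k : ℕ} :
    k ∈ nodeTags L ↔ ∃ e ∈ L, e.isStore = false ∧ e.tag = k := by
  simp [nodeTags, and_assoc]

/-- The two lists lead to the same buffers and the same memory. -/
structure SameMem (L L' : List (TEvent DOM THRD)) : Prop where
  isus : ∀ t a, isus t a L = isus t a L'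
  coms : ∀ t a, coms t a L = coms t a L'
  stores : ∀ a, stores a L = stores a L'

theorem SameMem.append {L L' : List (TEvent DOM THRD)} (h : SameMem L L')
    (R : List (TEvent DOM THRD)) : SameMem (L ++ R) (L' ++ R) :=
  ⟨fun t a => by simp [isus_append, h.isus], fun t a => by simp [coms_append, h.coms],
    fun a => by simp [stores_append, h.stores]⟩

theorem SameMem.buf {L L' : List (TEvent DOM THRD)} (h : SameMem L L') (t : THRD) (a : DOM) :
    buf t a L = buf t a L' := by
  simp [StoreAtomic.buf, h.isus, h.coms]

theorem SameMem.memOK {L L' : List (TEvent DOM THRD)} (h : SameMem L L') {e : TEvent DOM THRD}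
    (he : MemOK L e) : MemOK L' e := by
  cases e <;> simp only [MemOK, read] at he ⊢
  · rwa [← h.isus, ← h.coms]
  · rwa [← h.buf, ← h.stores]
  · simpa [← h.buf] using he

theorem SameMem.memRun {R : List (TEvent DOM THRD)} : ∀ {L L' : List (TEvent DOM THRD)},
    SameMem L L' → MemRun L R → MemRun L' R := by
  induction R with
  | nil => intros; trivial
  | cons e R ih => exact fun h hr => ⟨h.memOK hr.1, ih (h.append [e]) hr.2⟩

theorem memRun_append {A B : List (TEvent DOM THRD)} : ∀ {L : List (TEvent DOM THRD)},
    MemRun L (A ++ B) ↔ MemRun L A ∧ MemRun (L ++ A) B := by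
  induction A with
  | nil => simp [MemRun]
  | cons e A ih => intro L; simp [MemRun, ih, and_assoc]

/-- `MemOK` lets only the oldest pending issue of a buffer reach the memory. This is why `buf` may
simply drop as many issues as there are stores. -/
theorem coms_prefix_isus {L : List (TEvent DOM THRD)} (h : MemRun [] L) (t : THRD) (a : DOM) :
    coms t a L <+: isus t a L := by
  induction L using List.reverseRecOn with
  | nil => simp
  | append_singleton L e ih =>
    rw [memRun_append] at h
    have ih := ih h.1
    have he : MemOK L e := by simpa [MemRun] using h.2
    rw [coms_append, isus_append]
    cases e with
    | st t' a' v k =>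
      by_cases hc : t' = t ∧ a' = a
      · obtain ⟨rfl, rfl⟩ := hc
        simpa [coms_cons, isus_cons, TEvent.commitAt, TEvent.issueAt, MemOK] using he
      · simpa [coms_cons, isus_cons, TEvent.commitAt, TEvent.issueAt, hc] using ih
    | _ => simpa [coms_cons, TEvent.commitAt] using ih.trans (List.prefix_append _ _)

theorem isus_eq_coms_append_buf {L : List (TEvent DOM THRD)} (h : MemRun [] L) (t : THRD)
    (a : DOM) : isus t a L = coms t a L ++ buf t a L := by
  obtain ⟨β, hβ⟩ := coms_prefix_isus h t a
  rw [buf, ← hβ]; simp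

theorem buf_eq_of_append {L : List (TEvent DOM THRD)} {t : THRD} {a : DOM} {β : List (ℕ × DOM)}
    (h : isus t a L = coms t a L ++ β) : buf t a L = β := by
  rw [buf, h]; simp

end Defs

/-! ### Local execution of threads, and valid tagged computations -/

section Exec

variable {DOM THRD REG LAB : Type*} [Zero DOM] [DecidableEq DOM] [DecidableEq THRD]
  [DecidableEq REG]

/-- A step of a single thread. -/
inductive LStep (P : Program DOM THRD REG LAB) (t : THRD) :
    LAB → (REG → DOM) → TEvent DOM THRD → LAB → (REG → DOM) → Prop
  | load {l l' : LAB} {ρ : REG → DOM} {r : REG} {e : Expr DOM REG} (k : ℕ)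
      (s : Option (ℕ × DOM)) (h : (⟨l, .load r e, l'⟩ : LInstr DOM REG LAB) ∈ P.code t) :
      LStep P t l ρ (.ld t (e.eval ρ) k s) l' (Function.update ρ r (srcVal s))
  | store {l l' : LAB} {ρ : REG → DOM} {e e' : Expr DOM REG} (k : ℕ)
      (h : (⟨l, .store e e', l'⟩ : LInstr DOM REG LAB) ∈ P.code t) :
      LStep P t l ρ (.isu t (e.eval ρ) (e'.eval ρ) k) l' ρ
  | assign {l l' : LAB} {ρ : REG → DOM} {r : REG} {e : Expr DOM REG} (k : ℕ)
      (h : (⟨l, .assign r e, l'⟩ : LInstr DOM REG LAB) ∈ P.code t) :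
      LStep P t l ρ (.loc t k) l' (Function.update ρ r (e.eval ρ))
  | assert {l l' : LAB} {ρ : REG → DOM} {e : Expr DOM REG} (k : ℕ)
      (h : (⟨l, .assert e, l'⟩ : LInstr DOM REG LAB) ∈ P.code t) (he : e.eval ρ ≠ 0) :
      LStep P t l ρ (.loc t k) l' ρ
  | scfence {l l' : LAB} {ρ : REG → DOM} (k : ℕ)
      (h : (⟨l, .scfence, l'⟩ : LInstr DOM REG LAB) ∈ P.code t) :
      LStep P t l ρ (.scf t k) l' ρ

/-- A thread can execute the given non-store events from the given local state. -/
def Exec (P : Program DOM THRD REG LAB) (t : THRD) :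
    LAB → (REG → DOM) → List (TEvent DOM THRD) → Prop
  | _, _, [] => True
  | l, ρ, e :: w => ∃ l' ρ', LStep P t l ρ e l' ρ' ∧ Exec P t l' ρ' w

theorem Exec.of_append {P : Program DOM THRD REG LAB} {t : THRD} {w w' : List (TEvent DOM THRD)} :
    ∀ {l ρ}, Exec P t l ρ (w ++ w') → Exec P t l ρ w := by
  induction w with
  | nil => intros; trivial
  | cons e w ih =>
    rintro l ρ ⟨l', ρ', hs, h⟩
    exact ⟨l', ρ', hs, ih h⟩

/-- The value read only affects the registers after the load, and no later event of the thread
inspects them. A truncated computation may thus end with a load whose source has changed. -/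
theorem Exec.change_last_load {P : Program DOM THRD REG LAB} {t : THRD} {a : DOM} {k : ℕ}
    {s : Option (ℕ × DOM)} (s' : Option (ℕ × DOM)) {w : List (TEvent DOM THRD)} :
    ∀ {l ρ}, Exec P t l ρ (w ++ [.ld t a k s]) → Exec P t l ρ (w ++ [.ld t a k s']) := by
  induction w with
  | nil =>
    rintro l ρ ⟨l', ρ', hs, -⟩
    cases hs with
    | load _ _ h => exact ⟨_, _, .load k s' h, trivial⟩
  | cons e w ih =>
    rintro l ρ ⟨l', ρ', hs, h⟩
    exact ⟨l', ρ', hs, ih h⟩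

/-- The tagged computations. -/
structure Valid (P : Program DOM THRD REG LAB) (V : List (TEvent DOM THRD)) : Prop where
  exec : ∀ t, Exec P t (P.init t) (fun _ => 0) (prog t V)
  mem : MemRun [] V
  nodup : (nodeTags V).Nodup
  complete : ∀ t a, coms t a V = isus t a V

end Exec

/-! ### Exchanging adjacent independent events -/

section Swap

variable {DOM THRD : Type*} [DecidableEq DOM] [DecidableEq THRD]

/-- Thread `t` has no pending store to `a` after the events in `C`. -/
def NoPend (C : List (TEvent DOM THRD)) (t : THRD) (a : DOM) : Prop :=
  ∀ p ∈ isus t a C, p ∈ coms t a C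

/-- The event is a store to `a`, or a load from `a` whose source has reached the memory in `C`. -/
def Conf (C : List (TEvent DOM THRD)) (a : DOM) : TEvent DOM THRD → Prop
  | .st _ a' _ _ => a' = a
  | .ld _ a' _ s => a' = a ∧ ∀ p, s = some p → p ∈ stores a C
  | _ => False

/-- The event `e`, executed after the events in `C`, directly depends on the event `d` of `C`. -/
def Dep (C : List (TEvent DOM THRD)) (d : TEvent DOM THRD) : TEvent DOM THRD → Prop
  | .st t a v k => d = .isu t a v k ∨ (Conf C a d ∧ (d.isStore = true ∨ d.thread ≠ t))
  | .ld t a _ _ => d.thread = t ∨ (NoPend C t a ∧ ∃ p, d.storeAt a = some p)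
  | e => d.thread = e.thread

theorem not_noPend_iff {L : List (TEvent DOM THRD)} (h : MemRun [] L) {t : THRD} {a : DOM}
    (hp : ¬ NoPend L t a) : buf t a L ≠ [] := by
  intro hb
  apply hp
  intro p hp
  rwa [isus_eq_coms_append_buf h, hb, List.append_nil] at hp

theorem buf_congr {t : THRD} {a : DOM} {L L' : List (TEvent DOM THRD)}
    (h : isus t a L = isus t a L') (h' : coms t a L = coms t a L') : buf t a L = buf t a L' := by
  rw [buf, buf, h, h']

theorem issueAt_of_thread_ne {t : THRD} {a : DOM} {e : TEvent DOM THRD} (h : e.thread ≠ t) :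
    e.issueAt t a = none := by
  cases e <;> simp_all [TEvent.issueAt, TEvent.thread]

theorem commitAt_of_thread_ne {t : THRD} {a : DOM} {e : TEvent DOM THRD} (h : e.thread ≠ t) :
    e.commitAt t a = none := by
  cases e <;> simp_all [TEvent.commitAt, TEvent.thread]

theorem isus_concat_of_thread_ne {t : THRD} {a : DOM} {e : TEvent DOM THRD}
    (L : List (TEvent DOM THRD)) (h : e.thread ≠ t) : isus t a (L ++ [e]) = isus t a L := by
  simp [isus_append, isus_cons, issueAt_of_thread_ne h]

theorem coms_concat_of_thread_ne {t : THRD} {a : DOM} {e : TEvent DOM THRD}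
    (L : List (TEvent DOM THRD)) (h : e.thread ≠ t) : coms t a (L ++ [e]) = coms t a L := by
  simp [coms_append, coms_cons, commitAt_of_thread_ne h]

theorem buf_concat_of_thread_ne {t : THRD} {a : DOM} {e : TEvent DOM THRD}
    (L : List (TEvent DOM THRD)) (h : e.thread ≠ t) : buf t a (L ++ [e]) = buf t a L :=
  buf_congr (isus_concat_of_thread_ne L h) (coms_concat_of_thread_ne L h)

theorem stores_concat_of_storeAt {a : DOM} {e : TEvent DOM THRD}
    (L : List (TEvent DOM THRD)) (h : e.storeAt a = none) : stores a (L ++ [e]) = stores a L := by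
  simp [stores_append, stores_cons, h]

/-- A pending store of the own thread shields a load from the memory, so that stores of other
threads are invisible to it. -/
theorem read_concat {t : THRD} {a : DOM} {e : TEvent DOM THRD} {L : List (TEvent DOM THRD)}
    (h : e.thread ≠ t) (hs : e.storeAt a = none ∨ buf t a L ≠ []) :
    read t a (L ++ [e]) = read t a L := by
  unfold read
  rw [buf_concat_of_thread_ne L h]
  rcases hs with hs | hs
  · rw [stores_concat_of_storeAt L hs]
  · obtain ⟨x, hx⟩ := Option.ne_none_iff_exists'.1 (mt List.getLast?_eq_none_iff.1 hs)
    simp [hx]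

/-- A store to `a` of the own thread does not change what loads from `a` read. -/
theorem read_commit {L : List (TEvent DOM THRD)} {t : THRD} {a v : DOM} {k : ℕ}
    (h : MemRun [] L) (hs : MemOK L (.st t a v k)) :
    read t a (L ++ [.st t a v k]) = read t a L := by
  have h1 := isus_eq_coms_append_buf h t a
  obtain ⟨β, hβ⟩ := hs
  have h2 : buf t a L = (k, v) :: β := by
    apply buf_eq_of_append; rw [← hβ]; simp
  have h3 : buf t a (L ++ [.st t a v k]) = β := by
    apply buf_eq_of_append
    simp [isus_append, coms_append, isus_cons, coms_cons, TEvent.issueAt, TEvent.commitAt, ← hβ]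
  unfold read
  rw [h2, h3]
  -- If the store was the only pending one, it is afterwards the last store in memory; otherwise the
  -- youngest pending store is unaffected.
  rcases List.eq_nil_or_concat β with rfl | ⟨β', x, rfl⟩
  · simp [stores_append, stores_cons, TEvent.storeAt]
  · simp [List.getLast?_cons]

theorem read_commit_other {L : List (TEvent DOM THRD)} {t u : THRD} {a b v : DOM} {k : ℕ}
    (hab : b ≠ a) : read t a (L ++ [.st u b v k]) = read t a L := by
  simp [read, buf, stores_append, stores_cons, TEvent.storeAt, isus_append, coms_append,
    isus_cons, coms_cons, TEvent.issueAt, TEvent.commitAt, hab]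

/-- If `e` is a store, loads of its own thread do not matter, since committing a visible store turns
forwarding into a memory read of the same source (`read_commit`). A load of another thread matters
only if it reads from memory, hence the condition on the source in `Conf`. If `e` is not a store,
independence forces different threads, so neither event touches the buffers of the other; only a
memory read after a store to the same address needs care, and `Dep` excludes it. -/
theorem memOK_swap {L : List (TEvent DOM THRD)} {d e : TEvent DOM THRD} (hL : MemRun [] L)
    (hd : MemOK L d) (he : MemOK (L ++ [d]) e) (hi : ¬ Dep L d e) :
    MemOK L e ∧ MemOK (L ++ [e]) d := by
  by_cases hs : e.isStore = true
  · cases e with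
    | st t a v k =>
      simp only [Dep, not_or, not_and] at hi
      obtain ⟨hi1, hi2⟩ := hi
      have hdc : d.commitAt t a = none := by
        cases d <;> simp [TEvent.commitAt]
        rintro rfl rfl
        simp [Conf, TEvent.isStore] at hi2
      have he' : MemOK L (.st t a v k) := by
        simp only [MemOK, coms_append, isus_append, coms_cons, isus_cons, hdc] at he ⊢
        cases hdi : d.issueAt t a with
        | none => simpa [hdi] using he
        | some p =>
          simp only [hdi, Option.toList, isus_nil, coms_nil, List.append_nil] at he
          -- In the case of equality, `e` would be the store issued by `d` itself.
          rcases List.prefix_concat_iff.1 he with h | h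
          · exfalso
            apply hi1
            have := (List.append_inj' h rfl).2
            simp only [List.cons.injEq, and_true] at this
            subst this
            cases d <;> simp [TEvent.issueAt] at hdi
            obtain ⟨⟨rfl, rfl⟩, rfl, rfl⟩ := hdi
            rfl
          · exact h
      refine ⟨he', ?_⟩
      cases d with
      | st u b w j =>
        have hab : a ≠ b := by
          rintro rfl
          simp [Conf, TEvent.isStore] at hi2
        simpa [MemOK, coms_append, isus_append, coms_cons, isus_cons, TEvent.commitAt,
          TEvent.issueAt, hab] using hd
      | ld u b j s =>
        simp only [MemOK] at hd ⊢
        by_cases hab : a = b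
        · subst hab
          by_cases hut : u = t
          · subst hut
            rw [read_commit hL he', hd]
          · rw [read_concat (by simpa [TEvent.thread] using Ne.symm hut) (Or.inr ?_), hd]
            intro hb
            refine (hi2 ⟨rfl, ?_⟩).2 hut
            rintro p rfl
            rw [read, hb] at hd
            exact List.mem_of_getLast? hd.symm
        · rw [read_commit_other hab, hd]
      | scf u j =>
        intro b
        have hb := hd b
        by_cases hut : t = u ∧ a = b
        · obtain ⟨rfl, rfl⟩ := hut
          obtain ⟨β, hβ⟩ := he'
          have h2 : buf t a L = (k, v) :: β := by
            apply buf_eq_of_append; rw [← hβ]; simp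
          simp [h2] at hb
        · rw [← hb]
          apply buf_congr <;>
          simp [isus_append, isus_cons, coms_append, coms_cons, TEvent.issueAt, TEvent.commitAt,
            hut]
      | _ => trivial
    | _ => simp [TEvent.isStore] at hs
  · have hte : d.thread ≠ e.thread := by
      cases e <;> simp_all [Dep, TEvent.thread, TEvent.isStore]
    have hes : ∀ a, e.storeAt a = none := by
      cases e <;> simp_all [TEvent.storeAt, TEvent.isStore]
    constructor
    · cases e with
      | st => simp [TEvent.isStore] at hs
      | ld t a k s =>
        simp only [MemOK] at he ⊢
        rw [he]
        apply read_concat hte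
        by_cases hn : NoPend L t a
        · left
          simp only [Dep, not_or, not_and, not_exists] at hi
          exact Option.eq_none_iff_forall_ne_some.2 (hi.2 hn)
        · exact Or.inr (not_noPend_iff hL hn)
      | scf t k =>
        intro a
        exact (buf_concat_of_thread_ne (t := t) L hte).symm.trans (he a)
      | _ => trivial
    · cases d with
      | st u b w j =>
        simpa only [MemOK, coms_concat_of_thread_ne (t := u) L hte.symm,
          isus_concat_of_thread_ne (t := u) L hte.symm] using hd
      | ld u b j s =>
        simp only [MemOK] at hd ⊢
        rw [hd, read_concat (t := u) hte.symm (Or.inl (hes b))]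
      | scf u j =>
        intro a
        exact (buf_concat_of_thread_ne (t := u) L hte.symm).trans (hd a)
      | _ => trivial

theorem filterMap_swap {α β : Type*} {f : α → Option β} {d e : α} (A R : List α)
    (h : f d = none ∨ f e = none) :
    (A ++ d :: e :: R).filterMap f = (A ++ e :: d :: R).filterMap f := by
  rcases h with h | h <;> simp [List.filterMap_cons, h]

theorem filter_swap {α : Type*} {f : α → Bool} {d e : α} (A R : List α)
    (h : f d = false ∨ f e = false) :
    (A ++ d :: e :: R).filter f = (A ++ e :: d :: R).filter f := by
  rcases h with h | h <;> simp [List.filter_cons, h]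

/-- Two tagged computations that agree on everything the happens-before trace depends on. -/
structure SameData (V V' : List (TEvent DOM THRD)) : Prop where
  perm : V.Perm V'
  prog : ∀ t, prog t V = prog t V'
  stores : ∀ a, stores a V = stores a V'

/-- Two non-store events of one thread, and two stores to one address, always depend on each other.
So each projection sees at most one of two independent events. -/
theorem sameData_swap {L R : List (TEvent DOM THRD)} {d e : TEvent DOM THRD}
    (hi : ¬ Dep L d e) : SameData (L ++ d :: e :: R) (L ++ e :: d :: R) := by
  refine ⟨(List.Perm.swap _ _ _).append_left _, fun t => filter_swap _ _ ?_,
    fun a => filterMap_swap _ _ ?_⟩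
  · cases e <;> simp [TEvent.isStore, TEvent.thread, Dep] at hi ⊢
    all_goals grind
  · cases e <;> cases d <;> simp [TEvent.storeAt, TEvent.isStore, Dep, Conf] at hi ⊢
    grind

theorem sameMem_swap {L : List (TEvent DOM THRD)} {d e : TEvent DOM THRD}
    (hi : ¬ Dep L d e) : SameMem (L ++ [d, e]) (L ++ [e, d]) := by
  refine ⟨fun t a => filterMap_swap _ _ ?_, fun t a => filterMap_swap _ _ ?_,
    (sameData_swap (R := []) hi).stores⟩
  · cases e <;> cases d <;>
      simp [TEvent.issueAt, TEvent.thread, Dep] at hi ⊢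
    all_goals grind
  · cases e <;> cases d <;>
      simp [TEvent.commitAt, TEvent.isStore, Dep, Conf] at hi ⊢
    all_goals grind

variable {REG LAB : Type*} [Zero DOM] [DecidableEq REG]

theorem Valid.swap {P : Program DOM THRD REG LAB} {L R : List (TEvent DOM THRD)}
    {d e : TEvent DOM THRD} (h : Valid P (L ++ d :: e :: R)) (hi : ¬ Dep L d e) :
    Valid P (L ++ e :: d :: R) := by
  have hD := sameData_swap (R := R) hi
  have hM := sameMem_swap hi
  refine ⟨fun t => hD.prog t ▸ h.exec t, ?_, ?_, fun t a => ?_⟩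
  · have hm := h.mem
    simp only [memRun_append, MemRun, List.nil_append] at hm ⊢
    obtain ⟨h1, h2, h3, h4⟩ := hm
    obtain ⟨h5, h6⟩ := memOK_swap h1 h2 h3 hi
    refine ⟨h1, h5, h6, SameMem.memRun ?_ h4⟩
    simpa using hM
  · exact (((hD.perm.filter _).map _).nodup_iff).1 h.nodup
  · have h1 := (hM.append R).coms t a
    have h2 := (hM.append R).isus t a
    simp only [List.append_assoc, List.cons_append, List.nil_append] at h1 h2
    rw [← h1, ← h2, h.complete]

end Swap

/-! ### Tagged computations and the operational semantics -/

/-- The action of a tagged event. -/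
def TEvent.act {DOM THRD : Type*} [Zero DOM] : TEvent DOM THRD → Act DOM THRD
  | .st t a v _ => .st t a v
  | .ld t a _ s => .ld t a (srcVal s)
  | .isu t _ _ _ => .isu t
  | .loc t _ => .loc t
  | .scf t _ => .scfence t

section Relabel

variable {DOM THRD : Type*} [Zero DOM] [DecidableEq DOM] [DecidableEq THRD]

/-- The events of a tagged computation, with tags replaced according to `r`. -/
def relabel (r : ℕ → ℕ) (V : List (TEvent DOM THRD)) : List (Event DOM THRD) :=
  V.map fun e => ⟨e.act, r e.tag⟩

/-- `r` maps the tags of the non-store events to their positions. -/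
def PosTag (r : ℕ → ℕ) (V : List (TEvent DOM THRD)) : Prop :=
  ∀ (n : ℕ) (e : TEvent DOM THRD), V[n]? = some e → e.isStore = false → r e.tag = n

/-- The position of the non-store event with the given tag. -/
def pos (V : List (TEvent DOM THRD)) (k : ℕ) : ℕ :=
  V.findIdx fun e => !e.isStore && e.tag == k

/-- The events of a tagged computation. -/
def ev (V : List (TEvent DOM THRD)) : List (Event DOM THRD) := relabel (pos V) V

theorem PosTag.pairwise {r : ℕ → ℕ} {V : List (TEvent DOM THRD)} (h : PosTag r V) :
    V.Pairwise fun x y => x.isStore = false → y.isStore = false → r x.tag < r y.tag := by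
  rw [List.pairwise_iff_getElem]
  intro i j hi hj hij hx hy
  rw [h i _ (List.getElem?_eq_getElem hi) hx, h j _ (List.getElem?_eq_getElem hj) hy]
  exact hij

theorem PosTag.nodup {r : ℕ → ℕ} {V : List (TEvent DOM THRD)} (h : PosTag r V) :
    (nodeTags V).Nodup := by
  unfold nodeTags List.Nodup
  rw [List.pairwise_map, List.pairwise_filter]
  refine h.pairwise.imp fun {x y} hxy hx hy he => ?_
  have := hxy (by simpa using hx) (by simpa using hy)
  rw [he] at this
  exact lt_irrefl _ this

theorem posTag_pos {V : List (TEvent DOM THRD)} (h : (nodeTags V).Nodup) : PosTag (pos V) V := by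
  intro n e hn he
  obtain ⟨hlt, hn⟩ := List.getElem?_eq_some_iff.1 hn
  unfold pos
  rw [List.findIdx_eq hlt]
  refine ⟨by simp [hn, he], fun j hj => ?_⟩
  by_contra hc
  simp only [Bool.not_eq_false, Bool.and_eq_true, Bool.not_eq_true', beq_iff_eq] at hc
  unfold nodeTags List.Nodup at h
  rw [List.pairwise_map, List.pairwise_filter, List.pairwise_iff_getElem] at h
  exact h j n (hj.trans hlt) hlt hj (by simp [hc.1]) (by simp [hn, he]) (by rw [hc.2, hn])

theorem relabel_append (r : ℕ → ℕ) (L R : List (TEvent DOM THRD)) :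
    relabel r (L ++ R) = relabel r L ++ relabel r R := by simp [relabel]

theorem length_relabel (r : ℕ → ℕ) (L : List (TEvent DOM THRD)) :
    (relabel r L).length = L.length := by simp [relabel]

theorem getElem?_relabel (r : ℕ → ℕ) (L : List (TEvent DOM THRD)) (n : ℕ) :
    (relabel r L)[n]? = (L[n]?).map fun e => ⟨e.act, r e.tag⟩ := by simp [relabel]

end Relabel

section Bridge

variable {DOM THRD REG LAB : Type*} [Zero DOM] [DecidableEq DOM] [DecidableEq THRD]
  [DecidableEq REG]

theorem isus_concat (t : THRD) (a : DOM) (L : List (TEvent DOM THRD)) (e : TEvent DOM THRD) :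
    isus t a (L ++ [e]) = isus t a L ++ (e.issueAt t a).toList := by
  simp [isus_append, isus_cons]

theorem coms_concat (t : THRD) (a : DOM) (L : List (TEvent DOM THRD)) (e : TEvent DOM THRD) :
    coms t a (L ++ [e]) = coms t a L ++ (e.commitAt t a).toList := by
  simp [coms_append, coms_cons]

theorem stores_concat (a : DOM) (L : List (TEvent DOM THRD)) (e : TEvent DOM THRD) :
    stores a (L ++ [e]) = stores a L ++ (e.storeAt a).toList := by
  simp [stores_append, stores_cons]

theorem buf_concat_of_none {t : THRD} {a : DOM} {e : TEvent DOM THRD} (L : List (TEvent DOM THRD))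
    (h : e.issueAt t a = none) (h' : e.commitAt t a = none) : buf t a (L ++ [e]) = buf t a L :=
  buf_congr (by simp [isus_concat, h]) (by simp [coms_concat, h'])

/-- The operational state after the tagged events `L`, with all buffered stores in the per-address
buffers. -/
structure Sim (r : ℕ → ℕ) (L : List (TEvent DOM THRD)) (s : State DOM THRD REG LAB) : Prop where
  mem : ∀ a, s.mem a = srcVal (stores a L).getLast?
  buf₁ : ∀ t a, s.buf₁ t a = (buf t a L).map fun p => (r p.1, p.2)
  buf₂ : ∀ t, s.buf₂ t = []

theorem Sim.loc {r : ℕ → ℕ} {L : List (TEvent DOM THRD)} {s s' : State DOM THRD REG LAB}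
    (h : Sim r L s) (e : TEvent DOM THRD) (hi : ∀ t a, e.issueAt t a = none)
    (hc : e.isStore = false) (hm : s'.mem = s.mem) (h₁ : s'.buf₁ = s.buf₁)
    (h₂ : s'.buf₂ = s.buf₂) : Sim r (L ++ [e]) s' := by
  refine ⟨fun a => ?_, fun t a => ?_, fun t => by rw [h₂, h.buf₂]⟩
  · rw [hm, h.mem, stores_concat_of_storeAt]
    cases e <;> simp_all [TEvent.storeAt, TEvent.isStore]
  · rw [h₁, h.buf₁, buf_concat_of_none L (hi t a)]
    cases e <;> simp_all [TEvent.commitAt, TEvent.isStore]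

/-- The simulating run keeps all all-addresses buffers empty between events: a store is advanced and
written to memory in two consecutive transitions. Induction on the executed prefix, carrying along
that every thread can still execute the rest. -/
theorem run_of_valid {P : Program DOM THRD REG LAB} {r : ℕ → ℕ} {V : List (TEvent DOM THRD)}
    (hr : PosTag r V) (hV : Valid P V) (L : List (TEvent DOM THRD)) :
    ∀ R, V = L ++ R → ∃ s, Run P (relabel r L) s ∧ Sim r L s ∧
      ∀ t, Exec P t (s.pc t) (s.reg t) (prog t R) := by
  induction L using List.reverseRecOn with
  | nil =>
    rintro R rfl
    refine ⟨P.initState, Run.nil, ⟨fun a => rfl, fun t a => rfl, fun t => rfl⟩, ?_⟩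
    simpa [Program.initState] using hV.exec
  | append_singleton L e ih =>
    intro R hR
    obtain ⟨s, hs, hsim, hex⟩ := ih (e :: R) (by simpa using hR)
    have hm := hV.mem
    rw [hR, List.append_assoc, memRun_append] at hm
    have hL := hm.1
    have he : MemOK L e := by simpa [MemRun] using hm.2.1
    have hn : e.isStore = false → r e.tag = L.length := fun h =>
      hr _ e (by rw [hR]; simp) h
    have hlen := length_relabel r L
    have hrun : ∀ s', Step P (relabel r L).length s (some ⟨e.act, r e.tag⟩) s' →
        Run P (relabel r (L ++ [e])) s' := by
      intro s' h
      rw [relabel_append]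
      exact hs.snoc h
    have hex' : ∀ (l : LAB) (ρ : REG → DOM), e.isStore = false →
        Exec P e.thread l ρ (prog e.thread R) →
        ∀ t, Exec P t (Function.update s.pc e.thread l t) (Function.update s.reg e.thread ρ t)
          (prog t R) := by
      intro l ρ hes h t
      by_cases ht : t = e.thread
      · subst ht; simpa using h
      · have := hex t
        simpa [ht, prog, hes, List.filter_cons, Ne.symm ht] using this
    have hext : e.isStore = false → Exec P e.thread (s.pc e.thread) (s.reg e.thread)
        (e :: prog e.thread R) := by
      intro hes
      simpa [prog, hes] using hex e.thread
    cases e with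
    | st t a v k =>
      obtain ⟨β, hβ⟩ := he
      have hb : buf t a L = (k, v) :: β := by
        apply buf_eq_of_append; rw [← hβ]; simp
      have hb1 : s.buf₁ t a = (r k, v) :: β.map fun p => (r p.1, p.2) := by
        rw [hsim.buf₁, hb]; rfl
      have h1 : Run P (relabel r L) _ := hs.silent (Step.advanceBuffer hb1)
      refine ⟨(((s.setBuf₁ t a (β.map fun p => (r p.1, p.2))).setBuf₂ t
        (s.buf₂ t ++ [Entry.store (r k) a v])).setMem a v).setBuf₂ t [], ?_,
        ⟨fun b => ?_, fun u b => ?_, fun u => ?_⟩, fun u => ?_⟩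
      · rw [relabel_append]
        refine h1.snoc (Step.storeToMemory (β := []) ?_)
        simp [State.setBuf₁, State.setBuf₂, hsim.buf₂, TEvent.tag]
      · simp only [State.setBuf₁, State.setBuf₂, State.setMem]
        rw [stores_concat]
        by_cases hab : b = a
        · subst hab; simp [TEvent.storeAt, srcVal]
        · simp [TEvent.storeAt, hab, Ne.symm hab, hsim.mem]
      · simp only [State.setBuf₁, State.setBuf₂, State.setMem]
        by_cases hut : u = t ∧ b = a
        · obtain ⟨rfl, rfl⟩ := hut
          have : buf u b (L ++ [.st u b v k]) = β := by
            apply buf_eq_of_append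
            simp [isus_concat, coms_concat, TEvent.issueAt, TEvent.commitAt, ← hβ]
          simp [this]
        · rw [buf_concat_of_none L (by simp [TEvent.issueAt])
            (by simp [TEvent.commitAt, Ne.symm, eq_comm] at hut ⊢; tauto), ← hsim.buf₁]
          by_cases hu : u = t
          · subst hu
            have hb : b ≠ a := fun h => hut ⟨rfl, h⟩
            simp [hb]
          · simp [hu]
      · by_cases hu : u = t
        · subst hu; simp [State.setBuf₁, State.setBuf₂, State.setMem]
        · simp [State.setBuf₁, State.setBuf₂, State.setMem, hu, hsim.buf₂]
      · have : prog u (TEvent.st t a v k :: R) = prog u R := rfl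
        exact this ▸ hex u
    | ld t a k s₀ =>
      obtain ⟨l', ρ', hst, hex2⟩ := hext rfl
      simp only [TEvent.thread] at hst
      cases hst with
      | @load _ _ x e _ _ h =>
        simp only [MemOK] at he
        refine ⟨(s.setReg t x (srcVal s₀)).goto t l', hrun _ ?_,
          hsim.loc _ (fun _ _ => rfl) rfl rfl rfl rfl, hex' _ _ rfl hex2⟩
        simp only [TEvent.act, TEvent.tag] at hn ⊢
        rw [hn rfl, ← hlen]
        rcases List.eq_nil_or_concat (buf t (e.eval (s.reg t)) L) with hb | ⟨β, p, hb⟩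
        · refine Step.readMemory (l := l') h rfl (by simp [hsim.buf₁, hb]) (by simp [hsim.buf₂]) ?_
          rw [hsim.mem, he, read, hb]
          simp
        · have : srcVal s₀ = p.2 := by rw [he, read, hb]; simp [srcVal]
          rw [this]
          exact Step.earlyRead₁ (l := l') (i := r p.1) (β := β.map fun p => (r p.1, p.2))
            h rfl (by simp [hsim.buf₁, hb])
    | isu t a v k =>
      obtain ⟨l', ρ', hst, hex2⟩ := hext rfl
      simp only [TEvent.thread] at hst
      cases hst with
      | @store _ _ e e' _ h =>
        refine ⟨(s.setBuf₁ t (e.eval (s.reg t)) (s.buf₁ t (e.eval (s.reg t)) ++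
          [((relabel r L).length, e'.eval (s.reg t))])).goto t l', hrun _ ?_,
          ⟨fun b => ?_, fun u b => ?_, fun u => ?_⟩, fun u => ?_⟩
        · simp only [TEvent.act, TEvent.tag] at hn ⊢
          rw [hn rfl, ← hlen]
          exact Step.issueStore (l := l') h rfl rfl
        · simpa [State.setBuf₁, State.goto, stores_concat, TEvent.storeAt] using hsim.mem b
        · simp only [State.setBuf₁, State.goto]
          by_cases hut : u = t ∧ b = e.eval (s.reg t)
          · obtain ⟨rfl, rfl⟩ := hut
            have : buf u (e.eval (s.reg u)) (L ++ [.isu u (e.eval (s.reg u)) (e'.eval (s.reg u)) k])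
                = buf u (e.eval (s.reg u)) L ++ [(k, e'.eval (s.reg u))] := by
              apply buf_eq_of_append
              simp [isus_concat, coms_concat, TEvent.issueAt, TEvent.commitAt,
                isus_eq_coms_append_buf hL]
            simp only [Function.update_self, this, hsim.buf₁]
            simp only [TEvent.tag] at hn
            simp [hn rfl, hlen]
          · rw [buf_concat_of_none L (by simp [TEvent.issueAt, eq_comm] at hut ⊢; tauto)
              (by simp [TEvent.commitAt]), ← hsim.buf₁]
            by_cases hu : u = t
            · subst hu
              have hb : b ≠ e.eval (s.reg u) := fun h => hut ⟨rfl, h⟩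
              simp [hb]
            · simp [hu]
        · simpa [State.setBuf₁, State.goto] using hsim.buf₂ u
        · have := hex' l' _ rfl hex2 u
          simpa [State.setBuf₁, State.goto, TEvent.thread] using this
    | loc t k =>
      obtain ⟨l', ρ', hst, hex2⟩ := hext rfl
      simp only [TEvent.thread, TEvent.act, TEvent.tag] at hst hn hrun
      rw [hn rfl, ← hlen] at hrun
      cases hst with
      | @assign _ _ x e _ h =>
        exact ⟨_, hrun _ (Step.localAssign (l := l') h),
          hsim.loc _ (fun _ _ => rfl) rfl rfl rfl rfl, hex' _ _ rfl hex2⟩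
      | @assert _ _ e _ h hne =>
        refine ⟨_, hrun _ (Step.localAssert (l := l') h hne),
          hsim.loc _ (fun _ _ => rfl) rfl rfl rfl rfl, ?_⟩
        have := hex' l' _ rfl hex2
        simpa [State.goto, TEvent.thread] using this
    | scf t k =>
      obtain ⟨l', ρ', hst, hex2⟩ := hext rfl
      simp only [TEvent.thread, TEvent.act, TEvent.tag] at hst hn hrun
      rw [hn rfl, ← hlen] at hrun
      cases hst with
      | @scfence _ _ _ h =>
        refine ⟨_, hrun _ (Step.scfence (l := l') h (hsim.buf₂ t) fun a => ?_),
          hsim.loc _ (fun _ _ => rfl) rfl rfl rfl rfl, ?_⟩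
        · rw [hsim.buf₁, he a]; rfl
        · have := hex' l' _ rfl hex2
          simpa [State.goto, TEvent.thread] using this

theorem Valid.ev_mem_computations {P : Program DOM THRD REG LAB} {V : List (TEvent DOM THRD)}
    (hV : Valid P V) : ev V ∈ P.Computations := by
  obtain ⟨s, hs, hsim, -⟩ := run_of_valid (posTag_pos hV.nodup) hV V [] (by simp)
  refine ⟨s, hs, fun t a => ?_, hsim.buf₂⟩
  rw [hsim.buf₁, buf, hV.complete]
  simp

/-! ### From operational runs to tagged computations -/

/-- Tag and value of a store to `a` in an all-addresses buffer. -/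
def Entry.tagAt (a : DOM) : Entry DOM → Option (ℕ × DOM)
  | .store i b v => if b = a then some (i, v) else none
  | .fence _ _ => none

theorem Entry.valueAt_eq (a : DOM) (x : Entry DOM) :
    x.valueAt a = (x.tagAt a).map Prod.snd := by
  cases x <;> simp [Entry.valueAt, Entry.tagAt]

theorem filterMap_valueAt (a : DOM) (l : List (Entry DOM)) :
    l.filterMap (Entry.valueAt a) = (l.filterMap (Entry.tagAt a)).map Prod.snd := by
  rw [List.map_filterMap]
  exact List.filterMap_congr fun x _ => Entry.valueAt_eq a x

/-- The tagged events `V` of a run to the state `s`. -/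
structure Tagging (P : Program DOM THRD REG LAB) (τ : List (Event DOM THRD))
    (s : State DOM THRD REG LAB) (V : List (TEvent DOM THRD)) : Prop where
  relabel : relabel id V = τ
  posTag : PosTag id V
  memRun : MemRun [] V
  -- Continuation form: `Exec` recurses from the front, while a run grows at the end.
  exec : ∀ t w, Exec P t (s.pc t) (s.reg t) w → Exec P t (P.init t) (fun _ => 0) (prog t V ++ w)
  mem : ∀ a, s.mem a = srcVal (stores a V).getLast?
  -- Entries of the all-addresses buffer are older than those of the per-address buffer.
  buf : ∀ t a, isus t a V =
    coms t a V ++ ((s.buf₂ t).filterMap (Entry.tagAt a) ++ s.buf₁ t a)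
  noFence : ∀ t, ∀ x ∈ s.buf₂ t, ∃ i a v, x = .store i a v

theorem PosTag.concat {V : List (TEvent DOM THRD)} (h : PosTag id V) (e : TEvent DOM THRD)
    (he : e.isStore = false → e.tag = V.length) : PosTag id (V ++ [e]) := by
  intro n x hx hxs
  rw [List.getElem?_append] at hx
  split_ifs at hx with hn
  · exact h n x hx hxs
  · rw [List.getElem?_singleton] at hx
    split_ifs at hx with h0
    obtain rfl := Option.some.inj hx
    simp only [id, he hxs]
    omega

/-- A step that changes neither the memory nor the buffers. -/
theorem Tagging.loc {P : Program DOM THRD REG LAB} {τ : List (Event DOM THRD)}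
    {s s' : State DOM THRD REG LAB} {V : List (TEvent DOM THRD)} (h : Tagging P τ s V)
    {e : TEvent DOM THRD} {l : LAB} {ρ : REG → DOM} (he : e.isStore = false)
    (hi : ∀ t a, e.issueAt t a = none) (htag : e.tag = τ.length) (hm : MemOK V e)
    (hst : LStep P e.thread (s.pc e.thread) (s.reg e.thread) e l ρ)
    (hpc : s'.pc = Function.update s.pc e.thread l)
    (hreg : s'.reg = Function.update s.reg e.thread ρ) (hmem : s'.mem = s.mem)
    (h₁ : s'.buf₁ = s.buf₁) (h₂ : s'.buf₂ = s.buf₂) :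
    Tagging P (τ ++ [⟨e.act, τ.length⟩]) s' (V ++ [e]) := by
  have hlen : τ.length = V.length := by rw [← h.relabel, length_relabel]
  have hc : ∀ t a, e.commitAt t a = none := by
    intro t a; cases e <;> simp_all [TEvent.commitAt, TEvent.isStore]
  have hs : ∀ a, e.storeAt a = none := by
    intro a; cases e <;> simp_all [TEvent.storeAt, TEvent.isStore]
  refine ⟨?_, h.posTag.concat e fun _ => by rw [htag, hlen], ?_, fun t w hw => ?_, fun a => ?_,
    fun t a => ?_, fun t => by rw [h₂]; exact h.noFence t⟩
  · rw [relabel_append, h.relabel, ← htag]; rfl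
  · rw [memRun_append]; exact ⟨h.memRun, by simpa [MemRun] using hm⟩
  · rw [prog_append, List.append_assoc]
    apply h.exec
    rw [hpc, hreg] at hw
    by_cases ht : t = e.thread
    · subst ht
      simp only [Function.update_self] at hw
      simp only [prog, he, List.filter_cons]
      exact ⟨l, ρ, hst, hw⟩
    · simpa [ht, Ne.symm ht, prog] using hw
  · rw [hmem, h.mem, stores_concat, hs]; simp
  · rw [isus_concat, coms_concat, hi, hc, h₁, h₂, h.buf]; simp

/-- Tags are positions. Advancing a buffer entry leaves the tagged list unchanged, since the
concatenation of the two buffers, restricted to one address, stays the same. -/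
theorem exists_tagging {P : Program DOM THRD REG LAB} (hP : P.FenceFree)
    {τ : List (Event DOM THRD)} {s : State DOM THRD REG LAB} (h : Run P τ s) :
    ∃ V, Tagging P τ s V := by
  induction h with
  | nil =>
    refine ⟨[], rfl, fun n e he => by simp at he, trivial, fun t w hw => ?_, fun a => rfl,
      fun t a => rfl, fun t x hx => ?_⟩
    · simpa [Program.initState] using hw
    · simp [Program.initState] at hx
  | @silent τ s s' h hs ih =>
    obtain ⟨V, hV⟩ := ih
    cases hs with
    | @advanceBuffer t a v i β hb =>
      refine ⟨V, hV.relabel, hV.posTag, hV.memRun, hV.exec, hV.mem, fun u b => ?_, fun u => ?_⟩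
      · rw [hV.buf]
        congr 1
        by_cases hu : u = t
        · subst hu
          by_cases hab : b = a
          · subst hab; simp [State.setBuf₁, State.setBuf₂, hb, Entry.tagAt]
          · simp [State.setBuf₁, State.setBuf₂, Entry.tagAt, hab, Ne.symm hab]
        · simp [State.setBuf₁, State.setBuf₂, hu]
      · by_cases hu : u = t
        · subst hu
          simp only [State.setBuf₁, State.setBuf₂, Function.update_self, List.mem_append,
            List.mem_singleton]
          rintro x (hx | rfl)
          · exact hV.noFence u x hx
          · exact ⟨_, _, _, rfl⟩
        · simpa [State.setBuf₁, State.setBuf₂, hu] using hV.noFence u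
  | @snoc τ s s' e h hs ih =>
    obtain ⟨V, hV⟩ := ih
    have hlen : τ.length = V.length := by rw [← hV.relabel, length_relabel]
    have hbuf : ∀ t a, StoreAtomic.buf t a V =
        (s.buf₂ t).filterMap (Entry.tagAt a) ++ s.buf₁ t a :=
      fun t a => buf_eq_of_append (hV.buf t a)
    cases hs with
    | @earlyRead₁ t x e l a v i β h ha hb =>
      subst ha
      refine ⟨V ++ [TEvent.ld t (e.eval (s.reg t)) τ.length (some (i, v))], ?_⟩
      refine hV.loc (s' := (s.setReg t x v).goto t l)
          (e := .ld t (e.eval (s.reg t)) τ.length (some (i, v))) rfl (fun _ _ => rfl) rfl ?_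
          (.load _ _ h) rfl rfl rfl rfl rfl
      simp [MemOK, read, hbuf, hb]
    | @earlyRead₂ t x e l a v β h ha hb₁ hb₂ =>
      subst ha
      rw [filterMap_valueAt, List.map_eq_append_iff] at hb₂
      obtain ⟨l₁, l₂, hl, -, hl₂⟩ := hb₂
      obtain ⟨p, rfl, rfl⟩ : ∃ p, l₂ = [p] ∧ p.2 = v := by
        rw [List.map_eq_cons_iff] at hl₂
        obtain ⟨p, l', rfl, hp, hl'⟩ := hl₂
        exact ⟨p, by simpa using hl', hp⟩
      refine ⟨V ++ [TEvent.ld t (e.eval (s.reg t)) τ.length (some p)], ?_⟩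
      refine hV.loc (s' := (s.setReg t x p.2).goto t l)
          (e := .ld t (e.eval (s.reg t)) τ.length (some p)) rfl (fun _ _ => rfl) rfl ?_
          (.load _ _ h) rfl rfl rfl rfl rfl
      simp [MemOK, read, hbuf, hb₁, hl]
    | @readMemory t x e l a v h ha hb₁ hb₂ hv =>
      subst ha
      have hv' : v = srcVal (stores (e.eval (s.reg t)) V).getLast? := by rw [hv, hV.mem]
      subst hv'
      refine ⟨V ++ [TEvent.ld t (e.eval (s.reg t)) τ.length (stores (e.eval (s.reg t)) V).getLast?], ?_⟩
      refine hV.loc (s' := (s.setReg t x (srcVal (stores (e.eval (s.reg t)) V).getLast?)).goto t l)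
          (e := .ld t (e.eval (s.reg t)) τ.length (stores (e.eval (s.reg t)) V).getLast?)
          rfl (fun _ _ => rfl) rfl ?_ (.load _ _ h) rfl rfl rfl rfl rfl
      rw [filterMap_valueAt, List.map_eq_nil_iff] at hb₂
      simp [MemOK, read, hbuf, hb₁, hb₂]
    | @issueStore t e e' l a v h ha hv =>
      refine ⟨V ++ [.isu t a v τ.length], ?_, hV.posTag.concat (.isu t a v τ.length) fun _ => hlen, ?_,
        fun u w hw => ?_, fun b => ?_, fun u b => ?_, ?_⟩
      · rw [relabel_append, hV.relabel]; rfl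
      · rw [memRun_append]; exact ⟨hV.memRun, trivial, trivial⟩
      · rw [prog_append, List.append_assoc]
        apply hV.exec
        by_cases ht : u = t
        · subst ht
          simp only [State.goto, State.setBuf₁, Function.update_self] at hw
          subst ha hv
          have : prog u [TEvent.isu u (e.eval (s.reg u)) (e'.eval (s.reg u)) τ.length] =
            [TEvent.isu u (e.eval (s.reg u)) (e'.eval (s.reg u)) τ.length] := by
            simp [prog, TEvent.isStore, TEvent.thread]
          rw [this]
          exact ⟨l, _, .store _ h, hw⟩
        · simpa [ht, Ne.symm ht, prog, State.goto, State.setBuf₁, TEvent.thread] using hw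
      · simpa [State.goto, State.setBuf₁, stores_concat, TEvent.storeAt] using hV.mem b
      · rw [isus_concat, coms_concat, hV.buf]
        by_cases hu : u = t
        · subst hu
          by_cases hab : b = a
          · subst hab
            simp [State.setBuf₁, State.goto, TEvent.issueAt, TEvent.commitAt, hlen]
          · simp [State.setBuf₁, State.goto, TEvent.issueAt, TEvent.commitAt, hab, Ne.symm hab]
        · simp [State.setBuf₁, State.goto, TEvent.issueAt, TEvent.commitAt, hu, Ne.symm hu]
      · exact hV.noFence
    | @storeToMemory t a v i β hb =>
      refine ⟨V ++ [.st t a v i], ?_, hV.posTag.concat _ (by simp [TEvent.isStore]), ?_,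
        fun u w hw => ?_, fun b => ?_, fun u b => ?_, fun u => ?_⟩
      · rw [relabel_append, hV.relabel]; rfl
      · rw [memRun_append]
        refine ⟨hV.memRun, ?_, trivial⟩
        simp [MemOK, hV.buf, hb, Entry.tagAt]
      · simpa [prog_append, prog, TEvent.isStore] using hV.exec u w hw
      · rw [stores_concat]
        by_cases hab : b = a
        · subst hab; simp [State.setBuf₂, State.setMem, TEvent.storeAt, srcVal]
        · simp [State.setBuf₂, State.setMem, TEvent.storeAt, hab, Ne.symm hab, hV.mem]
      · rw [isus_concat, coms_concat, hV.buf]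
        by_cases hu : u = t
        · subst hu
          by_cases hab : b = a
          · subst hab
            simp [State.setBuf₂, State.setMem, TEvent.issueAt, TEvent.commitAt, hb, Entry.tagAt]
          · simp [State.setBuf₂, State.setMem, TEvent.issueAt, TEvent.commitAt, hb, Entry.tagAt,
              Ne.symm hab]
        · simp [State.setBuf₂, State.setMem, TEvent.issueAt, TEvent.commitAt, hu, Ne.symm hu]
      · by_cases hu : u = t
        · subst hu
          intro x hx
          refine hV.noFence u x ?_
          simp only [State.setBuf₂, State.setMem, Function.update_self] at hx
          rw [hb]; exact List.mem_cons_of_mem _ hx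
        · simpa [State.setBuf₂, State.setMem, hu] using hV.noFence u
    | @scfence t l h hb₂ hb₁ =>
      refine ⟨V ++ [TEvent.scf t τ.length], ?_⟩
      refine hV.loc (s' := s.goto t l) (e := .scf t τ.length) (ρ := s.reg t) rfl (fun _ _ => rfl) rfl ?_
          (.scfence _ h) rfl (by simp [State.goto, TEvent.thread]) rfl rfl rfl
      intro a
      simp [hbuf, hb₁, hb₂]
    | @issueFence t es l as h has hb₁ => exact absurd rfl (hP t _ h es)
    | @fence t as i β hb =>
      obtain ⟨_, _, _, h⟩ := hV.noFence t (.fence i as) (by simp [hb])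
      simp at h
    | @localAssign t x e l h =>
      refine ⟨V ++ [TEvent.loc t τ.length], ?_⟩
      exact hV.loc (s' := (s.setReg t x (e.eval (s.reg t))).goto t l) (e := .loc t τ.length) rfl (fun _ _ => rfl) rfl trivial
          (.assign _ h) rfl rfl rfl rfl rfl
    | @localAssert t e l h hne =>
      refine ⟨V ++ [TEvent.loc t τ.length], ?_⟩
      exact hV.loc (s' := s.goto t l) (e := .loc t τ.length) (ρ := s.reg t) rfl (fun _ _ => rfl) rfl trivial
          (.assert _ h hne) rfl (by simp [State.goto, TEvent.thread]) rfl rfl rfl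

theorem Valid.issue_mem {P : Program DOM THRD REG LAB} {V : List (TEvent DOM THRD)}
    (hV : Valid P V) {x : TEvent DOM THRD} (hx : x ∈ V) : x.issue ∈ V := by
  cases x with
  | st t a v k =>
    have : (k, v) ∈ coms t a V := mem_coms.2 hx
    rw [hV.complete] at this
    exact mem_isus.1 this
  | _ => exact hx

/-- In a valid list every tag, also that of a store, is the tag of some non-store event, and
`PosTag` prescribes its image. -/
theorem relabel_congr {P : Program DOM THRD REG LAB} {V : List (TEvent DOM THRD)}
    (hV : Valid P V) {r r' : ℕ → ℕ} (h : PosTag r V) (h' : PosTag r' V) :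
    relabel r V = relabel r' V := by
  unfold relabel
  refine List.map_congr_left fun x hx => ?_
  have h1 := hV.issue_mem hx
  obtain ⟨n, hn⟩ := List.mem_iff_getElem?.1 h1
  have h2 := h n _ hn x.isStore_issue
  have h3 := h' n _ hn x.isStore_issue
  rw [x.tag_issue] at h2 h3
  rw [h2, h3]

theorem exists_valid {P : Program DOM THRD REG LAB} (hP : P.FenceFree)
    {τ : List (Event DOM THRD)} (h : τ ∈ P.Computations) :
    ∃ V, Valid P V ∧ ev V = τ ∧ PosTag id V := by
  obtain ⟨s, hs, h₁, h₂⟩ := h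
  obtain ⟨V, hV⟩ := exists_tagging hP hs
  have hval : Valid P V := by
    refine ⟨fun t => ?_, hV.memRun, hV.posTag.nodup, fun t a => ?_⟩
    · simpa using hV.exec t [] trivial
    · rw [hV.buf, h₁, h₂]; simp
  refine ⟨V, hval, ?_, hV.posTag⟩
  rw [← hV.relabel]
  exact relabel_congr hval (posTag_pos hval.nodup) hV.posTag

end Bridge

/-! ### Happens-before traces of tagged computations -/

/-- Turns adjacency in a projected list into the language of positions in which `Po` and `St` are
defined. -/
theorem filterMap_eq_append_cons_cons_iff {α β : Type*} {f : α → Option β} {V : List α} {p q : β} :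
    (∃ l₁ l₂, V.filterMap f = l₁ ++ p :: q :: l₂) ↔
      ∃ (i j : ℕ) (x y : α), V[i]? = some x ∧ V[j]? = some y ∧ f x = some p ∧ f y = some q ∧ i < j ∧
        ∀ (k : ℕ) (z : α), i < k → k < j → V[k]? = some z → f z = none := by
  constructor
  · rintro ⟨l₁, l₂, h⟩
    rw [List.filterMap_eq_append_iff] at h
    obtain ⟨A, B, rfl, -, hB⟩ := h
    rw [List.filterMap_eq_cons_iff] at hB
    obtain ⟨B₁, x, B₂, rfl, -, hx, hB₂⟩ := hB
    rw [List.filterMap_eq_cons_iff] at hB₂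
    obtain ⟨C₁, y, C₂, rfl, hC₁, hy, -⟩ := hB₂
    refine ⟨(A ++ B₁).length, (A ++ B₁ ++ [x] ++ C₁).length, x, y, ?_, ?_, hx, hy, ?_, ?_⟩
    · have : A ++ (B₁ ++ x :: (C₁ ++ y :: C₂)) = (A ++ B₁) ++ x :: (C₁ ++ y :: C₂) := by simp
      rw [this, List.getElem?_append_right le_rfl]; simp
    · have : A ++ (B₁ ++ x :: (C₁ ++ y :: C₂)) = (A ++ B₁ ++ [x] ++ C₁) ++ y :: C₂ := by simp
      rw [this, List.getElem?_append_right le_rfl]; simp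
    · simp only [List.length_append, List.length_singleton]; omega
    · intro k z hk hk' hz
      have : A ++ (B₁ ++ x :: (C₁ ++ y :: C₂)) = (A ++ B₁ ++ [x]) ++ (C₁ ++ y :: C₂) := by simp
      rw [this, List.getElem?_append_right (by simp at hk ⊢; omega),
        List.getElem?_append_left (by simp at hk hk' ⊢; omega)] at hz
      exact hC₁ z (List.mem_of_getElem? hz)
  · rintro ⟨i, j, x, y, hi, hj, hx, hy, hij, hb⟩
    obtain ⟨hil, hi'⟩ := List.getElem?_eq_some_iff.1 hi
    obtain ⟨hjl, hj'⟩ := List.getElem?_eq_some_iff.1 hj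
    have h1 : V = V.take i ++ x :: V.drop (i + 1) := by
      rw [← hi', List.cons_getElem_drop_succ, List.take_append_drop]
    have h2 : V.drop (i + 1) = (V.drop (i + 1)).take (j - i - 1) ++ y :: V.drop (j + 1) := by
      have h3 := List.take_append_drop (j - i - 1) (V.drop (i + 1))
      rw [List.drop_drop, show i + 1 + (j - i - 1) = j by omega,
        List.drop_eq_getElem_cons hjl, hj'] at h3
      exact h3.symm
    have h3 : ((V.drop (i + 1)).take (j - i - 1)).filterMap f = [] := by
      rw [List.filterMap_eq_nil_iff]
      intro z hz
      obtain ⟨n, hn⟩ := List.mem_iff_getElem?.1 hz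
      rw [List.getElem?_take] at hn
      split_ifs at hn with hlt
      rw [List.getElem?_drop] at hn
      exact hb _ z (by omega) (by omega) hn
    refine ⟨(V.take i).filterMap f, (V.drop (j + 1)).filterMap f, ?_⟩
    conv_lhs => rw [h1, h2]
    simp [hx, hy, h3]

section Trace

variable {DOM THRD : Type*} [DecidableEq DOM] [DecidableEq THRD]

/-- Program order on tags. -/
def PoT (V : List (TEvent DOM THRD)) (i j : ℕ) : Prop :=
  ∃ t x y, (∃ l₁ l₂, prog t V = l₁ ++ x :: y :: l₂) ∧ x.tag = i ∧ y.tag = j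

/-- Store order on tags. -/
def StT (V : List (TEvent DOM THRD)) (i j : ℕ) : Prop :=
  ∃ a p q, (∃ l₁ l₂, stores a V = l₁ ++ p :: q :: l₂) ∧ p.1 = i ∧ q.1 = j

/-- Source relation on tags. -/
def SrcT (V : List (TEvent DOM THRD)) (i l : ℕ) : Prop :=
  ∃ t a p, TEvent.ld t a l (some p) ∈ V ∧ p.1 = i

/-- Conflict relation on tags. -/
def CfT (V : List (TEvent DOM THRD)) (l j : ℕ) : Prop :=
  (∃ i, SrcT V i l ∧ StT V i j) ∨
    ((∃ a, (∃ t s, TEvent.ld t a l s ∈ V) ∧ ∃ u v, TEvent.st u a v j ∈ V) ∧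
      (¬ ∃ i, SrcT V i l) ∧ ¬ ∃ i, StT V i j)

theorem mem_of_split {α : Type*} {l l₁ l₂ : List α} {x y : α} (h : l = l₁ ++ x :: y :: l₂) :
    x ∈ l ∧ y ∈ l := by
  subst h; simp

variable {REG LAB : Type*} [Zero DOM] [DecidableEq REG]

theorem Valid.posTag {P : Program DOM THRD REG LAB} {V : List (TEvent DOM THRD)}
    (hV : Valid P V) : PosTag (pos V) V := posTag_pos hV.nodup

theorem Valid.tag_mem {P : Program DOM THRD REG LAB} {V : List (TEvent DOM THRD)}
    (hV : Valid P V) {x : TEvent DOM THRD} (hx : x ∈ V) : x.tag ∈ nodeTags V :=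
  mem_nodeTags.2 ⟨_, hV.issue_mem hx, x.isStore_issue, x.tag_issue⟩

theorem Valid.node_eq {P : Program DOM THRD REG LAB} {V : List (TEvent DOM THRD)}
    (hV : Valid P V) {x y : TEvent DOM THRD} (hx : x ∈ V) (hy : y ∈ V) (hxs : x.isStore = false)
    (hys : y.isStore = false) (h : x.tag = y.tag) : x = y := by
  obtain ⟨n, hn⟩ := List.mem_iff_getElem?.1 hx
  obtain ⟨m, hm⟩ := List.mem_iff_getElem?.1 hy
  have h1 := hV.posTag n x hn hxs
  have h2 := hV.posTag m y hm hys
  rw [← h, h1] at h2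
  subst h2
  exact Option.some.inj (hn.symm.trans hm)

theorem Valid.pos_inj {P : Program DOM THRD REG LAB} {V : List (TEvent DOM THRD)}
    (hV : Valid P V) {i j : ℕ} (hi : i ∈ nodeTags V) (hj : j ∈ nodeTags V)
    (h : pos V i = pos V j) : i = j := by
  obtain ⟨x, hx, hxs, rfl⟩ := mem_nodeTags.1 hi
  obtain ⟨y, hy, hys, rfl⟩ := mem_nodeTags.1 hj
  obtain ⟨n, hn⟩ := List.mem_iff_getElem?.1 hx
  obtain ⟨m, hm⟩ := List.mem_iff_getElem?.1 hy
  rw [hV.posTag n x hn hxs, hV.posTag m y hm hys] at h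
  subst h
  rw [Option.some.inj (hn.symm.trans hm)]

theorem TEvent.isIssued_act (e : TEvent DOM THRD) : e.act.isIssued = e.isStore := by
  cases e <;> rfl

theorem TEvent.thread_act (e : TEvent DOM THRD) : e.act.thread = e.thread := by
  cases e <;> rfl

theorem getElem?_ev {V : List (TEvent DOM THRD)} {n : ℕ} {e : Event DOM THRD} :
    (ev V)[n]? = some e ↔ ∃ x, V[n]? = some x ∧ e = ⟨x.act, pos V x.tag⟩ := by
  simp [ev, getElem?_relabel, eq_comm]

theorem nodeOfThread_ev {V : List (TEvent DOM THRD)} {t : THRD} {n : ℕ} :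
    NodeOfThread (ev V) t n ↔ ∃ x, V[n]? = some x ∧ x.isStore = false ∧ x.thread = t := by
  simp only [NodeOfThread, getElem?_ev, Event.thread]
  constructor
  · rintro ⟨_, ⟨x, hx, rfl⟩, h1, h2⟩
    exact ⟨x, hx, by simpa [TEvent.isIssued_act] using h1, by simpa [TEvent.thread_act] using h2⟩
  · rintro ⟨x, hx, h1, h2⟩
    exact ⟨_, ⟨x, hx, rfl⟩, by simpa [TEvent.isIssued_act] using h1,
      by simpa [TEvent.thread_act] using h2⟩

theorem storeAt_ev {V : List (TEvent DOM THRD)} {n I : ℕ} {t : THRD} {a : DOM} :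
    StoreAt (ev V) n t a I ↔ ∃ v k, V[n]? = some (.st t a v k) ∧ pos V k = I := by
  simp only [StoreAt, getElem?_ev]
  constructor
  · rintro ⟨v, x, hx, h⟩
    cases x <;> simp [TEvent.act] at h
    obtain ⟨⟨rfl, rfl, rfl⟩, rfl⟩ := h
    exact ⟨_, _, hx, rfl⟩
  · rintro ⟨v, k, hx, rfl⟩
    exact ⟨v, _, hx, rfl⟩

theorem storeAt_ev_exists {V : List (TEvent DOM THRD)} {n I : ℕ} {a : DOM} :
    (∃ t, StoreAt (ev V) n t a I) ↔
      ∃ x p, V[n]? = some x ∧ x.storeAt a = some p ∧ pos V p.1 = I := by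
  simp only [storeAt_ev]
  constructor
  · rintro ⟨t, v, k, h, rfl⟩
    exact ⟨_, (k, v), h, by simp [TEvent.storeAt], rfl⟩
  · rintro ⟨x, p, h, hp, rfl⟩
    cases x <;> simp [TEvent.storeAt] at hp
    obtain ⟨rfl, rfl⟩ := hp
    exact ⟨_, _, _, h, rfl⟩

theorem loadAt_ev {V : List (TEvent DOM THRD)} {n : ℕ} {t : THRD} {a : DOM} :
    LoadAt (ev V) n t a ↔ ∃ k s, V[n]? = some (.ld t a k s) := by
  simp only [LoadAt, getElem?_ev]
  constructor
  · rintro ⟨v, i, x, hx, h⟩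
    cases x <;> simp [TEvent.act] at h
    obtain ⟨⟨rfl, rfl, -⟩, -⟩ := h
    exact ⟨_, _, hx⟩
  · rintro ⟨k, s, hx⟩
    exact ⟨_, _, _, hx, rfl⟩

theorem isNode_ev {P : Program DOM THRD REG LAB} {V : List (TEvent DOM THRD)} (hV : Valid P V)
    {n : ℕ} : IsNode (ev V) n ↔ ∃ k ∈ nodeTags V, pos V k = n := by
  simp only [IsNode, getElem?_ev]
  constructor
  · rintro ⟨_, ⟨x, hx, rfl⟩, h⟩
    have hxs : x.isStore = false := by simpa [TEvent.isIssued_act] using h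
    exact ⟨x.tag, mem_nodeTags.2 ⟨x, List.mem_of_getElem? hx, hxs, rfl⟩, hV.posTag n x hx hxs⟩
  · rintro ⟨k, hk, rfl⟩
    obtain ⟨x, hx, hxs, rfl⟩ := mem_nodeTags.1 hk
    obtain ⟨n, hn⟩ := List.mem_iff_getElem?.1 hx
    rw [hV.posTag n x hn hxs]
    exact ⟨_, ⟨x, hn, rfl⟩, by simpa [TEvent.isIssued_act] using hxs⟩

theorem prog_eq_filterMap (t : THRD) (V : List (TEvent DOM THRD)) :
    prog t V = V.filterMap (Option.guard fun e => !e.isStore && decide (e.thread = t)) := by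
  rw [prog, List.filterMap_eq_filter]

theorem po_ev {P : Program DOM THRD REG LAB} {V : List (TEvent DOM THRD)} (hV : Valid P V)
    {I J : ℕ} : Po (ev V) I J ↔ ∃ i j, PoT V i j ∧ pos V i = I ∧ pos V j = J := by
  simp only [Po, nodeOfThread_ev, PoT, prog_eq_filterMap, filterMap_eq_append_cons_cons_iff]
  constructor
  · rintro ⟨t, ⟨x, hx, hxs, hxt⟩, ⟨y, hy, hys, hyt⟩, hij, hb⟩
    refine ⟨x.tag, y.tag, ⟨t, x, y, ⟨I, J, x, y, hx, hy, ?_, ?_, hij, ?_⟩, rfl, rfl⟩,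
      hV.posTag I x hx hxs, hV.posTag J y hy hys⟩
    · simp [Option.guard, hxs, hxt]
    · simp [Option.guard, hys, hyt]
    · intro k z hk hk' hz
      simp only [Option.guard_eq_none_iff, Bool.and_eq_false_iff]
      by_contra hc
      simp only [not_or, Bool.not_eq_false, Bool.not_eq_true', decide_eq_true_eq] at hc
      exact hb k hk hk' ⟨z, hz, by simpa using hc.1, hc.2⟩
  · rintro ⟨_, _, ⟨t, x, y, ⟨i, j, x', y', hx, hy, hx', hy', hij, hb⟩, rfl, rfl⟩, rfl, rfl⟩
    simp only [Option.guard_eq_some_iff, Bool.and_eq_true, Bool.not_eq_true',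
      decide_eq_true_eq] at hx' hy'
    obtain ⟨rfl, hxs, hxt⟩ := hx'
    obtain ⟨rfl, hys, hyt⟩ := hy'
    rw [hV.posTag i _ hx hxs, hV.posTag j _ hy hys]
    refine ⟨t, ⟨_, hx, hxs, hxt⟩, ⟨_, hy, hys, hyt⟩, hij, ?_⟩
    rintro k hk hk' ⟨z, hz, hzs, hzt⟩
    have := hb k z hk hk' hz
    simp [Option.guard, hzs, hzt] at this

theorem st_ev {V : List (TEvent DOM THRD)}
    {I J : ℕ} : St (ev V) I J ↔ ∃ i j, StT V i j ∧ pos V i = I ∧ pos V j = J := by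
  simp only [St, storeAt_ev_exists, StT, stores, filterMap_eq_append_cons_cons_iff]
  have key : ∀ (a : DOM) (k : ℕ), (¬ ∃ t i', StoreAt (ev V) k t a i') ↔
      ∀ z, V[k]? = some z → z.storeAt a = none := by
    intro a k
    rw [exists_comm]
    simp only [storeAt_ev_exists]
    constructor
    · intro h z hz
      by_contra hc
      obtain ⟨p, hp⟩ := Option.ne_none_iff_exists'.1 hc
      exact h ⟨_, z, p, hz, hp, rfl⟩
    · rintro h ⟨_, x, p, hx, hp, -⟩
      rw [h x hx] at hp
      simp at hp
  simp only [key]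
  constructor
  · rintro ⟨a, i, j, ⟨x, p, hx, hp, rfl⟩, ⟨y, q, hy, hq, rfl⟩, hij, hb⟩
    exact ⟨p.1, q.1, ⟨a, p, q, ⟨i, j, x, y, hx, hy, hp, hq, hij,
      fun k z hk hk' hz => hb k hk hk' z hz⟩, rfl, rfl⟩, rfl, rfl⟩
  · rintro ⟨_, _, ⟨a, p, q, ⟨i, j, x, y, hx, hy, hp, hq, hij, hb⟩, rfl, rfl⟩, rfl, rfl⟩
    exact ⟨a, i, j, ⟨x, p, hx, hp, rfl⟩, ⟨y, q, hy, hq, rfl⟩, hij,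
      fun k hk hk' z hz => hb k z hk hk' hz⟩

theorem eq_append_cons_of_getElem? {α : Type*} {V : List α} {n : ℕ} {x : α}
    (h : V[n]? = some x) : ∃ L R, V = L ++ x :: R ∧ L.length = n := by
  obtain ⟨hn, h'⟩ := List.getElem?_eq_some_iff.1 h
  refine ⟨V.take n, V.drop (n + 1), ?_, by simp; omega⟩
  rw [← h', List.cons_getElem_drop_succ, List.take_append_drop]

theorem Valid.pos_lt {P : Program DOM THRD REG LAB} {L R : List (TEvent DOM THRD)}
    (hV : Valid P (L ++ R)) {x : TEvent DOM THRD} (hx : x ∈ L) (hxs : x.isStore = false) :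
    pos (L ++ R) x.tag < L.length := by
  obtain ⟨n, hn⟩ := List.mem_iff_getElem?.1 hx
  have hlt := (List.getElem?_eq_some_iff.1 hn).1
  rw [hV.posTag n x (by rw [List.getElem?_append_left hlt, hn]) hxs]
  exact hlt

theorem Valid.le_pos {P : Program DOM THRD REG LAB} {L R : List (TEvent DOM THRD)}
    (hV : Valid P (L ++ R)) {x : TEvent DOM THRD} (hx : x ∈ R) (hxs : x.isStore = false) :
    L.length ≤ pos (L ++ R) x.tag := by
  obtain ⟨n, hn⟩ := List.mem_iff_getElem?.1 hx
  rw [hV.posTag (L.length + n) x (by rw [List.getElem?_append_right (by omega)]; simpa using hn) hxs]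
  omega

theorem Valid.coms_eq {P : Program DOM THRD REG LAB} {L R : List (TEvent DOM THRD)}
    (hV : Valid P (L ++ R)) (t : THRD) (a : DOM) : coms t a R = buf t a L ++ isus t a R := by
  have h1 := hV.complete t a
  have h2 := isus_eq_coms_append_buf (memRun_append.1 hV.mem).1 t a
  rw [coms_append, isus_append, h2, List.append_assoc] at h1
  exact List.append_cancel_left h1

/-- By `Valid.coms_eq`, the stores of `t` to `a` still to come are those pending after `L`, followed
by those issued later. The bound on the issue position selects the former. -/
theorem pendingAt_ev {P : Program DOM THRD REG LAB} {L R : List (TEvent DOM THRD)} {t u : THRD}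
    {a b : DOM} {k : ℕ} {s : Option (ℕ × DOM)} (hV : Valid P (L ++ .ld u b k s :: R)) {I : ℕ} :
    PendingAt (ev (L ++ .ld u b k s :: R)) L.length t a I ↔
      ∃ p ∈ buf t a L, pos (L ++ .ld u b k s :: R) p.1 = I := by
  have hc := hV.coms_eq t a
  simp only [PendingAt, storeAt_ev]
  constructor
  · rintro ⟨hI, q, hq, v, j, hj, rfl⟩
    rw [List.getElem?_append_right (by omega)] at hj
    have hm : ((j, v) : ℕ × DOM) ∈ coms t a (.ld u b k s :: R) :=
      mem_coms.2 (List.mem_of_getElem? hj)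
    rw [hc, List.mem_append] at hm
    rcases hm with hm | hm
    · exact ⟨_, hm, rfl⟩
    · have := hV.le_pos (mem_isus.1 hm) rfl
      simp only [TEvent.tag] at this
      omega
  · rintro ⟨p, hp, rfl⟩
    have h1 : p ∈ isus t a L := List.mem_of_mem_drop hp
    have h2 : p ∈ coms t a (.ld u b k s :: R) := by rw [hc]; exact List.mem_append_left _ hp
    refine ⟨hV.pos_lt (mem_isus.1 h1) rfl, ?_⟩
    obtain ⟨n, hn⟩ := List.mem_iff_getElem?.1 (mem_coms.1 h2)
    refine ⟨L.length + n, ?_, p.2, p.1, ?_, rfl⟩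
    · rcases n with _ | n
      · simp at hn
      · omega
    · rw [List.getElem?_append_right (by omega)]
      simpa using hn

theorem isus_pairwise {P : Program DOM THRD REG LAB} {L R : List (TEvent DOM THRD)}
    (hV : Valid P (L ++ R)) (t : THRD) (a : DOM) :
    (isus t a L).Pairwise fun p q => pos (L ++ R) p.1 < pos (L ++ R) q.1 := by
  unfold isus
  rw [List.pairwise_filterMap]
  refine ((List.pairwise_append.1 hV.posTag.pairwise).1).imp ?_
  intro x y h p hp q hq
  cases x <;> simp [TEvent.issueAt] at hp
  cases y <;> simp [TEvent.issueAt] at hq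
  obtain ⟨-, rfl⟩ := hp
  obtain ⟨-, rfl⟩ := hq
  exact h rfl rfl

theorem Valid.memOK {P : Program DOM THRD REG LAB} {L R : List (TEvent DOM THRD)}
    {e : TEvent DOM THRD} (hV : Valid P (L ++ e :: R)) : MemOK L e := by
  have := hV.mem
  rw [memRun_append] at this
  exact this.2.1

theorem Valid.memRun_left {P : Program DOM THRD REG LAB} {L R : List (TEvent DOM THRD)}
    (hV : Valid P (L ++ R)) : MemRun [] L := (memRun_append.1 hV.mem).1

theorem getLast?_filterMap_iff {α β : Type*} {f : α → Option β} {V : List α} {p : β} :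
    (V.filterMap f).getLast? = some p ↔ ∃ (i : ℕ) (x : α), V[i]? = some x ∧ f x = some p ∧
      ∀ (k : ℕ) (z : α), i < k → V[k]? = some z → f z = none := by
  constructor
  · intro h
    obtain ⟨l, hl⟩ := List.getLast?_eq_some_iff.1 h
    rw [List.filterMap_eq_append_iff] at hl
    obtain ⟨A, B, rfl, -, hB⟩ := hl
    rw [List.filterMap_eq_cons_iff] at hB
    obtain ⟨B₁, x, B₂, rfl, -, hx, hB₂⟩ := hB
    rw [List.filterMap_eq_nil_iff] at hB₂
    have h1 : A ++ (B₁ ++ x :: B₂) = (A ++ B₁) ++ x :: B₂ := by simp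
    refine ⟨(A ++ B₁).length, x, ?_, hx, fun k z hk hz => ?_⟩
    · rw [h1, List.getElem?_append_right le_rfl]; simp
    · rw [h1, List.getElem?_append_right hk.le] at hz
      obtain ⟨n, hn⟩ := Nat.exists_eq_add_of_lt hk
      rw [show k - (A ++ B₁).length = n + 1 by omega, List.getElem?_cons_succ] at hz
      exact hB₂ z (List.mem_of_getElem? hz)
  · rintro ⟨i, x, hx, hp, hb⟩
    obtain ⟨L, R, rfl, rfl⟩ := eq_append_cons_of_getElem? hx
    have : R.filterMap f = [] := by
      rw [List.filterMap_eq_nil_iff]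
      intro z hz
      obtain ⟨n, hn⟩ := List.mem_iff_getElem?.1 hz
      refine hb (L.length + n + 1) z (by omega) ?_
      rw [List.getElem?_append_right (by omega), show L.length + n + 1 - L.length = n + 1 by omega]
      simpa using hn
    simp [hp, this]

/-- By `MemOK` the source recorded in a load is the result of `read`. The two alternatives in `Src`
correspond to a nonempty and an empty own buffer. -/
theorem src_ev_aux {P : Program DOM THRD REG LAB} {L R : List (TEvent DOM THRD)} {t : THRD}
    {a : DOM} {k : ℕ} {s : Option (ℕ × DOM)} (hV : Valid P (L ++ .ld t a k s :: R)) {I : ℕ} :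
    Src (ev (L ++ .ld t a k s :: R)) I L.length ↔
      ∃ p, s = some p ∧ pos (L ++ .ld t a k s :: R) p.1 = I := by
  have hload : ∀ u b, LoadAt (ev (L ++ .ld t a k s :: R)) L.length u b ↔ u = t ∧ b = a := by
    intro u b
    rw [loadAt_ev]
    simp [eq_comm]
  have hs : s = read t a L := hV.memOK
  unfold Src
  simp only [hload, pendingAt_ev hV]
  set V := L ++ .ld t a k s :: R with hVdef
  rcases List.eq_nil_or_concat (buf t a L) with hb | ⟨β, p, hb⟩
  · have hs' : s = (stores a L).getLast? := by rw [hs, read, hb]; simp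
    have hget : ∀ n, n < L.length → V[n]? = L[n]? := fun n hn => List.getElem?_append_left hn
    constructor
    · rintro ⟨u, b, ⟨rfl, rfl⟩, ⟨⟨p, hp, -⟩, -⟩ | ⟨-, n, hn, hst, hk⟩⟩
      · rw [hb] at hp; simp at hp
      · rw [storeAt_ev_exists] at hst
        obtain ⟨x, p, hx, hp, rfl⟩ := hst
        refine ⟨p, ?_, rfl⟩
        rw [hs', stores, getLast?_filterMap_iff]
        refine ⟨n, x, hget n hn ▸ hx, hp, fun m z hm hz => ?_⟩
        have hm' := (List.getElem?_eq_some_iff.1 hz).1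
        by_contra hc
        obtain ⟨q, hq⟩ := Option.ne_none_iff_exists'.1 hc
        apply hk m hm hm'
        rw [exists_comm]
        exact ⟨_, storeAt_ev_exists.2 ⟨z, q, (hget m hm').trans hz, hq, rfl⟩⟩
    · rintro ⟨p, hp, rfl⟩
      refine ⟨t, a, ⟨rfl, rfl⟩, Or.inr ⟨?_, ?_⟩⟩
      · rintro i ⟨q, hq, -⟩
        rw [hb] at hq; simp at hq
      · rw [hs', stores, getLast?_filterMap_iff] at hp
        obtain ⟨n, x, hx, hp, hk⟩ := hp
        have hn := (List.getElem?_eq_some_iff.1 hx).1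
        refine ⟨n, hn, storeAt_ev_exists.2 ⟨x, p, (hget n hn).trans hx, hp, rfl⟩, ?_⟩
        intro m hm hm'
        rw [exists_comm]
        rintro ⟨i, hi⟩
        obtain ⟨z, q, hz, hq, -⟩ := storeAt_ev_exists.1 hi
        rw [hk m z hm (hget m hm' ▸ hz)] at hq
        simp at hq
  · rw [List.concat_eq_append] at hb
    have hs' : s = some p := by rw [hs, read, hb]; simp
    have hpw := isus_pairwise hV t a
    rw [← hVdef] at hpw
    have hpw := hpw.sublist (List.drop_sublist (coms t a L).length _)
    change (buf t a L).Pairwise _ at hpw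
    rw [hb, List.pairwise_append] at hpw
    -- Issue positions increase along a buffer, so its last entry is the latest issued pending
    -- store.
    have hmax : ∀ q ∈ buf t a L, pos V q.1 ≤ pos V p.1 := by
      intro q hq
      rw [hb, List.mem_append, List.mem_singleton] at hq
      rcases hq with hq | rfl
      · exact (hpw.2.2 q hq p (by simp)).le
      · exact le_rfl
    have hpm : p ∈ buf t a L := by rw [hb]; simp
    constructor
    · rintro ⟨u, b, ⟨rfl, rfl⟩, ⟨⟨q, hq, rfl⟩, h⟩ | ⟨h, -⟩⟩
      · exact ⟨p, hs', le_antisymm (h _ ⟨p, hpm, rfl⟩) (hmax q hq)⟩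
      · exact absurd ⟨p, hpm, rfl⟩ (h _)
    · rintro ⟨q, hq, rfl⟩
      rw [hs'] at hq
      obtain rfl := Option.some.inj hq
      refine ⟨t, a, ⟨rfl, rfl⟩, Or.inl ⟨⟨p, hpm, rfl⟩, ?_⟩⟩
      rintro i ⟨q, hq, rfl⟩
      exact hmax q hq

theorem src_ev {P : Program DOM THRD REG LAB} {V : List (TEvent DOM THRD)} (hV : Valid P V)
    {I J : ℕ} : Src (ev V) I J ↔ ∃ i l, SrcT V i l ∧ pos V i = I ∧ pos V l = J := by
  constructor
  · intro h
    obtain ⟨t, a, hl, -⟩ := id h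
    obtain ⟨k, s, hk⟩ := loadAt_ev.1 hl
    have hJ : pos V k = J := hV.posTag J _ hk rfl
    have hmem := List.mem_of_getElem? hk
    obtain ⟨L, R, rfl, rfl⟩ := eq_append_cons_of_getElem? hk
    obtain ⟨p, rfl, hp⟩ := (src_ev_aux hV).1 h
    exact ⟨p.1, k, ⟨t, a, p, hmem, rfl⟩, hp, hJ⟩
  · rintro ⟨_, l, ⟨t, a, p, hm, rfl⟩, rfl, rfl⟩
    obtain ⟨n, hn⟩ := List.mem_iff_getElem?.1 hm
    have hJ : pos V l = n := hV.posTag n _ hn rfl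
    rw [hJ]
    obtain ⟨L, R, rfl, rfl⟩ := eq_append_cons_of_getElem? hn
    exact (src_ev_aux hV).2 ⟨p, rfl, rfl⟩

theorem Valid.srcT_mem {P : Program DOM THRD REG LAB} {V : List (TEvent DOM THRD)}
    (hV : Valid P V) {i l : ℕ} (h : SrcT V i l) : i ∈ nodeTags V ∧ l ∈ nodeTags V := by
  obtain ⟨t, a, p, hm, rfl⟩ := h
  refine ⟨?_, hV.tag_mem hm⟩
  obtain ⟨L, R, rfl⟩ := List.append_of_mem hm
  have hs : some p = read t a L := hV.memOK
  rw [nodeTags_append]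
  refine List.mem_append_left _ ?_
  rw [read] at hs
  have hor : p ∈ buf t a L ∨ p ∈ stores a L := by
    cases hb : (buf t a L).getLast? with
    | some q =>
      rw [hb] at hs
      simp at hs
      exact Or.inl (hs ▸ List.mem_of_getLast? hb)
    | none =>
      rw [hb] at hs
      simp at hs
      exact Or.inr (List.mem_of_getLast? hs.symm)
  rcases hor with h | h
  · exact mem_nodeTags.2 ⟨_, mem_isus.1 (List.mem_of_mem_drop h), rfl, rfl⟩
  · obtain ⟨u, hu⟩ := mem_stores.1 h
    have h1 := (coms_prefix_isus hV.memRun_left u a).subset (mem_coms.2 hu)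
    exact mem_nodeTags.2 ⟨_, mem_isus.1 h1, rfl, rfl⟩

theorem Valid.stT_mem {P : Program DOM THRD REG LAB} {V : List (TEvent DOM THRD)}
    (hV : Valid P V) {i j : ℕ} (h : StT V i j) : i ∈ nodeTags V ∧ j ∈ nodeTags V := by
  obtain ⟨a, p, q, ⟨l₁, l₂, h⟩, rfl, rfl⟩ := h
  obtain ⟨hp, hq⟩ := mem_of_split h
  obtain ⟨u, hu⟩ := mem_stores.1 hp
  obtain ⟨w, hw⟩ := mem_stores.1 hq
  exact ⟨hV.tag_mem hu, hV.tag_mem hw⟩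

theorem Valid.poT_mem {P : Program DOM THRD REG LAB} {V : List (TEvent DOM THRD)}
    (hV : Valid P V) {i j : ℕ} (h : PoT V i j) : i ∈ nodeTags V ∧ j ∈ nodeTags V := by
  obtain ⟨t, x, y, ⟨l₁, l₂, h⟩, rfl, rfl⟩ := h
  obtain ⟨hp, hq⟩ := mem_of_split h
  exact ⟨hV.tag_mem (mem_prog.1 hp).1, hV.tag_mem (mem_prog.1 hq).1⟩

theorem cf_ev {P : Program DOM THRD REG LAB} {V : List (TEvent DOM THRD)} (hV : Valid P V)
    {I J : ℕ} : Cf (ev V) I J ↔ ∃ l j, CfT V l j ∧ pos V l = I ∧ pos V j = J := by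
  have hsrc : ∀ {t a k s}, TEvent.ld t a k s ∈ V →
      ((∃ i, Src (ev V) i (pos V k)) ↔ ∃ i, SrcT V i k) := by
    intro t a k s hk
    simp only [src_ev hV]
    constructor
    · rintro ⟨_, i, l, h, rfl, hl⟩
      have := hV.pos_inj (hV.srcT_mem h).2 (hV.tag_mem hk) hl
      exact ⟨i, by rw [← show l = k from this]; exact h⟩
    · rintro ⟨i, h⟩
      exact ⟨_, i, k, h, rfl, rfl⟩
  have hst : ∀ {u a v k}, TEvent.st u a v k ∈ V →
      ((∃ i, St (ev V) i (pos V k)) ↔ ∃ i, StT V i k) := by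
    intro u a v k hk
    simp only [st_ev]
    constructor
    · rintro ⟨_, i, l, h, rfl, hl⟩
      have := hV.pos_inj (hV.stT_mem h).2 (hV.tag_mem hk) hl
      exact ⟨i, by rw [← show l = k from this]; exact h⟩
    · rintro ⟨i, h⟩
      exact ⟨_, i, k, h, rfl, rfl⟩
  constructor
  · rintro (⟨i, h1, h2⟩ | ⟨⟨a, ⟨t, hl⟩, q, u, hq⟩, h1, h2⟩)
    · obtain ⟨i', l, h3, hi', rfl⟩ := (src_ev hV).1 h1
      obtain ⟨i'', j, h4, hi'', rfl⟩ := st_ev.1 h2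
      have := hV.pos_inj (hV.srcT_mem h3).1 (hV.stT_mem h4).1 (hi'.trans hi''.symm)
      subst this
      exact ⟨l, j, Or.inl ⟨i', h3, h4⟩, rfl, rfl⟩
    · obtain ⟨k, s, hk⟩ := loadAt_ev.1 hl
      obtain ⟨v, j, hj, rfl⟩ := storeAt_ev.1 hq
      have hkm := List.mem_of_getElem? hk
      have hjm := List.mem_of_getElem? hj
      have hI := hV.posTag I _ hk rfl
      simp only [TEvent.tag] at hI
      subst hI
      rw [hsrc hkm] at h1
      rw [hst hjm] at h2
      exact ⟨k, j, Or.inr ⟨⟨a, ⟨t, s, hkm⟩, u, v, hjm⟩, h1, h2⟩, rfl, rfl⟩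
  · rintro ⟨l, j, ⟨i, h1, h2⟩ | ⟨⟨a, ⟨t, s, hl⟩, u, v, hj⟩, h1, h2⟩, rfl, rfl⟩
    · exact Or.inl ⟨pos V i, (src_ev hV).2 ⟨_, _, h1, rfl, rfl⟩, st_ev.2 ⟨_, _, h2, rfl, rfl⟩⟩
    · obtain ⟨n, hn⟩ := List.mem_iff_getElem?.1 hl
      obtain ⟨m, hm⟩ := List.mem_iff_getElem?.1 hj
      have hI := hV.posTag n _ hn rfl
      refine Or.inr ⟨⟨a, ⟨t, ?_⟩, m, u, storeAt_ev.2 ⟨v, j, hm, rfl⟩⟩, ?_, ?_⟩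
      · simp only [TEvent.tag] at hI
        rw [hI]
        exact loadAt_ev.2 ⟨l, s, hn⟩
      · rwa [hsrc hl]
      · rwa [hst hj]

theorem nodeAct_ev {V : List (TEvent DOM THRD)} {I : ℕ} {x : Act DOM THRD} :
    NodeAct (ev V) I x ↔ ∃ e ∈ V, pos V e.tag = I ∧ e.act = x ∧ ∀ t, x ≠ .isu t := by
  simp only [NodeAct, getElem?_ev]
  constructor
  · rintro ⟨p, ⟨e, he, h⟩, ht⟩
    simp only [Event.mk.injEq] at h
    exact ⟨e, List.mem_of_getElem? he, h.2.symm, h.1.symm, ht⟩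
  · rintro ⟨e, he, rfl, rfl, ht⟩
    obtain ⟨n, hn⟩ := List.mem_iff_getElem?.1 he
    exact ⟨n, ⟨e, hn, rfl⟩, ht⟩

/-- The nodes of the trace of a tagged computation are its node tags. -/
noncomputable def nodeEquiv {P : Program DOM THRD REG LAB} {V : List (TEvent DOM THRD)}
    (hV : Valid P V) : {k // k ∈ nodeTags V} ≃ {i // IsNode (ev V) i} :=
  Equiv.ofBijective (fun k => ⟨pos V k.1, (isNode_ev hV).2 ⟨k.1, k.2, rfl⟩⟩)
    ⟨fun i j h => Subtype.ext (hV.pos_inj i.2 j.2 (congrArg Subtype.val h)), fun i => by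
      obtain ⟨k, hk, h⟩ := (isNode_ev hV).1 i.2
      exact ⟨⟨k, hk⟩, Subtype.ext h⟩⟩

theorem nodeEquiv_coe {P : Program DOM THRD REG LAB} {V : List (TEvent DOM THRD)}
    (hV : Valid P V) (k : {k // k ∈ nodeTags V}) : (nodeEquiv hV k).1 = pos V k.1 := rfl

theorem Valid.rel_iff {P : Program DOM THRD REG LAB} {V : List (TEvent DOM THRD)}
    (hV : Valid P V) {S T : ℕ → ℕ → Prop}
    (hT : ∀ i j, T i j → i ∈ nodeTags V ∧ j ∈ nodeTags V)
    (h : ∀ {I J}, S I J ↔ ∃ i j, T i j ∧ pos V i = I ∧ pos V j = J)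
    {i j : ℕ} (hi : i ∈ nodeTags V) (hj : j ∈ nodeTags V) :
    S (pos V i) (pos V j) ↔ T i j := by
  rw [h]
  constructor
  · rintro ⟨i', j', hT', h1, h2⟩
    rwa [← hV.pos_inj (hT _ _ hT').1 hi h1, ← hV.pos_inj (hT _ _ hT').2 hj h2]
  · exact fun h => ⟨_, _, h, rfl, rfl⟩

theorem Valid.cfT_mem {P : Program DOM THRD REG LAB} {V : List (TEvent DOM THRD)}
    (hV : Valid P V) {i j : ℕ} (h : CfT V i j) : i ∈ nodeTags V ∧ j ∈ nodeTags V := by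
  rcases h with ⟨k, h1, h2⟩ | ⟨⟨a, ⟨t, s, h1⟩, u, v, h2⟩, -⟩
  · exact ⟨(hV.srcT_mem h1).2, (hV.stT_mem h2).2⟩
  · exact ⟨hV.tag_mem h1, hV.tag_mem h2⟩

theorem Valid.po_iff {P : Program DOM THRD REG LAB} {V : List (TEvent DOM THRD)}
    (hV : Valid P V) {i j : ℕ} (hi : i ∈ nodeTags V) (hj : j ∈ nodeTags V) :
    Po (ev V) (pos V i) (pos V j) ↔ PoT V i j :=
  hV.rel_iff (fun _ _ => hV.poT_mem) (po_ev hV) hi hj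

theorem Valid.st_iff {P : Program DOM THRD REG LAB} {V : List (TEvent DOM THRD)}
    (hV : Valid P V) {i j : ℕ} (hi : i ∈ nodeTags V) (hj : j ∈ nodeTags V) :
    St (ev V) (pos V i) (pos V j) ↔ StT V i j :=
  hV.rel_iff (fun _ _ => hV.stT_mem) st_ev hi hj

theorem Valid.src_iff {P : Program DOM THRD REG LAB} {V : List (TEvent DOM THRD)}
    (hV : Valid P V) {i j : ℕ} (hi : i ∈ nodeTags V) (hj : j ∈ nodeTags V) :
    Src (ev V) (pos V i) (pos V j) ↔ SrcT V i j :=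
  hV.rel_iff (fun _ _ => hV.srcT_mem) (src_ev hV) hi hj

theorem Valid.cf_iff {P : Program DOM THRD REG LAB} {V : List (TEvent DOM THRD)}
    (hV : Valid P V) {i j : ℕ} (hi : i ∈ nodeTags V) (hj : j ∈ nodeTags V) :
    Cf (ev V) (pos V i) (pos V j) ↔ CfT V i j :=
  hV.rel_iff (fun _ _ => hV.cfT_mem) (cf_ev hV) hi hj

theorem Valid.nodeAct_iff {P : Program DOM THRD REG LAB} {V : List (TEvent DOM THRD)}
    (hV : Valid P V) {k : ℕ} (hk : k ∈ nodeTags V) {x : Act DOM THRD} :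
    NodeAct (ev V) (pos V k) x ↔ ∃ e ∈ V, e.tag = k ∧ e.act = x ∧ ∀ t, x ≠ .isu t := by
  rw [nodeAct_ev]
  constructor
  · rintro ⟨e, he, h1, h2⟩
    exact ⟨e, he, hV.pos_inj (hV.tag_mem he) hk h1, h2⟩
  · rintro ⟨e, he, rfl, h2⟩
    exact ⟨e, he, rfl, h2⟩

/-- Since loads carry their source, the source relation depends only on the set of events, and the
conflict relation on that set and the store order. The isomorphism is the identity on tags. -/
theorem SameData.sameTrace {P : Program DOM THRD REG LAB} {V V' : List (TEvent DOM THRD)}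
    (hV : Valid P V) (hV' : Valid P V') (h : SameData V V') : SameTrace (ev V) (ev V') := by
  have hmem : ∀ e, e ∈ V ↔ e ∈ V' := fun e => h.perm.mem_iff
  have hn : ∀ k, k ∈ nodeTags V ↔ k ∈ nodeTags V' := fun k => by simp [mem_nodeTags, hmem]
  have hpo : PoT V = PoT V' := by unfold PoT; simp only [h.prog]
  have hst : StT V = StT V' := by unfold StT; simp only [h.stores]
  have hsrc : SrcT V = SrcT V' := by unfold SrcT; simp only [hmem]
  have hcf : CfT V = CfT V' := by unfold CfT; simp only [hmem, hst, hsrc]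
  let g : {k // k ∈ nodeTags V} ≃ {k // k ∈ nodeTags V'} := Equiv.subtypeEquivRight hn
  refine ⟨(nodeEquiv hV).symm.trans (g.trans (nodeEquiv hV')), ?_, ?_, ?_, ?_, ?_⟩
  · intro i x
    obtain ⟨k, rfl⟩ := (nodeEquiv hV).surjective i
    simp only [Equiv.trans_apply, Equiv.symm_apply_apply, nodeEquiv_coe]
    rw [hV.nodeAct_iff k.2, hV'.nodeAct_iff (g k).2]
    simp only [hmem]; rfl
  all_goals
    intro i j
    obtain ⟨k, rfl⟩ := (nodeEquiv hV).surjective i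
    obtain ⟨l, rfl⟩ := (nodeEquiv hV).surjective j
    simp only [Equiv.trans_apply, Equiv.symm_apply_apply, nodeEquiv_coe]
  · rw [hV.po_iff k.2 l.2, hV'.po_iff (g k).2 (g l).2, hpo]; rfl
  · rw [hV.st_iff k.2 l.2, hV'.st_iff (g k).2 (g l).2, hst]; rfl
  · rw [hV.src_iff k.2 l.2, hV'.src_iff (g k).2 (g l).2, hsrc]; rfl
  · rw [hV.cf_iff k.2 l.2, hV'.cf_iff (g k).2 (g l).2, hcf]; rfl

theorem SameTrace.trans {τ σ υ : List (Event DOM THRD)} (h : SameTrace τ σ)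
    (h' : SameTrace σ υ) : SameTrace τ υ := by
  obtain ⟨f, f1, f2, f3, f4, f5⟩ := h
  obtain ⟨g, g1, g2, g3, g4, g5⟩ := h'
  exact ⟨f.trans g, fun i x => (f1 i x).trans (g1 _ x), fun i j => (f2 i j).trans (g2 _ _),
    fun i j => (f3 i j).trans (g3 _ _), fun i j => (f4 i j).trans (g4 _ _),
    fun i j => (f5 i j).trans (g5 _ _)⟩

end Trace

/-! ### Sequentially consistent traces are acyclic -/

section SC

variable {DOM THRD REG LAB : Type*} [Zero DOM] [DecidableEq DOM] [DecidableEq THRD]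
  [DecidableEq REG]

theorem SCComputations.storeAt {P : Program DOM THRD REG LAB} {σ : List (Event DOM THRD)}
    (h : σ ∈ P.SCComputations) {p I : ℕ} {t : THRD} {a : DOM} (hs : StoreAt σ p t a I) :
    p = I + 1 := by
  obtain ⟨v, hv⟩ := hs
  exact h.2 p _ hv rfl

theorem SCComputations.st_lt {P : Program DOM THRD REG LAB} {σ : List (Event DOM THRD)}
    (h : σ ∈ P.SCComputations) {I J : ℕ} (hst : St σ I J) : I < J := by
  obtain ⟨a, p, q, ⟨t, hp⟩, ⟨u, hq⟩, hpq, -⟩ := hst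
  have := SCComputations.storeAt h hp
  have := SCComputations.storeAt h hq
  omega

theorem SCComputations.not_pending {P : Program DOM THRD REG LAB} {σ : List (Event DOM THRD)}
    (h : σ ∈ P.SCComputations) {l I : ℕ} {t : THRD} {a : DOM} : ¬ PendingAt σ l t a I := by
  rintro ⟨hI, q, hq, hs⟩
  have := SCComputations.storeAt h hs
  omega

theorem SCComputations.src_lt {P : Program DOM THRD REG LAB} {σ : List (Event DOM THRD)}
    (h : σ ∈ P.SCComputations) {I J : ℕ} (hs : Src σ I J) : I < J := by
  obtain ⟨t, a, -, ⟨hp, -⟩ | ⟨-, p, hp, ⟨u, hu⟩, -⟩⟩ := hs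
  · exact hp.1
  · have := SCComputations.storeAt h hu
    omega

theorem exists_last_store {τ : List (Event DOM THRD)} {a : DOM} (l : ℕ) :
    (∃ q I, q < l ∧ ∃ u, StoreAt τ q u a I) → ∃ q I, q < l ∧ (∃ u, StoreAt τ q u a I) ∧
      ∀ k, q < k → k < l → ¬ ∃ u i', StoreAt τ k u a i' := by
  induction l with
  | zero => rintro ⟨q, I, hq, -⟩; omega
  | succ l ih =>
    rintro ⟨q, I, hq, h⟩
    by_cases hl : ∃ u I, StoreAt τ l u a I
    · obtain ⟨u, I, hI⟩ := hl
      exact ⟨l, I, by omega, ⟨u, hI⟩, fun k hk hk' => by omega⟩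
    · have hql : q ≠ l := by
        rintro rfl
        obtain ⟨u, hu⟩ := h
        exact hl ⟨u, I, hu⟩
      obtain ⟨q', I', hq', h1, h2⟩ := ih ⟨q, I, by omega, h⟩
      refine ⟨q', I', by omega, h1, fun k hk hk' => ?_⟩
      by_cases hkl : k = l
      · subst hkl; exact hl
      · exact h2 k hk (by omega)

/-- The store is executed after the load, and its issue sits one position before the store. That
position is not the load, as the tagged form of the computation shows an issue there; so the issue,
too, comes after the load. -/
theorem SCComputations.cf_lt {P : Program DOM THRD REG LAB} (hP : P.FenceFree)
    {σ : List (Event DOM THRD)} (h : σ ∈ P.SCComputations) {I J : ℕ} (hc : Cf σ I J) : I < J := by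
  have key : ∀ {t a q u b}, LoadAt σ I t a → StoreAt σ q u b J → I < q → I < J := by
    intro t a q u b hl hs hq
    have h1 := SCComputations.storeAt h hs
    refine lt_of_le_of_ne (by omega) ?_
    rintro rfl
    obtain ⟨W, hW, rfl, -⟩ := exists_valid hP h.1
    obtain ⟨v, k, hk, hpos⟩ := storeAt_ev.1 hs
    obtain ⟨j, s, hj⟩ := loadAt_ev.1 hl
    have h2 := hW.posTag I _ hj rfl
    have h3 := hW.issue_mem (List.mem_of_getElem? hk)
    have h4 := hW.pos_inj (hW.tag_mem h3) (hW.tag_mem (List.mem_of_getElem? hj))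
      (hpos.trans h2.symm)
    have h5 := hW.node_eq h3 (List.mem_of_getElem? hj) rfl rfl h4
    simp [TEvent.issue] at h5
  rcases hc with ⟨i, h1, h2⟩ | ⟨⟨a, ⟨t, hl⟩, q, u, hq⟩, h1, h2⟩
  · obtain ⟨t, a, hl, ⟨hp, -⟩ | ⟨-, p, hp, ⟨w, hw⟩, hb⟩⟩ := h1
    · exact absurd hp (SCComputations.not_pending h)
    · obtain ⟨b, p', q, ⟨w', hw'⟩, ⟨u, hu⟩, hpq, -⟩ := h2
      have e1 := SCComputations.storeAt h hw
      have e2 := SCComputations.storeAt h hw'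
      obtain rfl : p = p' := by omega
      obtain ⟨v, hv⟩ := hw
      obtain ⟨v', hv'⟩ := hw'
      rw [hv] at hv'
      simp only [Option.some.injEq, Event.mk.injEq, Act.st.injEq, and_true] at hv'
      obtain ⟨-, rfl, -⟩ := hv'
      refine key hl hu ?_
      by_contra hc
      rcases (not_lt.1 hc).lt_or_eq with hlt | rfl
      · exact hb q hpq hlt ⟨u, J, hu⟩
      · obtain ⟨v, hv⟩ := hu
        obtain ⟨v', i', hl⟩ := hl
        rw [hv] at hl
        simp at hl
  · refine key hl hq ?_
    by_contra hc
    rcases (not_lt.1 hc).lt_or_eq with hlt | rfl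
    · obtain ⟨q', I', hq', h3, h4⟩ := exists_last_store I ⟨q, J, hlt, u, hq⟩
      exact h1 ⟨I', t, a, hl, Or.inr ⟨fun i' => SCComputations.not_pending h, q', hq', h3, h4⟩⟩
    · obtain ⟨v, hv⟩ := hq
      obtain ⟨v', i', hl⟩ := hl
      rw [hv] at hl
      simp at hl

/-- `ρ` increases along the happens-before relations of `V`. -/
structure Ranked (V : List (TEvent DOM THRD)) (ρ : ℕ → ℕ) : Prop where
  po : ∀ i j, PoT V i j → ρ i < ρ j
  st : ∀ i j, StT V i j → ρ i < ρ j
  src : ∀ i j, SrcT V i j → ρ i < ρ j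
  cf : ∀ i j, CfT V i j → ρ i < ρ j

/-- The rank of a tag is the position of the corresponding node in the SC computation, where all
four relations point forward. Numbers that are not tags get the irrelevant value 0. -/
theorem exists_ranked {P : Program DOM THRD REG LAB} (hP : P.FenceFree)
    {V : List (TEvent DOM THRD)} (hV : Valid P V) {σ : List (Event DOM THRD)}
    (h : σ ∈ P.SCComputations) (hs : SameTrace (ev V) σ) : ∃ ρ, Ranked V ρ := by
  classical
  obtain ⟨f, -, f2, f3, f4, f5⟩ := hs
  refine ⟨fun k => if hk : k ∈ nodeTags V then (f (nodeEquiv hV ⟨k, hk⟩)).1 else 0, ?_, ?_, ?_, ?_⟩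
  · intro i j hij
    obtain ⟨hi, hj⟩ := hV.poT_mem hij
    simp only [hi, hj, dif_pos]
    obtain ⟨t, -, -, hlt, -⟩ := (f2 (nodeEquiv hV ⟨i, hi⟩) (nodeEquiv hV ⟨j, hj⟩)).1
      ((hV.po_iff hi hj).2 hij)
    exact hlt
  · intro i j hij
    obtain ⟨hi, hj⟩ := hV.stT_mem hij
    simp only [hi, hj, dif_pos]
    exact SCComputations.st_lt h ((f3 (nodeEquiv hV ⟨i, hi⟩) (nodeEquiv hV ⟨j, hj⟩)).1
      ((hV.st_iff hi hj).2 hij))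
  · intro i j hij
    obtain ⟨hi, hj⟩ := hV.srcT_mem hij
    simp only [hi, hj, dif_pos]
    exact SCComputations.src_lt h ((f4 (nodeEquiv hV ⟨i, hi⟩) (nodeEquiv hV ⟨j, hj⟩)).1
      ((hV.src_iff hi hj).2 hij))
  · intro i j hij
    obtain ⟨hi, hj⟩ := hV.cfT_mem hij
    simp only [hi, hj, dif_pos]
    exact SCComputations.cf_lt hP h ((f5 (nodeEquiv hV ⟨i, hi⟩) (nodeEquiv hV ⟨j, hj⟩)).1
      ((hV.cf_iff hi hj).2 hij))

theorem Ranked.prog_pairwise {V : List (TEvent DOM THRD)} {ρ : ℕ → ℕ} (h : Ranked V ρ)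
    (t : THRD) : (prog t V).Pairwise fun x y => ρ x.tag < ρ y.tag := by
  have : Trans (fun x y : TEvent DOM THRD => ρ x.tag < ρ y.tag)
    (fun x y : TEvent DOM THRD => ρ x.tag < ρ y.tag)
    (fun x y : TEvent DOM THRD => ρ x.tag < ρ y.tag) := ⟨fun h1 h2 => lt_trans h1 h2⟩
  rw [← List.isChain_iff_pairwise, List.isChain_iff_forall_rel_of_append_cons_cons]
  intro x y l₁ l₂ hl
  exact h.po _ _ ⟨t, x, y, ⟨l₁, l₂, hl⟩, rfl, rfl⟩

theorem Ranked.stores_pairwise {V : List (TEvent DOM THRD)} {ρ : ℕ → ℕ} (h : Ranked V ρ)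
    (a : DOM) : (stores a V).Pairwise fun p q => ρ p.1 < ρ q.1 := by
  have : Trans (fun x y : ℕ × DOM => ρ x.1 < ρ y.1)
    (fun x y : ℕ × DOM => ρ x.1 < ρ y.1)
    (fun x y : ℕ × DOM => ρ x.1 < ρ y.1) := ⟨fun h1 h2 => lt_trans h1 h2⟩
  rw [← List.isChain_iff_pairwise, List.isChain_iff_forall_rel_of_append_cons_cons]
  intro x y l₁ l₂ hl
  exact h.st _ _ ⟨a, x, y, ⟨l₁, l₂, hl⟩, rfl, rfl⟩

theorem Ranked.po_lt {A B : List (TEvent DOM THRD)} {ρ : ℕ → ℕ} (h : Ranked (A ++ B) ρ)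
    {x y : TEvent DOM THRD} (hx : x ∈ A) (hy : y ∈ B) (hxs : x.isStore = false)
    (hys : y.isStore = false) (hxy : x.thread = y.thread) : ρ x.tag < ρ y.tag := by
  have := h.prog_pairwise x.thread
  rw [prog_append, List.pairwise_append] at this
  exact this.2.2 x (mem_prog.2 ⟨hx, hxs, rfl⟩) y (mem_prog.2 ⟨hy, hys, hxy.symm⟩)

theorem Ranked.st_lt {A B : List (TEvent DOM THRD)} {ρ : ℕ → ℕ} (h : Ranked (A ++ B) ρ)
    {a : DOM} {p q : ℕ × DOM} (hp : p ∈ stores a A) (hq : q ∈ stores a B) : ρ p.1 < ρ q.1 := by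
  have := h.stores_pairwise a
  rw [stores_append, List.pairwise_append] at this
  exact this.2.2 p hp q hq

/-- A load whose source, if any, is among the stores in `A` happens before the stores to its
address in `B`. -/
theorem Ranked.cf_lt {P : Program DOM THRD REG LAB} {A B : List (TEvent DOM THRD)} {ρ : ℕ → ℕ}
    (hV : Valid P (A ++ B)) (h : Ranked (A ++ B) ρ) {t : THRD} {a : DOM} {l : ℕ}
    {s : Option (ℕ × DOM)} (hl : TEvent.ld t a l s ∈ A ++ B) (hs : ∀ p, s = some p → p ∈ stores a A)
    {q : ℕ × DOM} (hq : q ∈ stores a B) : ρ l < ρ q.1 := by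
  have hpw := h.stores_pairwise a
  -- The conflict relation only reaches the first store `q₀` after the source; store order leads
  -- from there to `q`.
  have hsplit : ∀ l₁ q₀ l₂, stores a (A ++ B) = l₁ ++ q₀ :: l₂ → q ∈ q₀ :: l₂ →
      ρ q₀.1 ≤ ρ q.1 := by
    intro l₁ q₀ l₂ h1 h2
    rw [h1, List.pairwise_append, List.pairwise_cons] at hpw
    rcases List.mem_cons.1 h2 with rfl | h2
    · exact le_rfl
    · exact (hpw.2.1.1 q h2).le
  cases s with
  | none =>
    have hqV : q ∈ stores a (A ++ B) := by rw [stores_append]; exact List.mem_append_right _ hq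
    obtain ⟨q₀, l₂, h1⟩ := List.exists_cons_of_ne_nil (List.ne_nil_of_mem hqV)
    refine lt_of_lt_of_le (h.cf l q₀.1 (Or.inr ⟨⟨a, ⟨t, none, hl⟩, ?_⟩, ?_, ?_⟩))
      (hsplit [] q₀ l₂ h1 (h1 ▸ hqV))
    · obtain ⟨u, hu⟩ := mem_stores.1 (show q₀ ∈ stores a (A ++ B) by rw [h1]; simp)
      exact ⟨u, q₀.2, hu⟩
    · rintro ⟨i, t', a', p, hp, -⟩
      have := hV.node_eq hl hp rfl rfl rfl
      simp at this
    · rintro ⟨i, b, p, q', ⟨l₁, l₃, h2⟩, -, hq'⟩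
      obtain ⟨u, hu⟩ := mem_stores.1 (show q₀ ∈ stores a (A ++ B) by rw [h1]; simp)
      obtain ⟨u', hu'⟩ := mem_stores.1 (mem_of_split h2).2
      have := hV.node_eq (hV.issue_mem hu) (hV.issue_mem hu') rfl rfl hq'.symm
      simp only [TEvent.issue, TEvent.isu.injEq] at this
      obtain ⟨-, rfl, -⟩ := this
      rw [h2] at hpw h1
      have h3 : q' ∈ l₂ := by
        cases l₁ <;> simp at h1 <;> rw [← h1.2] <;> simp
      rw [h1, List.pairwise_cons] at hpw
      have := hpw.1 q' h3
      rw [hq'] at this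
      exact lt_irrefl _ this
  | some p =>
    obtain ⟨l₁, l₂, h1⟩ := List.append_of_mem (hs p rfl)
    obtain ⟨q₀, l₃, h2⟩ := List.exists_cons_of_ne_nil (List.ne_nil_of_mem
      (List.mem_append_right l₂ hq))
    have h3 : stores a (A ++ B) = l₁ ++ p :: q₀ :: l₃ := by
      rw [stores_append, h1, ← h2]; simp
    refine lt_of_lt_of_le (h.cf l q₀.1 (Or.inl ⟨p.1, ⟨t, a, p, hl, rfl⟩, a, p, q₀,
      ⟨l₁, l₃, h3⟩, rfl, rfl⟩)) (hsplit (l₁ ++ [p]) q₀ l₃ (by simp [h3]) ?_)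
    rw [← h2]
    exact List.mem_append_right _ hq

end SC

/-! ### The cost of tagged computations -/

section Delay

variable {DOM THRD : Type*}

open Classical in
/-- The number of delays in `R` after `T`, counted at the overtaken events. -/
noncomputable def dl : List (TEvent DOM THRD) → List (TEvent DOM THRD) → ℕ
  | _, [] => 0
  | T, f :: R => R.countP (fun x => x.isStore = true ∧ x.thread = f.thread ∧ x.issue ∈ T) +
      dl (T ++ [f]) R

theorem countP_eq_card {α : Type*} (q : α → Prop) [DecidablePred q] (R : List α) :
    ∀ T : List α, R.countP (fun x => q x) =
      ((Finset.Ico T.length (T.length + R.length)).filter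
        fun p => ∃ x ∈ (T ++ R)[p]?, q x).card := by
  induction R with
  | nil => simp
  | cons f R ih =>
    intro T
    have := ih (T ++ [f])
    simp only [List.length_append, List.length_singleton, List.append_assoc,
      List.singleton_append] at this
    rw [List.countP_cons, this]
    have hI : Finset.Ico T.length (T.length + (f :: R).length) =
        insert T.length (Finset.Ico (T.length + 1) (T.length + 1 + R.length)) := by
      ext k; simp; omega
    rw [hI, Finset.filter_insert]
    by_cases hf : q f <;> simp [hf]

open Classical in
theorem dl_eq_sum (R : List (TEvent DOM THRD)) : ∀ T : List (TEvent DOM THRD),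
    dl T R = ∑ k ∈ Finset.Ico T.length (T ++ R).length,
      ((Finset.range (T ++ R).length).filter fun p => k < p ∧ ∃ x ∈ (T ++ R)[p]?,
        ∃ f ∈ (T ++ R)[k]?, x.isStore = true ∧ x.thread = f.thread ∧
          x.issue ∈ (T ++ R).take k).card := by
  induction R with
  | nil => simp [dl]
  | cons f R ih =>
    intro T
    have h1 := ih (T ++ [f])
    simp only [List.length_append, List.length_singleton, List.append_assoc,
      List.singleton_append] at h1
    rw [dl, Finset.sum_eq_sum_Ico_succ_bot (by simp)]
    congr 1
    · rw [countP_eq_card _ R (T ++ [f])]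
      congr 1
      ext p
      simp only [List.length_append, List.length_singleton, List.append_assoc,
        List.singleton_append, Finset.mem_filter, Finset.mem_Ico, Finset.mem_range,
        List.length_cons, List.length_nil]
      rw [List.getElem?_append_right (le_refl T.length)]
      simp only [Nat.sub_self, List.getElem?_cons_zero, Option.mem_def, Option.some.injEq,
        exists_eq_left']
      rw [List.take_left']
      · constructor
        · rintro ⟨h1, h2⟩; exact ⟨by omega, by omega, h2⟩
        · rintro ⟨h1, h2, h3⟩; exact ⟨by omega, h3⟩
      · rfl
    · rw [h1]
      simp only [List.length_append]

theorem mem_take_iff {α : Type*} {V : List α} {k : ℕ} {x : α} :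
    x ∈ V.take k ↔ ∃ n < k, V[n]? = some x := by
  rw [List.mem_iff_getElem?]
  constructor
  · rintro ⟨n, hn⟩
    rw [List.getElem?_take] at hn
    split_ifs at hn with h
    exact ⟨n, h, hn⟩
  · rintro ⟨n, h, hn⟩
    exact ⟨n, by rw [List.getElem?_take, if_pos h, hn]⟩

variable [DecidableEq DOM] [DecidableEq THRD] [Zero DOM] {REG LAB : Type*} [DecidableEq REG]

theorem Valid.issue_mem_take {P : Program DOM THRD REG LAB} {V : List (TEvent DOM THRD)}
    (hV : Valid P V) {x : TEvent DOM THRD} (hx : x ∈ V) {k : ℕ} :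
    x.issue ∈ V.take k ↔ pos V x.tag < k := by
  rw [mem_take_iff]
  obtain ⟨n, hn⟩ := List.mem_iff_getElem?.1 (hV.issue_mem hx)
  have h1 := hV.posTag n _ hn x.isStore_issue
  rw [x.tag_issue] at h1
  rw [h1]
  constructor
  · rintro ⟨m, hm, hm'⟩
    have h2 := hV.posTag m _ hm' x.isStore_issue
    rw [x.tag_issue, h1] at h2
    omega
  · exact fun h => ⟨n, h, hn⟩

/-- Double counting of pairs of a store and an event it overtakes: `delays` groups them by store,
`dl` by overtaken event. The latter allows recursion along the list. -/
theorem Valid.delays_ev {P : Program DOM THRD REG LAB} {V : List (TEvent DOM THRD)}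
    (hV : Valid P V) : delays (ev V) = dl [] V := by
  classical
  have hlen : (ev V).length = V.length := length_relabel _ _
  rw [dl_eq_sum]
  simp only [List.nil_append, List.length_nil, ← Finset.range_eq_Ico, Finset.card_filter]
  rw [Finset.sum_comm]
  have h1 : delays (ev V) = ∑ p ∈ Finset.range (ev V).length,
      if ∃ x ∈ V[p]?, x.isStore = true then
        ((Finset.range V.length).filter fun k => k < p ∧ ∃ x ∈ V[p]?, ∃ f ∈ V[k]?,
          x.thread = f.thread ∧ pos V x.tag < k).card else 0 := by
    rw [Finset.sum_range, delays, sumIssued]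
    refine Finset.sum_congr rfl fun p _ => ?_
    obtain ⟨x, hx, he⟩ := getElem?_ev.1 (List.getElem?_eq_getElem p.2)
    simp only [Fin.getElem_fin, he, hx, Option.mem_def, Option.some.injEq, exists_eq_left',
      TEvent.isIssued_act]
    congr 1
    rw [delaysAt, between]
    congr 1
    ext k
    simp only [Finset.mem_filter, Finset.mem_Ioo, Finset.mem_range, Option.mem_def,
      getElem?_ev, Event.thread]
    have hp := p.2
    constructor
    · rintro ⟨⟨h1, h2⟩, e, ⟨f, hf, rfl⟩, h3⟩
      refine ⟨by omega, h2, f, hf, ?_, h1⟩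
      rw [TEvent.thread_act] at h3
      exact (TEvent.thread_act x).symm.trans h3.symm
    · rintro ⟨-, h2, f, hf, h3, h1⟩
      exact ⟨⟨h1, h2⟩, _, ⟨f, hf, rfl⟩, by rw [TEvent.thread_act]; exact h3.symm.trans (TEvent.thread_act x).symm⟩
  rw [h1, hlen]
  refine Finset.sum_congr rfl fun p hp => ?_
  have hp := Finset.mem_range.1 hp
  have hx := List.getElem?_eq_getElem hp
  have hm : V[p] ∈ V := List.getElem_mem hp
  simp only [hx, Option.mem_def, Option.some.injEq, exists_eq_left', hV.issue_mem_take hm]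
  rw [Finset.card_filter]
  split_ifs with h
  · simp [h]
  · simp [h]

end Delay

/-! ### How exchanging and dropping events changes the delays -/

section DelayLemmas

variable {DOM THRD : Type*}

theorem dl_congr_left {R : List (TEvent DOM THRD)} : ∀ {T T' : List (TEvent DOM THRD)},
    (∀ x, x ∈ T ↔ x ∈ T') → dl T R = dl T' R := by
  induction R with
  | nil => intros; rfl
  | cons f R ih =>
    intro T T' h
    rw [dl, dl, ih (T := T ++ [f]) (T' := T' ++ [f]) (by simp [h])]
    congr 2
    funext x
    exact decide_eq_decide.2 (and_congr_right fun _ => and_congr_right fun _ => h _)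

theorem dl_append_congr {A : List (TEvent DOM THRD)} :
    ∀ {T R R' : List (TEvent DOM THRD)}, R.Perm R' → dl (T ++ A) R = dl (T ++ A) R' →
      dl T (A ++ R) = dl T (A ++ R') := by
  classical
  induction A with
  | nil => intro T R R' _ h; simpa using h
  | cons f A ih =>
    intro T R R' hp h
    rw [List.cons_append, List.cons_append, dl, dl, (hp.append_left A).countP_eq,
      ih hp (by simpa using h)]

/-- An event of `A` contributes a count of certain stores behind it, so the continuation matters to
`A` only through such counts. -/
theorem dl_append_le {A : List (TEvent DOM THRD)} {R R' : List (TEvent DOM THRD)}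
    (hc : ∀ q : TEvent DOM THRD → Bool, (∀ x, q x = true → x.isStore = true) →
      R.countP q ≤ R'.countP q) :
    ∀ {T : List (TEvent DOM THRD)}, dl (T ++ A) R ≤ dl (T ++ A) R' →
      dl T (A ++ R) ≤ dl T (A ++ R') := by
  classical
  induction A with
  | nil => intro T h; simpa using h
  | cons f A ih =>
    intro T h
    rw [List.cons_append, List.cons_append, dl, dl, List.countP_append, List.countP_append]
    refine add_le_add (add_le_add_right (hc _ fun x hx => ?_) _) (ih (by simpa using h))
    simp only [decide_eq_true_eq] at hx
    exact hx.1

theorem dl_append_lt {A : List (TEvent DOM THRD)} {R R' : List (TEvent DOM THRD)}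
    (hp : R.Perm R') :
    ∀ {T : List (TEvent DOM THRD)}, dl (T ++ A) R < dl (T ++ A) R' →
      dl T (A ++ R) < dl T (A ++ R') := by
  classical
  induction A with
  | nil => intro T h; simpa using h
  | cons f A ih =>
    intro T h
    rw [List.cons_append, List.cons_append, dl, dl, (hp.append_left A).countP_eq]
    exact Nat.add_lt_add_left (ih (by simpa using h)) _

theorem dl_swap_eq {T R : List (TEvent DOM THRD)} {d e : TEvent DOM THRD}
    (h : d.thread ≠ e.thread) : dl T (d :: e :: R) = dl T (e :: d :: R) := by
  classical
  simp only [dl, List.countP_cons]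
  rw [dl_congr_left (T := T ++ [d] ++ [e]) (T' := T ++ [e] ++ [d]) (by simp; tauto)]
  have h1 : ∀ x : TEvent DOM THRD, (x.isStore = true ∧ x.thread = e.thread ∧ x.issue ∈ T ++ [d]) ↔
      (x.isStore = true ∧ x.thread = e.thread ∧ x.issue ∈ T) := by
    intro x
    simp only [List.mem_append, List.mem_singleton]
    constructor
    · rintro ⟨h1, h2, h3 | rfl⟩
      · exact ⟨h1, h2, h3⟩
      · rw [x.thread_issue] at h; exact absurd h2 h
    · exact fun h => ⟨h.1, h.2.1, Or.inl h.2.2⟩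
  have h2 : ∀ x : TEvent DOM THRD, (x.isStore = true ∧ x.thread = d.thread ∧ x.issue ∈ T ++ [e]) ↔
      (x.isStore = true ∧ x.thread = d.thread ∧ x.issue ∈ T) := by
    intro x
    simp only [List.mem_append, List.mem_singleton]
    constructor
    · rintro ⟨h1, h2, h3 | rfl⟩
      · exact ⟨h1, h2, h3⟩
      · rw [x.thread_issue] at h; exact absurd h2.symm h
    · exact fun h => ⟨h.1, h.2.1, Or.inl h.2.2⟩
  simp only [h1, h2, h, Ne.symm h, false_and, and_false]
  simp
  omega

/-- A store that was issued before exchanges its position with a preceding event of its thread. -/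
theorem dl_swap_store {T R : List (TEvent DOM THRD)} {d e : TEvent DOM THRD}
    (h : d.thread = e.thread) (he : e.isStore = true) (hi : e.issue ∈ T) :
    dl T (e :: d :: R) ≤ dl T (d :: e :: R) ∧
      (d.isStore = false → dl T (e :: d :: R) < dl T (d :: e :: R)) := by
  classical
  simp only [dl, List.countP_cons]
  rw [dl_congr_left (T := T ++ [d] ++ [e]) (T' := T ++ [e] ++ [d]) (by simp; tauto)]
  have h2 : ∀ x : TEvent DOM THRD, (x.isStore = true ∧ x.thread = e.thread ∧ x.issue ∈ T ++ [e]) ↔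
      (x.isStore = true ∧ x.thread = e.thread ∧ x.issue ∈ T) := by
    intro x
    simp only [List.mem_append, List.mem_singleton]
    constructor
    · rintro ⟨h1, h2, h3 | rfl⟩
      · exact ⟨h1, h2, h3⟩
      · rw [x.isStore_issue] at he; simp at he
    · exact fun h => ⟨h.1, h.2.1, Or.inl h.2.2⟩
  have h3 : R.countP (fun x => decide (x.isStore = true ∧ x.thread = e.thread ∧ x.issue ∈ T)) ≤
      R.countP (fun x => decide (x.isStore = true ∧ x.thread = e.thread ∧ x.issue ∈ T ++ [d])) := by
    refine List.countP_mono_left fun x _ hx => ?_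
    simp only [decide_eq_true_eq, List.mem_append] at hx ⊢
    exact ⟨hx.1, hx.2.1, Or.inl hx.2.2⟩
  simp only [h2, h, he, hi, and_self, decide_true, if_true]
  -- Before the exchange `e` overtakes `d`. Afterwards `d` can overtake `e` only if `d` is a store;
  -- this accounts for at most one delay.
  constructor
  · split_ifs <;> omega
  · intro hd
    simp only [hd, Bool.false_eq_true, false_and, decide_false, if_false]
    omega

/-- Of two stores of one thread that are both already issued, the later one overtakes the earlier
one in either order: one delay each time. -/
theorem dl_perm_stores {T R R' : List (TEvent DOM THRD)} (hp : R.Perm R')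
    (hs : ∀ x ∈ R, x.isStore = true) (hi : ∀ x ∈ R, x.issue ∈ T) : dl T R = dl T R' := by
  classical
  induction hp generalizing T with
  | nil => rfl
  | @cons x l l' hp ih =>
    rw [dl, dl, hp.countP_eq, ih (fun y hy => hs y (List.mem_cons_of_mem _ hy))
      fun y hy => List.mem_append_left _ (hi y (List.mem_cons_of_mem _ hy))]
  | swap x y l =>
    by_cases h : y.thread = x.thread
    · exact le_antisymm
        (dl_swap_store h.symm (hs y (by simp)) (hi y (by simp))).1
        (dl_swap_store h (hs x (by simp)) (hi x (by simp))).1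
    · exact dl_swap_eq h
  | trans h1 h2 ih1 ih2 =>
    rw [ih1 hs hi, ih2 (fun x hx => hs x (h1.mem_iff.2 hx)) fun x hx => hi x (h1.mem_iff.2 hx)]

theorem dl_filter_le {q : TEvent DOM THRD → Bool} {R : List (TEvent DOM THRD)} :
    ∀ {T T' : List (TEvent DOM THRD)},
      (∀ x ∈ R, q x = true → x.isStore = true) →
      (∀ x : TEvent DOM THRD, x.isStore = true → x.issue ∈ T → x.issue ∈ T') →
      dl T (R.filter q) ≤ dl T' R := by
  classical
  induction R with
  | nil => intros; simp [dl]
  | cons f R ih =>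
    intro T T' hq h
    have hq' : ∀ x ∈ R, q x = true → x.isStore = true :=
      fun x hx => hq x (List.mem_cons_of_mem _ hx)
    by_cases hf : q f = true
    · rw [List.filter_cons_of_pos hf, dl, dl]
      refine add_le_add ?_ (ih hq' fun x hx hxT => ?_)
      · refine (List.filter_sublist.countP_le).trans (List.countP_mono_left fun x _ hx => ?_)
        simp only [decide_eq_true_eq] at hx ⊢
        exact ⟨hx.1, hx.2.1, h x hx.1 hx.2.2⟩
      · rw [List.mem_append] at hxT ⊢
        exact hxT.imp_left (h x hx)
    · rw [List.filter_cons_of_neg hf, dl]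
      refine (ih (T' := T' ++ [f]) hq' fun x hx hxT => ?_).trans (Nat.le_add_left _ _)
      exact List.mem_append_left _ (h x hx hxT)

end DelayLemmas

/-! ### Moving events ahead of the events they do not depend on -/

section Move

variable {DOM THRD REG LAB : Type*} [Zero DOM] [DecidableEq DOM] [DecidableEq THRD]
  [DecidableEq REG]

/-- A tagged computation that is a violation. -/
def Bad (P : Program DOM THRD REG LAB) (V : List (TEvent DOM THRD)) : Prop :=
  Valid P V ∧ P.IsViolation (ev V)

theorem Bad.of_sameData {P : Program DOM THRD REG LAB} {V V' : List (TEvent DOM THRD)}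
    (h : Bad P V) (hV' : Valid P V') (hd : SameData V V') : Bad P V' := by
  refine ⟨hV', hV'.ev_mem_computations, ?_⟩
  rintro ⟨σ, hσ, hs⟩
  exact h.2.2 ⟨σ, hσ, (hd.sameTrace h.1 hV').trans hs⟩

theorem Bad.swap {P : Program DOM THRD REG LAB} {L R : List (TEvent DOM THRD)}
    {d e : TEvent DOM THRD} (h : Bad P (L ++ d :: e :: R)) (hi : ¬ Dep L d e) :
    Bad P (L ++ e :: d :: R) :=
  h.of_sameData (h.1.swap hi) (sameData_swap hi)

theorem Valid.issue_mem_left {P : Program DOM THRD REG LAB} {L R : List (TEvent DOM THRD)}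
    {e : TEvent DOM THRD} (h : Valid P (L ++ e :: R)) (he : e.isStore = true) : e.issue ∈ L := by
  cases e with
  | st t a v k =>
    have h1 : coms t a L ++ [(k, v)] <+: isus t a L := h.memOK
    exact mem_isus.1 (h1.subset (show (k, v) ∈ _ by simp))
  | _ => simp [TEvent.isStore] at he

/-- A non-store event depends on every earlier event of its thread. So in an independent pair of one
thread, `e` is a store, and it was issued before both events. -/
theorem dl_swap {P : Program DOM THRD REG LAB} {L R : List (TEvent DOM THRD)}
    {d e : TEvent DOM THRD} (h : Valid P (L ++ d :: e :: R)) (hi : ¬ Dep L d e) :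
    dl [] (L ++ e :: d :: R) ≤ dl [] (L ++ d :: e :: R) ∧
      (d.thread = e.thread → d.isStore = false → e.isStore = true →
        dl [] (L ++ e :: d :: R) < dl [] (L ++ d :: e :: R)) := by
  have hp : (e :: d :: R).Perm (d :: e :: R) := .swap _ _ _
  by_cases ht : d.thread = e.thread
  · have he : e.isStore = true := by
      by_contra hc
      apply hi
      cases e <;> simp_all [Dep, TEvent.isStore, TEvent.thread]
    have hL : e.issue ∈ L := by
      have h1 : Valid P ((L ++ [d]) ++ e :: R) := by simpa using h
      have h2 := h1.issue_mem_left he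
      rw [List.mem_append, List.mem_singleton] at h2
      refine h2.resolve_right fun h3 => hi ?_
      cases e <;> simp_all [Dep, TEvent.isStore, TEvent.issue]
    obtain ⟨h1, h2⟩ := dl_swap_store (T := [] ++ L) (R := R) ht he (by simpa using hL)
    exact ⟨dl_append_le (fun q _ => hp.countP_eq q |>.le) h1,
      fun _ hd _ => dl_append_lt hp (h2 hd)⟩
  · exact ⟨(dl_append_congr hp (dl_swap_eq ht).symm).le, fun h => absurd h ht⟩

/-- The event moves left by successive exchanges, each judged in the prefix `A ++ Y₁` at hand. If a
store passes a non-store event of its thread on the way, a delay disappears. -/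
theorem Bad.push {P : Program DOM THRD REG LAB} {A Y : List (TEvent DOM THRD)}
    {e : TEvent DOM THRD} : ∀ {R : List (TEvent DOM THRD)}, Bad P (A ++ Y ++ e :: R) →
    (∀ Y₁ d Y₂, Y = Y₁ ++ d :: Y₂ → ¬ Dep (A ++ Y₁) d e) →
    Bad P (A ++ e :: Y ++ R) ∧ dl [] (A ++ e :: Y ++ R) ≤ dl [] (A ++ Y ++ e :: R) ∧
      (∀ y ∈ Y, y.thread = e.thread → y.isStore = false → e.isStore = true →
        dl [] (A ++ e :: Y ++ R) < dl [] (A ++ Y ++ e :: R)) := by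
  induction Y using List.reverseRecOn with
  | nil => intro R h _; simpa using h
  | append_singleton Y d ih =>
    intro R h hi
    have h1 : Bad P ((A ++ Y) ++ d :: e :: R) := by simpa using h
    have hd := hi Y d [] (by simp)
    have h2 := h1.swap hd
    obtain ⟨h3, h4⟩ := dl_swap h1.1 hd
    obtain ⟨h5, h6, h7⟩ := ih (R := d :: R) h2 fun Y₁ d' Y₂ hY =>
      hi Y₁ d' (Y₂ ++ [d]) (by simp [hY])
    have e1 : A ++ e :: (Y ++ [d]) ++ R = A ++ e :: Y ++ d :: R := by simp
    have e2 : A ++ (Y ++ [d]) ++ e :: R = A ++ Y ++ d :: e :: R := by simp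
    rw [e1, e2]
    refine ⟨h5, h6.trans h3, fun y hy hyt hys hes => ?_⟩
    rw [List.mem_append, List.mem_singleton] at hy
    rcases hy with hy | rfl
    · exact (h7 y hy hyt hys hes).trans_le h3
    · exact h6.trans_lt (h4 hyt hys hes)

theorem Conf.mono {C C' : List (TEvent DOM THRD)} {a : DOM} {d : TEvent DOM THRD}
    (h : Conf C a d) (hs : C ⊆ C') : Conf C' a d := by
  cases d <;> simp only [Conf] at h ⊢
  · exact h
  · refine ⟨h.1, fun p hp => ?_⟩
    obtain ⟨t, ht⟩ := mem_stores.1 (h.2 p hp)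
    exact mem_stores.2 ⟨t, hs ht⟩

/-- Dependencies after rearrangement come from dependencies in the original order `O`, possibly on
another member of the block. A non-store event depends on any member of its own thread. If there is
none, the block contains no issues of that thread, so `NoPend` carries over from the prefix; being
stated by membership, `NoPend` ignores the order of events. -/
theorem dep_of_prefix {O A Y₁ Y₂ : List (TEvent DOM THRD)} {d e : TEvent DOM THRD}
    (hO : O.Perm (A ++ (Y₁ ++ d :: Y₂))) (h : Dep (A ++ Y₁) d e) :
    ∃ d' ∈ Y₁ ++ d :: Y₂, Dep O d' e := by
  have hsub : A ++ Y₁ ⊆ O := by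
    intro x hx
    rw [hO.mem_iff]
    simp only [List.mem_append, List.mem_cons] at hx ⊢
    tauto
  by_cases hex : ∃ d' ∈ Y₁ ++ d :: Y₂, d'.thread = e.thread ∧ e.isStore = false
  · obtain ⟨d', hd', ht, he⟩ := hex
    refine ⟨d', hd', ?_⟩
    cases e <;> simp_all [Dep, TEvent.isStore, TEvent.thread]
  · refine ⟨d, by simp, ?_⟩
    cases e with
    | st t a v k => exact h.imp_right fun h => ⟨h.1.mono hsub, h.2⟩
    | ld t a k s =>
      refine h.imp_right fun h => ⟨fun p hp => ?_, h.2⟩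
      have h1 := mem_isus.1 hp
      rw [hO.mem_iff, List.mem_append] at h1
      rcases h1 with h1 | h1
      · exact mem_coms.2 (hsub (mem_coms.1 (h.1 p (mem_isus.2 (List.mem_append_left _ h1)))))
      · exact absurd ⟨_, h1, rfl, rfl⟩ hex
    | _ => exact h

open Classical in
/-- The events of the first list, together with the events of the second list that depend on
them. All events executed before are in the first argument. -/
noncomputable def clos : List (TEvent DOM THRD) → List (TEvent DOM THRD) →
    List (TEvent DOM THRD) → List (TEvent DOM THRD)
  | _, Y, [] => Y
  | O, Y, e :: γ => clos (O ++ [e]) (if ∃ d ∈ Y, Dep O d e then Y ++ [e] else Y) γ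

theorem subset_clos {γ : List (TEvent DOM THRD)} : ∀ {O Y : List (TEvent DOM THRD)},
    Y ⊆ clos O Y γ := by
  induction γ with
  | nil => exact fun {O Y} => List.Subset.refl _
  | cons e γ ih =>
    intro O Y
    rw [clos]
    refine List.Subset.trans ?_ ih
    split_ifs
    · exact List.subset_append_left _ _
    · exact List.Subset.refl _

/-- Invariant: the processed events are rearranged into `A` followed by the closure so far. The next
event either depends on the closure and joins it at the end, or is pushed ahead of it; neither
increases the delays. -/
theorem Bad.gather {P : Program DOM THRD REG LAB} {R γ : List (TEvent DOM THRD)} :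
    ∀ {A Y O : List (TEvent DOM THRD)}, O.Perm (A ++ Y) → Bad P (A ++ Y ++ (γ ++ R)) →
      ∃ A', (O ++ γ).Perm (A' ++ clos O Y γ) ∧ Bad P (A' ++ clos O Y γ ++ R) ∧
        dl [] (A' ++ clos O Y γ ++ R) ≤ dl [] (A ++ Y ++ (γ ++ R)) := by
  induction γ with
  | nil =>
    intro A Y O hO h
    exact ⟨A, by simpa [clos] using hO, by simpa [clos] using h, by simp [clos]⟩
  | cons e γ ih =>
    intro A Y O hO h
    rw [clos]
    split_ifs with hd
    · have hO' : (O ++ [e]).Perm (A ++ (Y ++ [e])) := by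
        simpa using hO.append_right [e]
      have e1 : A ++ Y ++ (e :: γ ++ R) = A ++ (Y ++ [e]) ++ (γ ++ R) := by simp
      obtain ⟨A', h1, h2, h3⟩ := ih hO' (by rwa [← e1])
      exact ⟨A', by simpa using h1, h2, by rwa [e1]⟩
    · have hpush := Bad.push (R := γ ++ R) h fun Y₁ d Y₂ hY hdep => by
        subst hY
        obtain ⟨d', h1, h2⟩ := dep_of_prefix hO hdep
        exact hd ⟨d', h1, h2⟩
      have e1 : A ++ e :: Y ++ (γ ++ R) = A ++ [e] ++ Y ++ (γ ++ R) := by simp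
      have hO' : (O ++ [e]).Perm (A ++ [e] ++ Y) := by
        refine (hO.append_right [e]).trans ?_
        rw [List.append_assoc, List.append_assoc]
        exact (List.perm_append_comm).append_left A
      obtain ⟨A', h1, h2, h3⟩ := ih hO' (by rw [← e1]; exact hpush.1)
      refine ⟨A', by simpa using h1, h2, h3.trans ?_⟩
      rw [← e1]
      exact hpush.2.1

/-- If a delayed store does not depend on an event `y` of its thread that it overtakes, then there
is a violation with fewer delays. -/
theorem Bad.exists_lt {P : Program DOM THRD REG LAB} {A γ R : List (TEvent DOM THRD)}
    {y e : TEvent DOM THRD} (h : Bad P (A ++ y :: γ ++ e :: R)) (hyt : y.thread = e.thread)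
    (hys : y.isStore = false) (hes : e.isStore = true)
    (hd : ∀ d ∈ clos (A ++ [y]) [y] γ, ¬ Dep (A ++ y :: γ) d e) :
    ∃ V, Bad P V ∧ dl [] V < dl [] (A ++ y :: γ ++ e :: R) := by
  have e1 : A ++ y :: γ ++ e :: R = A ++ [y] ++ (γ ++ e :: R) := by simp
  rw [e1] at h ⊢
  -- Everything that depends on `y` becomes a block directly before `e`; then `e` is pushed ahead of
  -- this block, and thereby of `y`.
  obtain ⟨A', h1, h2, h3⟩ := h.gather (List.Perm.refl _)
  have hpush := h2.push fun Y₁ d Y₂ hY hdep => by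
    rw [hY] at h1 hd
    obtain ⟨d', h4, h5⟩ := dep_of_prefix h1 hdep
    exact hd d' h4 (by simpa using h5)
  refine ⟨_, hpush.1, (hpush.2.2 y (subset_clos (by simp)) hyt hys hes).trans_le h3⟩

end Move

/-! ### Reorders -/

section Reorder

variable {DOM THRD : Type*} [DecidableEq THRD]

/-- The number of reorders in the second list after the first one. -/
def ro : List (Event DOM THRD) → List (Event DOM THRD) → ℕ
  | _, [] => 0
  | T, f :: R => (if f.act.isIssued then T.countP (fun y => decide (y.thread = f.thread ∧
      y.act.isIssued = true ∧ f.iss < y.iss)) else 0) + ro (T ++ [f]) R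

theorem ro_perm_left {R : List (Event DOM THRD)} : ∀ {T T' : List (Event DOM THRD)},
    T.Perm T' → ro T R = ro T' R := by
  induction R with
  | nil => intros; rfl
  | cons f R ih =>
    intro T T' h
    rw [ro, ro, h.countP_eq, ih (h.append_right [f])]

theorem ro_append {A R : List (Event DOM THRD)} : ∀ {T : List (Event DOM THRD)},
    ro T (A ++ R) = ro T A + ro (T ++ A) R := by
  induction A with
  | nil => intro T; simp [ro]
  | cons f A ih =>
    intro T
    rw [List.cons_append, ro, ro, ih]
    simp [Nat.add_assoc]

theorem ro_swap_lt {T R : List (Event DOM THRD)} {x y : Event DOM THRD}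
    (hx : x.act.isIssued = true) (hy : y.act.isIssued = true) (ht : x.thread = y.thread)
    (hlt : y.iss < x.iss) : ro T (y :: x :: R) < ro T (x :: y :: R) := by
  simp only [ro, hx, hy, if_true, List.countP_append]
  rw [ro_perm_left (T := T ++ [y] ++ [x]) (T' := T ++ [x] ++ [y]) (by
    rw [List.append_assoc, List.append_assoc]
    exact List.perm_append_comm.append_left T)]
  simp only [List.countP_cons, List.countP_nil, ht, hx, hy, hlt, hlt.asymm]
  simp
  omega

/-- Stores and fences come after their issue. -/
def IssBefore (τ : List (Event DOM THRD)) : Prop :=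
  ∀ (q : ℕ) (e : Event DOM THRD), τ[q]? = some e → e.act.isIssued = true → e.iss < q

/-- `reordersAt` also asks that the overtaken store or fence lie after the issue of the overtaking
one. This follows from the order of the two issues, as every store or fence comes after its own
issue. -/
theorem reorders_eq {τ : List (Event DOM THRD)} (h : IssBefore τ) : reorders τ = ro [] τ := by
  classical
  have key : ∀ (R T : List (Event DOM THRD)), τ = T ++ R → ro T R =
      ∑ k ∈ Finset.Ico T.length τ.length, if ∃ f ∈ τ[k]?, f.act.isIssued = true then
        ((Finset.range k).filter fun q => ∃ y ∈ τ[q]?, ∃ f ∈ τ[k]?, y.thread = f.thread ∧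
          y.act.isIssued = true ∧ f.iss < y.iss).card else 0 := by
    intro R
    induction R with
    | nil => rintro T rfl; simp [ro]
    | cons f R ih =>
      intro T hT
      have h1 := ih (T ++ [f]) (by simpa using hT)
      rw [List.length_append, List.length_singleton] at h1
      rw [ro, Finset.sum_eq_sum_Ico_succ_bot (by rw [hT]; simp), h1]
      congr 1
      have hf : τ[T.length]? = some f := by
        rw [hT, List.getElem?_append_right (le_refl T.length)]; simp
      simp only [hf, Option.mem_def, Option.some.injEq, exists_eq_left']
      split_ifs
      · rw [countP_eq_card _ T []]
        congr 1
        ext q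
        simp only [List.length_nil, Finset.mem_filter, Finset.mem_Ico, Finset.mem_range,
          List.nil_append, Option.mem_def, zero_add, zero_le, true_and]
        refine and_congr_right fun hq => ?_
        rw [hT, List.getElem?_append_left hq]
      · rfl
  rw [key τ [] rfl, reorders, sumIssued]
  rw [List.length_nil, ← Finset.range_eq_Ico, Finset.sum_range]
  refine Finset.sum_congr rfl fun p _ => ?_
  have hp := List.getElem?_eq_getElem p.2
  simp only [Fin.getElem_fin, hp, Option.mem_def, Option.some.injEq, exists_eq_left']
  congr 1
  rw [reordersAt, between, Finset.filter_filter]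
  congr 1
  ext q
  simp only [Finset.mem_filter, Finset.mem_Ioo, Finset.mem_range, Option.mem_def]
  constructor
  · rintro ⟨⟨h1, h2⟩, ⟨e, he, h3⟩, y, hy, h4, h5⟩
    rw [he] at hy
    obtain rfl := Option.some.inj hy
    exact ⟨h2, e, he, h3, h4, h5⟩
  · rintro ⟨h2, e, he, h3, h4, h5⟩
    exact ⟨⟨h5.trans (h q e he h4), h2⟩, ⟨e, he, h3⟩, e, he, h4, h5⟩

end Reorder

/-! ### Uniqueness of events -/

section Unique

variable {DOM THRD REG LAB : Type*} [Zero DOM] [DecidableEq DOM] [DecidableEq THRD]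
  [DecidableEq REG]

theorem Valid.isus_nodup {P : Program DOM THRD REG LAB} {L R : List (TEvent DOM THRD)}
    (hV : Valid P (L ++ R)) (t : THRD) (a : DOM) : (isus t a L).Nodup :=
  (isus_pairwise hV t a).imp fun {p q} h he => by rw [he] at h; exact lt_irrefl _ h

theorem Valid.not_mem_right {P : Program DOM THRD REG LAB} {L R : List (TEvent DOM THRD)}
    (hV : Valid P (L ++ R)) {x : TEvent DOM THRD} (hx : x ∈ L) (hxs : x.isStore = false) :
    x ∉ R := fun h => absurd (hV.le_pos h hxs) (not_le.2 (hV.pos_lt hx hxs))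

theorem Valid.store_not_mem_left {P : Program DOM THRD REG LAB} {L R : List (TEvent DOM THRD)}
    {e : TEvent DOM THRD} (hV : Valid P (L ++ e :: R)) (he : e.isStore = true) : e ∉ L := by
  cases e with
  | st t a v k =>
    intro h
    have h1 : coms t a L ++ [(k, v)] <+: isus t a L := hV.memOK
    have h2 := (hV.isus_nodup t a).sublist h1.sublist
    have h3 : ((k, v) : ℕ × DOM) ∈ coms t a L := mem_coms.2 h
    exact (List.nodup_append.1 h2).2.2 _ h3 _ (by simp) rfl
  | _ => simp [TEvent.isStore] at he

theorem Valid.store_not_mem_right {P : Program DOM THRD REG LAB} {L R : List (TEvent DOM THRD)}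
    {e : TEvent DOM THRD} (hV : Valid P (L ++ e :: R)) (he : e.isStore = true) : e ∉ R := by
  intro h
  obtain ⟨R₁, R₂, rfl⟩ := List.append_of_mem h
  have h1 : Valid P ((L ++ e :: R₁) ++ e :: R₂) := by simpa using hV
  exact h1.store_not_mem_left he (by simp)

theorem Valid.mem_buf {P : Program DOM THRD REG LAB} {L R : List (TEvent DOM THRD)} {t : THRD}
    {a v : DOM} {k : ℕ} (hV : Valid P (L ++ R)) (hx : TEvent.st t a v k ∈ R)
    (hi : TEvent.isu t a v k ∈ L) : (k, v) ∈ buf t a L := by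
  have h1 : ((k, v) : ℕ × DOM) ∈ coms t a R := mem_coms.2 hx
  rw [hV.coms_eq, List.mem_append] at h1
  exact h1.resolve_right fun h2 => hV.not_mem_right hi rfl (mem_isus.1 h2)

theorem Valid.not_mem_coms_of_mem_buf {P : Program DOM THRD REG LAB}
    {L R : List (TEvent DOM THRD)} (hV : Valid P (L ++ R)) {t : THRD} {a : DOM} {p : ℕ × DOM}
    (hp : p ∈ buf t a L) : p ∉ coms t a L := by
  have h := hV.isus_nodup t a
  rw [isus_eq_coms_append_buf hV.memRun_left] at h
  exact fun h' => (List.nodup_append.1 h).2.2 p h' p hp rfl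

theorem NoPend.buf_eq_nil {P : Program DOM THRD REG LAB} {L R : List (TEvent DOM THRD)}
    (hV : Valid P (L ++ R)) {t : THRD} {a : DOM} (h : NoPend L t a) : buf t a L = [] := by
  rw [List.eq_nil_iff_forall_not_mem]
  exact fun p hp => hV.not_mem_coms_of_mem_buf hp (h p (List.mem_of_mem_drop hp))

/-- A tag determines its issue, and thereby the thread of the store. -/
theorem Valid.mem_coms_of_mem_stores {P : Program DOM THRD REG LAB}
    {C V : List (TEvent DOM THRD)} (hV : Valid P V) (hC : C ⊆ V) {t : THRD} {a : DOM} {p : ℕ × DOM}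
    (hp : p ∈ stores a C) (hi : TEvent.isu t a p.2 p.1 ∈ V) : p ∈ coms t a C := by
  obtain ⟨u, hu⟩ := mem_stores.1 hp
  have h1 := hV.node_eq (hV.issue_mem (hC hu)) hi rfl rfl rfl
  simp only [TEvent.issue, TEvent.isu.injEq, and_true] at h1
  rw [← h1]
  exact mem_coms.2 hu

/-- The head of a buffer is its oldest issue, hence it precedes that of `q`. -/
theorem Valid.issue_head_buf_mem {P : Program DOM THRD REG LAB} {A B R : List (TEvent DOM THRD)}
    (hV : Valid P (A ++ B ++ R)) {t : THRD} {a : DOM} {p q : ℕ × DOM} {β : List (ℕ × DOM)}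
    (hb : buf t a (A ++ B) = p :: β) (hq : q ∈ buf t a (A ++ B))
    (hqA : TEvent.isu t a q.2 q.1 ∈ A) : TEvent.isu t a p.2 p.1 ∈ A := by
  have h1 := (isus_pairwise hV t a).sublist (List.drop_sublist (coms t a (A ++ B)).length _)
  change (buf t a (A ++ B)).Pairwise _ at h1
  rw [hb] at h1 hq
  rcases List.mem_cons.1 hq with rfl | hq
  · exact hqA
  · have h2 := (List.pairwise_cons.1 h1).1 q hq
    have h3 : p ∈ isus t a (A ++ B) :=
      List.mem_of_mem_drop (show p ∈ buf t a (A ++ B) by rw [hb]; simp)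
    rcases List.mem_append.1 (mem_isus.1 h3) with h3 | h3
    · exact h3
    · rw [List.append_assoc] at hV h2
      have h4 := hV.pos_lt hqA rfl
      have h5 := hV.le_pos (List.mem_append_left R h3) rfl
      simp only [TEvent.tag] at h4 h5
      omega

end Unique

/-! ### Dependencies in ranked computations -/

section Rank

variable {DOM THRD REG LAB : Type*} [Zero DOM] [DecidableEq DOM] [DecidableEq THRD]
  [DecidableEq REG]

theorem Ranked.thread_lt {P : Program DOM THRD REG LAB} {O R : List (TEvent DOM THRD)}
    {ρ : ℕ → ℕ} {d e : TEvent DOM THRD} (hV : Valid P (O ++ e :: R)) (h : Ranked (O ++ e :: R) ρ)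
    (hd : d ∈ O) (he : e.isStore = false) (ht : d.thread = e.thread) : ρ d.tag < ρ e.tag := by
  have hi : d.issue ∈ O := by
    by_cases hs : d.isStore = true
    · obtain ⟨O₁, O₂, rfl⟩ := List.append_of_mem hd
      have h1 : Valid P (O₁ ++ d :: (O₂ ++ e :: R)) := by simpa using hV
      exact List.mem_append_left _ (h1.issue_mem_left hs)
    · cases d <;> simp_all [TEvent.isStore, TEvent.issue]
  rw [← d.tag_issue]
  exact h.po_lt hi (List.mem_cons_self ..) d.isStore_issue he (d.thread_issue.trans ht)

theorem Ranked.conf_lt {P : Program DOM THRD REG LAB} {O R : List (TEvent DOM THRD)}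
    {ρ : ℕ → ℕ} {d : TEvent DOM THRD} {a : DOM} {q : ℕ × DOM} (hV : Valid P (O ++ R))
    (h : Ranked (O ++ R) ρ) (hd : d ∈ O) (hc : Conf O a d) (hq : q ∈ stores a R) :
    ρ d.tag < ρ q.1 := by
  cases d with
  | st u b w j =>
    obtain rfl : b = a := hc
    exact h.st_lt (p := (j, w)) (mem_stores.2 ⟨u, hd⟩) hq
  | ld u b j s =>
    obtain ⟨rfl, hs⟩ := hc
    exact h.cf_lt hV (List.mem_append_left _ hd) hs hq
  | _ => exact hc.elim

/-- Each direct dependency is a path in happens-before. Equality occurs when `d` is the issue of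
`e`, as they share a tag. A load from memory has as source the last store to its address, which `d`
equals or precedes in store order. -/
theorem Ranked.dep_le {P : Program DOM THRD REG LAB} {O R : List (TEvent DOM THRD)} {ρ : ℕ → ℕ}
    {d e : TEvent DOM THRD} (hV : Valid P (O ++ e :: R)) (h : Ranked (O ++ e :: R) ρ)
    (hd : d ∈ O) (hdep : Dep O d e) : ρ d.tag ≤ ρ e.tag := by
  cases e with
  | st t a v k =>
    rcases hdep with rfl | ⟨hc, -⟩
    · exact le_rfl
    · exact (h.conf_lt (q := (k, v)) hV hd hc (mem_stores.2 ⟨t, by simp⟩)).le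
  | ld t a k s =>
    rcases hdep with ht | ⟨hn, p, hp⟩
    · exact (h.thread_lt hV hd rfl ht).le
    · have hs : s = read t a O := hV.memOK
      rw [read, hn.buf_eq_nil hV] at hs
      have hp' : p ∈ stores a O := List.mem_filterMap.2 ⟨d, hd, hp⟩
      have hpt : p.1 = d.tag := by
        cases d <;> simp [TEvent.storeAt] at hp
        rw [← hp.2]; rfl
      rcases List.eq_nil_or_concat (stores a O) with h0 | ⟨l, q, h0⟩
      · rw [h0] at hp'; simp at hp'
      · rw [List.concat_eq_append] at h0
        rw [h0] at hs hp'
        have hs : s = some q := by simpa using hs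
        subst hs
        have h1 : ρ q.1 < ρ k := h.src _ _ ⟨t, a, q, by simp, rfl⟩
        refine le_trans ?_ h1.le
        rw [← hpt]
        rw [List.mem_append, List.mem_singleton] at hp'
        rcases hp' with hp' | rfl
        · have h2 := h.stores_pairwise a
          rw [stores_append, h0, List.pairwise_append, List.pairwise_append] at h2
          exact (h2.1.2.2 p hp' q (by simp)).le
        · exact le_rfl
  | _ => exact (h.thread_lt hV hd rfl hdep).le

theorem Ranked.clos_le {P : Program DOM THRD REG LAB} {γ R : List (TEvent DOM THRD)} {ρ : ℕ → ℕ}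
    {m : ℕ} : ∀ {O Y : List (TEvent DOM THRD)}, Valid P (O ++ (γ ++ R)) →
      Ranked (O ++ (γ ++ R)) ρ → Y ⊆ O → (∀ d ∈ Y, m ≤ ρ d.tag) →
      ∀ d ∈ clos O Y γ, m ≤ ρ d.tag := by
  induction γ with
  | nil => intro O Y _ _ _ h; exact h
  | cons e γ ih =>
    intro O Y hV hR hY h
    rw [clos]
    have e1 : O ++ (e :: γ ++ R) = O ++ [e] ++ (γ ++ R) := by simp
    have hY' : Y ⊆ O ++ [e] := List.Subset.trans hY (List.subset_append_left _ _)
    split_ifs with hd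
    · obtain ⟨d, hdY, hdep⟩ := hd
      refine ih (by rwa [← e1]) (by rwa [← e1]) (List.append_subset.2 ⟨hY', by simp⟩) ?_
      intro d' hd'
      rw [List.mem_append, List.mem_singleton] at hd'
      rcases hd' with hd' | rfl
      · exact h d' hd'
      · exact (h d hdY).trans (hR.dep_le hV (hY hdY) hdep)
    · exact ih (by rwa [← e1]) (by rwa [← e1]) hY' h

end Rank

/-! ### Events depending on a given one -/

section Clos

variable {DOM THRD : Type*} [DecidableEq DOM] [DecidableEq THRD]

theorem clos_subset {γ : List (TEvent DOM THRD)} : ∀ {O Y : List (TEvent DOM THRD)},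
    clos O Y γ ⊆ Y ++ γ := by
  induction γ with
  | nil => intro O Y; simp [clos]
  | cons e γ ih =>
    intro O Y x hx
    rw [clos] at hx
    have := ih hx
    split_ifs at this <;> simp at this ⊢ <;> tauto

/-- Closures are built from left to right, so the part of the closure before its first event with
property `Q` is the closure within a shorter list. -/
theorem exists_first_clos {Q : TEvent DOM THRD → Prop} {γ : List (TEvent DOM THRD)} :
    ∀ {O Y : List (TEvent DOM THRD)}, (∀ d ∈ Y, ¬ Q d) → (∃ d ∈ clos O Y γ, Q d) →
      ∃ γ₁ z γ₂, γ = γ₁ ++ z :: γ₂ ∧ (∀ d ∈ clos O Y γ₁, ¬ Q d) ∧ Q z ∧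
        ∃ d ∈ clos O Y γ₁, Dep (O ++ γ₁) d z := by
  induction γ with
  | nil =>
    rintro O Y hY ⟨d, hd, hQ⟩
    exact absurd hQ (hY d hd)
  | cons e γ ih =>
    rintro O Y hY h
    rw [clos] at h
    by_cases hd : ∃ d ∈ Y, Dep O d e
    · by_cases hQ : Q e
      · exact ⟨[], e, γ, rfl, hY, hQ, by simpa [clos] using hd⟩
      · rw [if_pos hd] at h
        obtain ⟨γ₁, z, γ₂, rfl, h1, h2, h3⟩ := ih (O := O ++ [e]) (Y := Y ++ [e]) (by
          intro d hd
          rw [List.mem_append, List.mem_singleton] at hd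
          rcases hd with hd | rfl
          · exact hY d hd
          · exact hQ) h
        refine ⟨e :: γ₁, z, γ₂, rfl, ?_, h2, ?_⟩
        · rw [clos, if_pos hd]; exact h1
        · rw [clos, if_pos hd]; simpa using h3
    · rw [if_neg hd] at h
      obtain ⟨γ₁, z, γ₂, rfl, h1, h2, h3⟩ := ih (O := O ++ [e]) hY h
      refine ⟨e :: γ₁, z, γ₂, rfl, ?_, h2, ?_⟩
      · rw [clos, if_neg hd]; exact h1
      · rw [clos, if_neg hd]; simpa using h3

/-- Nothing but its store and later events of its thread depend on an issue. -/
theorem clos_issue {t : THRD} {a v : DOM} {k : ℕ} {γ : List (TEvent DOM THRD)} :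
    ∀ {O : List (TEvent DOM THRD)}, (∀ e ∈ γ, e.isStore = false → e.thread ≠ t) →
      TEvent.st t a v k ∉ γ → clos O [.isu t a v k] γ = [.isu t a v k] := by
  induction γ with
  | nil => intros; rfl
  | cons e γ ih =>
    intro O h1 h2
    rw [clos, if_neg]
    · exact ih (fun x hx => h1 x (List.mem_cons_of_mem _ hx))
        fun hx => h2 (List.mem_cons_of_mem _ hx)
    · simp only [List.mem_singleton, exists_eq_left]
      have h3 := h1 e (by simp)
      have h4 : e ≠ .st t a v k := by rintro rfl; exact h2 (by simp)
      intro hdep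
      cases e with
      | st u b w j =>
        rcases hdep with hdep | hdep
        · simp only [TEvent.isu.injEq] at hdep
          obtain ⟨rfl, rfl, rfl, rfl⟩ := hdep
          exact h4 rfl
        · exact hdep.1
      | ld u b j s =>
        rcases hdep with hdep | ⟨-, p, hp⟩
        · exact h3 rfl hdep.symm
        · simp [TEvent.storeAt] at hp
      | _ => exact h3 rfl (Eq.symm hdep)

end Clos

/-! ### Stopping a computation and writing back the buffers -/

section Truncate

variable {DOM THRD : Type*} [DecidableEq DOM] [DecidableEq THRD]

/-- A load reads from the store that is visible after `L`. -/
def reread (L : List (TEvent DOM THRD)) : TEvent DOM THRD → TEvent DOM THRD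
  | .ld u a k _ => .ld u a k (read u a L)
  | z => z

theorem reread_thread (L : List (TEvent DOM THRD)) (z : TEvent DOM THRD) :
    (reread L z).thread = z.thread := by cases z <;> rfl

open Classical in
/-- The stores in `R`, except for `g`, that are issued in `A`. -/
noncomputable def flush (A R : List (TEvent DOM THRD)) (g : TEvent DOM THRD) :
    List (TEvent DOM THRD) :=
  R.filter fun x => x.isStore = true ∧ x.issue ∈ A ∧ x ≠ g

theorem mem_flush {A R : List (TEvent DOM THRD)} {g x : TEvent DOM THRD} :
    x ∈ flush A R g ↔ x ∈ R ∧ x.isStore = true ∧ x.issue ∈ A ∧ x ≠ g := by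
  simp [flush]

theorem flush_append (A R R' : List (TEvent DOM THRD)) (g : TEvent DOM THRD) :
    flush A (R ++ R') g = flush A R g ++ flush A R' g := by
  simp [flush]

theorem isus_of_stores {R : List (TEvent DOM THRD)} (h : ∀ x ∈ R, x.isStore = true) (t : THRD)
    (a : DOM) : isus t a R = [] := by
  rw [isus, List.filterMap_eq_nil_iff]
  intro x hx
  have := h x hx
  cases x <;> simp_all [TEvent.isStore, TEvent.issueAt]

theorem prog_of_stores {R : List (TEvent DOM THRD)} (h : ∀ x ∈ R, x.isStore = true) (t : THRD) :
    prog t R = [] := by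
  rw [prog, List.filter_eq_nil_iff]
  intro x hx
  simp [h x hx]

theorem memRun_of_stores {F : List (TEvent DOM THRD)} : ∀ {L : List (TEvent DOM THRD)},
    (∀ x ∈ F, x.isStore = true) → (∀ t a, coms t a (L ++ F) <+: isus t a L) → MemRun L F := by
  induction F with
  | nil => intros; trivial
  | cons x F ih =>
    intro L hF h
    have hx := hF x (by simp)
    cases x with
    | st t a v k =>
      refine ⟨?_, ih (fun x hx => hF x (List.mem_cons_of_mem _ hx)) fun u b => ?_⟩
      · refine List.IsPrefix.trans ?_ (h t a)
        rw [coms_append, coms_cons]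
        simp [TEvent.commitAt]
      · rw [isus_append, List.append_assoc]
        simpa [isus_cons, TEvent.issueAt] using h u b
    | _ => simp [TEvent.isStore] at hx

theorem coms_filter {q : TEvent DOM THRD → Bool} {q' : ℕ × DOM → Bool} {t : THRD} {a : DOM}
    (h : ∀ k v, q (.st t a v k) = q' (k, v)) (R : List (TEvent DOM THRD)) :
    coms t a (R.filter q) = (coms t a R).filter q' := by
  induction R with
  | nil => rfl
  | cons x R ih =>
    rw [coms_cons, List.filter_append, ← ih, List.filter_cons]
    cases hx : x.commitAt t a with
    | none =>
      split_ifs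
      · rw [coms_cons, hx]; rfl
      · simp
    | some p =>
      have hxe : x = .st t a p.2 p.1 := by
        cases x <;> simp [TEvent.commitAt] at hx
        obtain ⟨⟨rfl, rfl⟩, rfl⟩ := hx
        rfl
      have : q x = q' p := by rw [hxe, h]
      by_cases hq : q' p = true
      · simp [this, hq, coms_cons, hx]
      · simp [this, hq]

variable {REG LAB : Type*} [Zero DOM] [DecidableEq REG]

theorem Valid.filter_coms {P : Program DOM THRD REG LAB} {A R : List (TEvent DOM THRD)}
    (hV : Valid P (A ++ R)) (t : THRD) (a : DOM) :
    (coms t a R).filter (fun p => decide (p ∈ isus t a A)) = buf t a A := by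
  rw [hV.coms_eq, List.filter_append, List.filter_eq_self.2, List.filter_eq_nil_iff.2,
    List.append_nil]
  · intro p hp hpA
    simp only [decide_eq_true_eq] at hpA
    exact hV.not_mem_right (mem_isus.1 hpA) rfl (mem_isus.1 hp)
  · intro p hp
    simpa using List.mem_of_mem_drop hp

/-- Every buffer is drained in FIFO order. The buffer of `t` for `b` gives up its head first and
then the rest in the old order; in every other buffer the old order is untouched, with `z` at its
place if it is a store. -/
theorem Valid.coms_truncate {P : Program DOM THRD REG LAB} {A R : List (TEvent DOM THRD)}
    {z : TEvent DOM THRD} (hV : Valid P (A ++ z :: R)) {t : THRD} {b vg : DOM} {kg : ℕ}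
    {β : List (ℕ × DOM)} (hb : buf t b A = (kg, vg) :: β) (hz : z.thread ≠ t) (u : THRD)
    (a : DOM) :
    coms u a (A ++ .st t b vg kg :: reread (A ++ [.st t b vg kg]) z ::
      flush A R (.st t b vg kg)) = isus u a A := by
  classical
  rw [isus_eq_coms_append_buf hV.memRun_left, coms_append, coms_cons, coms_cons]
  congr 1
  have hf := hV.filter_coms u a
  have hzc : (reread (A ++ [.st t b vg kg]) z).commitAt u a = z.commitAt u a := by
    cases z <;> rfl
  rw [hzc]
  rw [coms_cons, List.filter_append] at hf
  by_cases hc : u = t ∧ a = b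
  · obtain ⟨rfl, rfl⟩ := hc
    have h1 : coms u a (flush A R (.st u a vg kg)) = ((coms u a R).filter
        (fun p => decide (p ∈ isus u a A))).filter (fun p => decide (p ≠ (kg, vg))) := by
      rw [List.filter_filter]
      apply coms_filter
      intro k v
      simp [TEvent.isStore, TEvent.issue, mem_isus]
      grind
    rw [commitAt_of_thread_ne hz] at hf ⊢
    have h2 : (buf u a A).Nodup := (hV.isus_nodup u a).sublist (List.drop_sublist _ _)
    simp only [Option.toList_none, List.filter_nil, List.nil_append] at hf ⊢
    rw [h1, hf, hb]
    rw [hb, List.nodup_cons] at h2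
    have h3 : β.filter (fun p => decide (p ≠ (kg, vg))) = β := by
      rw [List.filter_eq_self]
      intro p hp
      simp only [decide_eq_true_eq]
      rintro rfl
      exact h2.1 hp
    have h4 : ((kg, vg) :: β).filter (fun p => decide (p ≠ (kg, vg))) = β := by
      rw [List.filter_cons_of_neg (by simp), h3]
    rw [h4]
    simp [TEvent.commitAt]
  · have h1 : coms u a (flush A R (.st t b vg kg)) = (coms u a R).filter
        (fun p => decide (p ∈ isus u a A)) := by
      apply coms_filter
      intro k v
      have : ¬ (TEvent.st u a v k = TEvent.st t b vg kg) := by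
        intro h
        simp only [TEvent.st.injEq] at h
        exact hc ⟨h.1, h.2.1⟩
      simp [TEvent.isStore, TEvent.issue, mem_isus, this]
    rw [h1, ← hf]
    have h2 : TEvent.commitAt u a (.st t b vg kg) = none := by
      simp [TEvent.commitAt]; tauto
    rw [h2]
    simp only [Option.toList_none, List.nil_append]
    congr 1
    cases hzz : z.commitAt u a with
    | none => rfl
    | some p =>
      have hxe : z = .st u a p.2 p.1 := by
        cases z <;> simp [TEvent.commitAt] at hzz
        obtain ⟨⟨rfl, rfl⟩, rfl⟩ := hzz
        rfl
      subst hxe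
      have h3 : p ∈ isus u a A := mem_isus.2 (hV.issue_mem_left rfl)
      simp [h3]

/-- Only stores follow `z`, so if `z` is a load it is the last program step of its thread and may
read another value. `Conf C c z` guarantees that `z` is a load or a store. -/
theorem Valid.truncate {P : Program DOM THRD REG LAB} {A R : List (TEvent DOM THRD)}
    {z : TEvent DOM THRD} (hV : Valid P (A ++ z :: R)) {t : THRD} {b vg : DOM} {kg : ℕ}
    {β : List (ℕ × DOM)} (hb : buf t b A = (kg, vg) :: β) (hz : z.thread ≠ t)
    {C : List (TEvent DOM THRD)} {c : DOM} (hzm : Conf C c z) :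
    Valid P (A ++ .st t b vg kg :: reread (A ++ [.st t b vg kg]) z ::
      flush A R (.st t b vg kg)) := by
  have hF : ∀ x ∈ flush A R (.st t b vg kg), x.isStore = true := fun x hx => (mem_flush.1 hx).2.1
  have hcoms := hV.coms_truncate hb hz
  have hisz : ∀ u a, (reread (A ++ [.st t b vg kg]) z).issueAt u a = none := by
    intro u a
    cases z <;> first | rfl | exact hzm.elim
  have hisus : ∀ u a, isus u a (A ++ .st t b vg kg :: reread (A ++ [.st t b vg kg]) z ::
      flush A R (.st t b vg kg)) = isus u a A := by
    intro u a
    rw [isus_append, isus_cons, isus_cons, isus_of_stores hF, hisz]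
    simp [TEvent.issueAt]
  refine ⟨fun u => ?_, ?_, ?_, fun u a => by rw [hcoms, hisus]⟩
  · have hex := hV.exec u
    have hp : prog u (A ++ .st t b vg kg :: reread (A ++ [.st t b vg kg]) z ::
        flush A R (.st t b vg kg)) =
        prog u A ++ prog u [reread (A ++ [.st t b vg kg]) z] := by
      have h1 : A ++ .st t b vg kg :: reread (A ++ [.st t b vg kg]) z ::
        flush A R (.st t b vg kg) = A ++ ([.st t b vg kg] ++
          ([reread (A ++ [.st t b vg kg]) z] ++ flush A R (.st t b vg kg))) := by simp
      rw [h1, prog_append, prog_append, prog_append, prog_of_stores hF,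
        prog_of_stores (R := [.st t b vg kg]) (by simp [TEvent.isStore])]
      simp
    have h2 : A ++ z :: R = (A ++ [z]) ++ R := by simp
    rw [hp]
    rw [h2, prog_append, prog_append] at hex
    have hex := hex.of_append
    cases z with
    | ld w a k s =>
      by_cases hw : w = u
      · simp only [reread, prog, TEvent.isStore, TEvent.thread, hw, Bool.not_false, decide_true,
          Bool.and_self, List.filter_cons_of_pos, List.filter_nil] at hex ⊢
        exact hex.change_last_load _
      · simpa [prog, reread, TEvent.isStore, TEvent.thread, hw] using hex
    | st w a v k => exact hex
    | _ => exact hzm.elim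
  · rw [memRun_append]
    refine ⟨hV.memRun_left, ?_, ?_, ?_⟩
    · change coms t b A ++ [(kg, vg)] <+: isus t b A
      rw [isus_eq_coms_append_buf hV.memRun_left, hb]
      simp
    · have hzOK := hV.memOK
      cases z with
      | ld w a k s => exact rfl
      | st w a v k =>
        have hne : (TEvent.st t b vg kg).thread ≠ w := fun h => hz h.symm
        change coms w a (A ++ [.st t b vg kg]) ++ [(k, v)] <+: isus w a (A ++ [.st t b vg kg])
        rw [coms_concat_of_thread_ne _ hne, isus_concat_of_thread_ne _ hne]
        exact hzOK
      | _ => exact hzm.elim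
    · refine memRun_of_stores hF fun u a => ?_
      have h1 := hcoms u a
      simp only [List.nil_append, List.append_assoc, List.cons_append] at h1 ⊢
      rw [h1, isus_append, isus_cons, isus_cons, hisz]
      simp [TEvent.issueAt]
  · have h1 := hV.nodup
    refine h1.sublist ?_
    have h2 : nodeTags (flush A R (.st t b vg kg)) = [] := by
      rw [nodeTags, List.map_eq_nil_iff, List.filter_eq_nil_iff]
      intro x hx
      simp [hF x hx]
    have h3 : nodeTags [reread (A ++ [.st t b vg kg]) z] = nodeTags [z] := by
      cases z <;> rfl
    have h4 : A ++ .st t b vg kg :: reread (A ++ [.st t b vg kg]) z ::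
        flush A R (.st t b vg kg) = A ++ ([.st t b vg kg] ++
          ([reread (A ++ [.st t b vg kg]) z] ++ flush A R (.st t b vg kg))) := by simp
    have h5 : A ++ z :: R = A ++ ([z] ++ R) := by simp
    rw [h4, h5]
    simp only [nodeTags_append, h2, h3]
    refine List.Sublist.append_left ?_ _
    simp [nodeTags, TEvent.isStore]

/-- As `z` is of another thread, `g` may be counted behind it. What then follows is, up to order, a
selection of the stores of `R`, all issued in `A`; their order is irrelevant by `dl_perm_stores`,
and dropping events only removes delays. -/
theorem Valid.dl_truncate_le {P : Program DOM THRD REG LAB} {A R : List (TEvent DOM THRD)}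
    {z : TEvent DOM THRD} (hV : Valid P (A ++ z :: R)) {t : THRD} {b vg : DOM} {kg : ℕ}
    {β : List (ℕ × DOM)} (hb : buf t b A = (kg, vg) :: β) (hz : z.thread ≠ t)
    {C : List (TEvent DOM THRD)} {c : DOM} (hzm : Conf C c z) :
    dl [] (A ++ .st t b vg kg :: reread (A ++ [.st t b vg kg]) z ::
      flush A R (.st t b vg kg)) ≤ dl [] (A ++ z :: R) := by
  classical
  set g : TEvent DOM THRD := .st t b vg kg with hg
  set z' := reread (A ++ [g]) z with hz'
  have hgA : g.issue ∈ A :=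
    mem_isus.1 (List.mem_of_mem_drop (show (kg, vg) ∈ buf t b A by rw [hb]; simp))
  have hgR : g ∈ R := by
    have h1 : (kg, vg) ∈ coms t b (z :: R) := by
      rw [hV.coms_eq, hb]; simp
    have h2 := mem_coms.1 h1
    rw [List.mem_cons] at h2
    refine h2.resolve_left fun h => hz ?_
    rw [← h]; rfl
  obtain ⟨R₁, R₂, rfl⟩ := List.append_of_mem hgR
  have hV' : Valid P ((A ++ z :: R₁) ++ g :: R₂) := by simpa using hV
  have hg1 := hV'.store_not_mem_left rfl
  have hg2 := hV'.store_not_mem_right rfl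
  let q : TEvent DOM THRD → Bool := fun x => decide (x.isStore = true ∧ x.issue ∈ A)
  have hfl : ∀ R : List (TEvent DOM THRD), g ∉ R → flush A R g = R.filter q := by
    intro R hR
    refine List.filter_congr fun x hx => ?_
    have : x ≠ g := by rintro rfl; exact hR hx
    simp [q, this]
  have hperm : (g :: flush A (R₁ ++ g :: R₂) g).Perm ((R₁ ++ g :: R₂).filter q) := by
    have h1 : flush A (g :: R₂) g = flush A R₂ g := by simp [flush]
    have h2 : q g = true := by
      simp only [q, decide_eq_true_eq]
      exact ⟨rfl, hgA⟩
    rw [flush_append, h1, hfl R₁ (fun h => hg1 (by simp [h])), hfl R₂ hg2, List.filter_append,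
      List.filter_cons_of_pos h2]
    exact List.perm_middle.symm
  set R := R₁ ++ g :: R₂ with hR
  set F := flush A R g with hF
  have hFs : ∀ x ∈ g :: F, x.isStore = true := by
    intro x hx
    have := (List.mem_filter.1 (hperm.mem_iff.1 hx)).2
    simp only [q, decide_eq_true_eq] at this
    exact this.1
  have hFi : ∀ x ∈ g :: F, x.issue ∈ A := by
    intro x hx
    have := (List.mem_filter.1 (hperm.mem_iff.1 hx)).2
    simp only [q, decide_eq_true_eq] at this
    exact this.2
  have hqz : ∀ q : TEvent DOM THRD → Bool, (∀ x, q x = true → x.isStore = true) →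
      q z' = q z := by
    intro q hq
    cases z with
    | ld u a k s =>
      have h1 : q (.ld u a k s) = false := by
        exact Bool.eq_false_iff.2 fun h => Bool.false_ne_true (hq _ h)
      have h2 : q z' = false := by
        exact Bool.eq_false_iff.2 fun h => Bool.false_ne_true (hq _ h)
      rw [h1, h2]
    | _ => rfl
  refine dl_append_le (fun q' hq' => ?_) ?_
  · have h1 : (g :: z' :: F).Perm (z' :: g :: F) := .swap _ _ _
    rw [h1.countP_eq, List.countP_cons, List.countP_cons (a := z), hqz q' hq', hperm.countP_eq]
    exact Nat.add_le_add_right (List.filter_sublist.countP_le) _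
  · rw [dl_swap_eq (d := g) (e := z') (by rw [reread_thread]; exact fun h => hz h.symm)]
    generalize g :: F = G at hperm hFs hFi
    rw [dl, dl, hperm.countP_eq, dl_perm_stores (T := [] ++ A ++ [z']) hperm hFs
      fun x hx => List.mem_append_left _ (hFi x hx)]
    refine add_le_add ?_ (dl_filter_le (fun x _ hx => ?_) fun x hxs hx => ?_)
    · rw [reread_thread]
      exact List.filter_sublist.countP_le
    · simp only [q, decide_eq_true_eq] at hx
      exact hx.1
    · rw [List.mem_append, List.mem_singleton] at hx ⊢
      refine hx.imp_right fun h => ?_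
      exfalso
      cases x with
      | st =>
        cases z with
        | ld => simp [hz', reread, TEvent.issue] at h
        | st => simp [hz', reread, TEvent.issue] at h
        | _ => exact hzm.elim
      | _ => simp [TEvent.isStore] at hxs

end Truncate

/-! ### Adjacent stores of a thread -/

section Adjacent

variable {DOM THRD REG LAB : Type*} [Zero DOM] [DecidableEq DOM] [DecidableEq THRD]
  [DecidableEq REG]

/-- A load that a pending store precedes in program order, and that no issue of its thread
follows, does not read from memory. -/
theorem Valid.not_conf {P : Program DOM THRD REG LAB} {A γ R : List (TEvent DOM THRD)}
    {y : TEvent DOM THRD} {t : THRD} {a v : DOM} {k : ℕ} (hV : Valid P (A ++ y :: γ ++ R))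
    (hys : y.isStore = false) (hyt : y.thread = t)
    (hγ : ∀ e ∈ γ, e.isStore = false → e.thread ≠ t) (hx : TEvent.st t a v k ∈ R)
    (hi : TEvent.isu t a v k ∈ A) : ¬ Conf (A ++ y :: γ) a y := by
  intro hc
  cases y with
  | st => simp [TEvent.isStore] at hys
  | ld u b j s =>
    obtain ⟨rfl, hs⟩ := hc
    obtain rfl : u = t := hyt
    have e1 : A ++ .ld u b j s :: γ ++ R = A ++ .ld u b j s :: (γ ++ R) := by simp
    have hV' : Valid P (A ++ .ld u b j s :: (γ ++ R)) := by rwa [← e1]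
    have hr : s = read u b A := hV'.memOK
    have h1 : (k, v) ∈ buf u b A := hV'.mem_buf (by simp [hx]) hi
    have h2 : (k, v) ∈ buf u b (A ++ .ld u b j s :: γ) :=
      hV.mem_buf hx (List.mem_append_left _ hi)
    have h3 : isus u b (A ++ .ld u b j s :: γ) = isus u b A := by
      have : isus u b γ = [] := by
        rw [List.eq_nil_iff_forall_not_mem]
        exact fun p hp => hγ _ (mem_isus.1 hp) rfl rfl
      rw [isus_append, isus_cons, this]
      simp [TEvent.issueAt]
    rcases List.eq_nil_or_concat (buf u b A) with h0 | ⟨l, p, h0⟩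
    · simp [h0] at h1
    rcases List.eq_nil_or_concat (buf u b (A ++ .ld u b j s :: γ)) with h0' | ⟨l', p', h0'⟩
    · simp [h0'] at h2
    rw [List.concat_eq_append] at h0 h0'
    rw [isus_eq_coms_append_buf hV.memRun_left, isus_eq_coms_append_buf hV'.memRun_left, h0, h0',
      ← List.append_assoc, ← List.append_assoc] at h3
    obtain rfl : p' = p := by simpa using (List.append_inj' h3 rfl).2
    have hsp : s = some p' := by rw [hr, read, h0]; simp
    have hp : p' ∈ buf u b (A ++ .ld u b j s :: γ) := by rw [h0']; simp
    refine hV.not_mem_coms_of_mem_buf hp (hV.mem_coms_of_mem_stores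
      (List.subset_append_left _ _) (hs _ hsp) ?_)
    exact List.mem_append_left _ (mem_isus.1 (List.mem_of_mem_drop hp))
  | _ => exact hc

/-- If a load `z` has an empty own buffer, it now reads from a store already in memory, possibly the
new one. Otherwise its source is an own pending store which by `hz` reached the memory within `γ`,
and `flush` retains that store. -/
theorem Valid.conf_reread {P : Program DOM THRD REG LAB} {A γ E : List (TEvent DOM THRD)}
    {z : TEvent DOM THRD} (hV : Valid P (A ++ z :: (γ ++ E))) {t : THRD} {b vg c : DOM} {kg : ℕ}
    (hzt : z.thread ≠ t) (hz : Conf (A ++ z :: γ) c z) :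
    Conf (A ++ .st t b vg kg :: reread (A ++ [.st t b vg kg]) z :: flush A γ (.st t b vg kg)) c
      (reread (A ++ [.st t b vg kg]) z) := by
  cases z with
  | st => exact hz
  | ld u a j s =>
    obtain ⟨rfl, hs⟩ := hz
    refine ⟨rfl, fun p hp => ?_⟩
    rw [read, buf_concat_of_thread_ne _ (show (TEvent.st t b vg kg).thread ≠ u from hzt.symm)] at hp
    have hr : s = read u a A := hV.memOK
    rcases List.eq_nil_or_concat (buf u a A) with h0 | ⟨l, q, h0⟩
    · rw [h0] at hp
      have h1 : p ∈ stores a (A ++ [.st t b vg kg]) := List.mem_of_getLast? (by simpa using hp)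
      obtain ⟨w, hw⟩ := mem_stores.1 h1
      refine mem_stores.2 ⟨w, ?_⟩
      simp only [List.mem_append, List.mem_cons] at hw ⊢
      tauto
    · rw [List.concat_eq_append] at h0
      rw [h0] at hp
      obtain rfl : q = p := by simpa using hp
      have hq : q ∈ buf u a A := by rw [h0]; simp
      have hsq : s = some q := by rw [hr, read, h0]; simp
      have hqi := mem_isus.1 (List.mem_of_mem_drop hq)
      have h1 := hV.mem_coms_of_mem_stores (t := u) (by intro x; simp; tauto) (hs _ hsq)
        (List.mem_append_left _ hqi)
      rw [coms_append, List.mem_append] at h1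
      have h2 := mem_coms.1 (h1.resolve_left (hV.not_mem_coms_of_mem_buf hq))
      rw [List.mem_cons] at h2
      have h3 := h2.resolve_left (by simp)
      refine mem_stores.2 ⟨u, ?_⟩
      have h4 : TEvent.st u a q.2 q.1 ∈ flush A γ (.st t b vg kg) := by
        refine mem_flush.2 ⟨h3, rfl, hqi, ?_⟩
        intro h
        simp only [TEvent.st.injEq] at h
        exact hzt h.1
      simp [h4]
  | _ => exact hz.elim

theorem dep_reread {A : List (TEvent DOM THRD)} {d z g : TEvent DOM THRD} {C} {c : DOM}
    (hz : Conf C c z) (hg : g.thread ≠ z.thread) (h : Dep A d z) :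
    Dep (A ++ [g]) d (reread (A ++ [g]) z) := by
  cases z with
  | st u a v k => exact h.imp_right fun h => ⟨h.1.mono (List.subset_append_left _ _), h.2⟩
  | ld u a k s =>
    refine h.imp_right fun h => ⟨?_, h.2⟩
    intro p hp
    have hg : g.thread ≠ u := hg
    rw [isus_concat_of_thread_ne _ hg] at hp
    rw [coms_concat_of_thread_ne _ hg]
    exact h.1 p hp
  | _ => exact hz.elim

/-- If the event `z`, which depends on the event `y` of thread `t`, conflicts with a pending store
of `t` that precedes `y` in program order, then `t` can write back an older store before `z`. -/
theorem Bad.exists_lt_of_conf {P : Program DOM THRD REG LAB} (hP : P.FenceFree)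
    {A γ₁ γ₂ E : List (TEvent DOM THRD)} {y z d' : TEvent DOM THRD} {t : THRD} {b vg c v : DOM}
    {kg k : ℕ} {β : List (ℕ × DOM)} (h : Bad P (A ++ y :: γ₁ ++ z :: (γ₂ ++ E)))
    (hys : y.isStore = false) (hyt : y.thread = t) (hzt : z.thread ≠ t)
    (hb : buf t b (A ++ y :: γ₁) = (kg, vg) :: β) (hg : TEvent.isu t b vg kg ∈ A)
    (hz : Conf (A ++ y :: γ₁ ++ z :: γ₂) c z) (hx : TEvent.st t c v k ∈ E)
    (hi : TEvent.isu t c v k ∈ A) (hxg : TEvent.st t c v k ≠ .st t b vg kg)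
    (hd : ∀ d ∈ clos (A ++ [y]) [y] γ₁, ¬ Conf (A ++ y :: γ₁ ++ z :: γ₂) b d)
    (hd' : d' ∈ clos (A ++ [y]) [y] γ₁) (hdep : Dep (A ++ y :: γ₁) d' z) :
    ∃ V, Bad P V ∧ dl [] V < dl [] (A ++ y :: γ₁ ++ z :: (γ₂ ++ E)) := by
  have hV := h.1.truncate hb hzt hz
  have hle := h.1.dl_truncate_le hb hzt hz
  have hcr := h.1.conf_reread (b := b) (vg := vg) (kg := kg) hzt hz
  set A' := A ++ y :: γ₁ with hA'
  set g : TEvent DOM THRD := .st t b vg kg with hgdef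
  set z' := reread (A' ++ [g]) z with hz'
  have hsub : clos (A ++ [y]) [y] γ₁ ⊆ y :: γ₁ := clos_subset
  have hbad : Bad P (A' ++ g :: z' :: flush A' (γ₂ ++ E) g) := by
    refine ⟨hV, hV.ev_mem_computations, ?_⟩
    rintro ⟨σ, hσ, hs⟩
    obtain ⟨ρ, hρ⟩ := exists_ranked hP hV hσ hs
    -- The cycle: `y` leads to `d'` and on to `z'` by dependencies, `z'` precedes store `k` by
    -- conflict or store order, and the issue of `k` precedes `y` in program order.
    have h1 : ρ y.tag ≤ ρ d'.tag := by
      have e1 : A' ++ g :: z' :: flush A' (γ₂ ++ E) g =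
          A ++ [y] ++ (γ₁ ++ (g :: z' :: flush A' (γ₂ ++ E) g)) := by simp [hA']
      exact Ranked.clos_le (by rwa [← e1]) (by rwa [← e1]) (by simp) (by simp) d' hd'
    have h2 : ρ d'.tag ≤ ρ z'.tag := by
      have e1 : A' ++ g :: z' :: flush A' (γ₂ ++ E) g =
          A' ++ [g] ++ z' :: flush A' (γ₂ ++ E) g := by simp
      refine Ranked.dep_le (by rwa [← e1]) (by rwa [← e1]) ?_
        (dep_reread hz (fun h => hzt h.symm) hdep)
      exact List.mem_append_left _ (List.mem_append_right _ (hsub hd'))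
    have h3 : ρ z'.tag < ρ k := by
      have e1 : A' ++ g :: z' :: flush A' (γ₂ ++ E) g =
          (A' ++ g :: z' :: flush A' γ₂ g) ++ flush A' E g := by simp [flush_append]
      refine Ranked.conf_lt (q := (k, v)) (by rwa [← e1]) (by rwa [← e1]) (by simp) hcr ?_
      exact mem_stores.2 ⟨t, mem_flush.2 ⟨hx, rfl, List.mem_append_left _ hi, hxg⟩⟩
    have h4 : ρ k < ρ y.tag := by
      have e1 : A' ++ g :: z' :: flush A' (γ₂ ++ E) g =
          A ++ (y :: γ₁ ++ g :: z' :: flush A' (γ₂ ++ E) g) := by simp [hA']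
      rw [e1] at hρ
      exact hρ.po_lt hi (by simp) rfl hys hyt.symm
    omega
  -- The store `g` is issued before `y` and conflicts with nothing in the closure of `y`, so it can
  -- be moved ahead of `y`.
  obtain ⟨V, hV1, hV2⟩ := Bad.exists_lt hbad hyt hys rfl fun d hdc hdg => by
    rcases hdg with rfl | ⟨hc, -⟩
    · have hV0 : Valid P (A ++ (y :: γ₁ ++ z :: (γ₂ ++ E))) := by
        rw [← List.append_assoc]; exact h.1
      exact hV0.not_mem_right hg rfl (List.mem_append_left _ (hsub hdc))
    · exact hd d hdc (hc.mono (List.subset_append_left _ _))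
  exact ⟨V, hV1, hV2.trans_le hle⟩

/-- The main case, stores in issue order. As `y` is the last non-store event of `t`, the first store
overtakes it; the second was issued at `y` at the latest. -/
theorem Bad.exists_lt_of_stores {P : Program DOM THRD REG LAB} (hP : P.FenceFree)
    {A γ R : List (TEvent DOM THRD)} {y : TEvent DOM THRD} {t : THRD} {a₁ v₁ a₂ v₂ : DOM}
    {k₁ k₂ : ℕ} (h : Bad P (A ++ y :: γ ++ .st t a₁ v₁ k₁ :: .st t a₂ v₂ k₂ :: R))
    (hys : y.isStore = false) (hyt : y.thread = t)
    (hγ : ∀ e ∈ γ, e.isStore = false → e.thread ≠ t) (hi₁ : TEvent.isu t a₁ v₁ k₁ ∈ A)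
    (hi₂ : TEvent.isu t a₂ v₂ k₂ ∈ A ++ [y]) :
    ∃ V, Bad P V ∧
      dl [] V < dl [] (A ++ y :: γ ++ .st t a₁ v₁ k₁ :: .st t a₂ v₂ k₂ :: R) := by
  by_contra hmin
  have hsub : clos (A ++ [y]) [y] γ ⊆ y :: γ := clos_subset
  have hV0 : Valid P (A ++ (y :: γ ++ .st t a₁ v₁ k₁ :: .st t a₂ v₂ k₂ :: R)) := by
    rw [← List.append_assoc]; exact h.1
  have hV2 : Valid P (A ++ y :: γ ++ [.st t a₁ v₁ k₁] ++ .st t a₂ v₂ k₂ :: R) := by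
    simpa using h.1
  have hx₂ := hV2.store_not_mem_left rfl
  -- Without a conflict in the closure of `y`, the first store could move ahead of `y` and save a
  -- delay.
  obtain ⟨d, hd, hdc⟩ : ∃ d ∈ clos (A ++ [y]) [y] γ, Conf (A ++ y :: γ) a₁ d := by
    by_contra hno
    refine hmin (h.exists_lt hyt hys rfl fun d hd hdep => ?_)
    rcases hdep with rfl | ⟨hc, -⟩
    · exact hV0.not_mem_right hi₁ rfl (List.mem_append_left _ (hsub hd))
    · exact hno ⟨d, hd, hc⟩
  have hy₁ := h.1.not_conf hys hyt hγ (List.mem_cons_self ..) hi₁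
  have hi₂ : TEvent.isu t a₂ v₂ k₂ ∈ A := by
    rw [List.mem_append, List.mem_singleton] at hi₂
    refine hi₂.resolve_right ?_
    rintro rfl
    -- If `y` is the second issue, its closure is `y` alone, which cannot be the conflicting event.
    rw [clos_issue hγ (fun hx => hx₂ (by simp [hx])), List.mem_singleton] at hd
    exact hy₁ (hd ▸ hdc)
  have hy₂ := h.1.not_conf hys hyt hγ (List.mem_cons_of_mem _ (List.mem_cons_self ..)) hi₂
  obtain ⟨γ₁, z, γ₂, rfl, hQ, hz, d', hd', hdep⟩ :=
    exists_first_clos (Q := fun d => Conf (A ++ y :: γ) a₁ d ∨ Conf (A ++ y :: γ) a₂ d)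
      (O := A ++ [y]) (Y := [y]) (γ := γ) (by simp [hy₁, hy₂]) ⟨d, hd, Or.inl hdc⟩
  have hsub' : clos (A ++ [y]) [y] γ₁ ⊆ y :: γ₁ := clos_subset
  have e1 : A ++ y :: (γ₁ ++ z :: γ₂) = A ++ y :: γ₁ ++ z :: γ₂ := by simp
  have e2 : A ++ [y] ++ γ₁ = A ++ y :: γ₁ := by simp
  have e3 : A ++ y :: (γ₁ ++ z :: γ₂) ++ .st t a₁ v₁ k₁ :: .st t a₂ v₂ k₂ :: R =
      A ++ y :: γ₁ ++ z :: (γ₂ ++ .st t a₁ v₁ k₁ :: .st t a₂ v₂ k₂ :: R) := by simp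
  rw [e1] at hQ hz
  rw [e2] at hdep
  rw [e3] at h hmin
  have hb₁ : (k₁, v₁) ∈ buf t a₁ (A ++ y :: γ₁) :=
    h.1.mem_buf (by simp) (List.mem_append_left _ hi₁)
  have hb₂ : (k₂, v₂) ∈ buf t a₂ (A ++ y :: γ₁) :=
    h.1.mem_buf (by simp) (List.mem_append_left _ hi₂)
  have hhead : ∀ a p β, (a = a₁ ∨ a = a₂) → buf t a (A ++ y :: γ₁) = p :: β →
      TEvent.isu t a p.2 p.1 ∈ A := by
    rintro a p β (rfl | rfl) hb
    · exact h.1.issue_head_buf_mem hb hb₁ hi₁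
    · exact h.1.issue_head_buf_mem hb hb₂ hi₂
  have hzt : z.thread ≠ t := by
    intro ht
    by_cases hzs : z.isStore = true
    · cases z with
      | st u a w j =>
        obtain rfl : u = t := ht
        have ha : a = a₁ ∨ a = a₂ := hz
        rcases hdep with rfl | ⟨hc, -⟩
        -- Here `z` would be the head of a buffer of `t`, issued in `A`; but the closure contains
        -- only `y` and later events, so it cannot contain that issue.
        · have hpre : coms u a (A ++ y :: γ₁) ++ [(j, w)] <+: isus u a (A ++ y :: γ₁) := h.1.memOK
          rw [isus_eq_coms_append_buf h.1.memRun_left, List.prefix_append_right_inj] at hpre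
          obtain ⟨β, hβ⟩ := hpre
          exact hV0.not_mem_right (hhead a (j, w) β ha hβ.symm) rfl
            (List.mem_append_left _
              (List.cons_subset_cons _ (List.subset_append_left _ _) (hsub' hd')))
        · have hc := hc.mono (List.subset_append_left _ (.st u a w j :: γ₂))
          rcases ha with rfl | rfl
          · exact hQ d' hd' (Or.inl hc)
          · exact hQ d' hd' (Or.inr hc)
      | _ => simp [TEvent.isStore] at hzs
    · exact hγ z (by simp) (by simpa using hzs) ht
  by_cases haa : a₁ = a₂
  · subst haa
    obtain ⟨⟨kg, vg⟩, β, hb⟩ := List.exists_cons_of_ne_nil (List.ne_nil_of_mem hb₂)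
    refine hmin (h.exists_lt_of_conf (v := v₂) (k := k₂) hP hys hyt hzt hb
      (hhead _ _ _ (.inl rfl) hb) (or_self_iff.1 hz) (by simp) hi₂ ?_ (fun d hd hc => hQ d hd (Or.inl hc)) hd' hdep)
    -- The second store is not the oldest pending one to this address: the first one is pending too
    -- and reaches the memory earlier.
    intro he
    simp only [TEvent.st.injEq, true_and] at he
    obtain ⟨rfl, rfl⟩ := he
    have h1 := h.1.coms_eq t a₁
    rw [hb] at h1
    have e4 : z :: (γ₂ ++ .st t a₁ v₁ k₁ :: .st t a₁ v₂ k₂ :: R) =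
        (z :: γ₂ ++ [.st t a₁ v₁ k₁]) ++ .st t a₁ v₂ k₂ :: R := by simp
    rw [e4, coms_append] at h1
    have h2 : (k₂, v₂) ∉ coms t a₁ (z :: γ₂ ++ [.st t a₁ v₁ k₁]) := by
      intro hm
      refine hx₂ ?_
      have := mem_coms.1 hm
      simp only [List.mem_append, List.mem_cons] at this ⊢
      tauto
    have h3 : (k₁, v₁) ∈ coms t a₁ (z :: γ₂ ++ [.st t a₁ v₁ k₁]) := mem_coms.2 (by simp)
    obtain ⟨p, l, hl⟩ := List.exists_cons_of_ne_nil (List.ne_nil_of_mem h3)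
    rw [hl, List.cons_append, List.cons_append, List.cons.injEq] at h1
    rw [hl, h1.1] at h2
    simp at h2
  · obtain ⟨⟨kg₁, vg₁⟩, β₁, hβ₁⟩ := List.exists_cons_of_ne_nil (List.ne_nil_of_mem hb₁)
    obtain ⟨⟨kg₂, vg₂⟩, β₂, hβ₂⟩ := List.exists_cons_of_ne_nil (List.ne_nil_of_mem hb₂)
    -- Write back the oldest store to the other address, so that the store conflicting with `z`
    -- remains pending when `z` is executed.
    rcases hz with hz | hz
    · exact hmin (h.exists_lt_of_conf (v := v₁) (k := k₁) hP hys hyt hzt hβ₂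
        (hhead _ _ _ (.inr rfl) hβ₂) hz (by simp) hi₁ (by simp [haa]) (fun d hd hc => hQ d hd (Or.inr hc)) hd' hdep)
    · exact hmin (h.exists_lt_of_conf (v := v₂) (k := k₂) hP hys hyt hzt hβ₁
        (hhead _ _ _ (.inl rfl) hβ₁) hz (by simp) hi₂ (by simp [Ne.symm haa]) (fun d hd hc => hQ d hd (Or.inl hc)) hd' hdep)

theorem Valid.issBefore {P : Program DOM THRD REG LAB} {V : List (TEvent DOM THRD)}
    (hV : Valid P V) : IssBefore (ev V) := by
  intro q e hq he
  obtain ⟨x, hx, rfl⟩ := getElem?_ev.1 hq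
  obtain ⟨L, R, rfl, rfl⟩ := eq_append_cons_of_getElem? hx
  rw [TEvent.isIssued_act] at he
  have := hV.pos_lt (hV.issue_mem_left he) x.isStore_issue
  rwa [x.tag_issue] at this

theorem PosTag.swap_stores {r : ℕ → ℕ} {L R : List (TEvent DOM THRD)} {x y : TEvent DOM THRD}
    (h : PosTag r (L ++ x :: y :: R)) (hx : x.isStore = true) (hy : y.isStore = true) :
    PosTag r (L ++ y :: x :: R) := by
  intro n e hn he
  refine h n e ?_ he
  rw [List.getElem?_append] at hn ⊢
  split_ifs at hn ⊢ with hlt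
  · exact hn
  · rcases hm : n - L.length with _ | _ | m
    · rw [hm] at hn
      simp only [List.getElem?_cons_zero, Option.some.injEq] at hn
      simp [← hn, hy] at he
    · rw [hm] at hn
      simp only [zero_add, List.getElem?_cons_succ, List.getElem?_cons_zero,
        Option.some.injEq] at hn
      simp [← hn, hx] at he
    · rw [hm] at hn
      simpa using hn

/-- Exchanging two adjacent stores of a thread that are executed in the wrong order. -/
theorem Bad.exchange_stores {P : Program DOM THRD REG LAB} {L R : List (TEvent DOM THRD)}
    {t : THRD} {a₁ v₁ a₂ v₂ : DOM} {k₁ k₂ : ℕ}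
    (h : Bad P (L ++ .st t a₁ v₁ k₁ :: .st t a₂ v₂ k₂ :: R))
    (hlt : pos (L ++ .st t a₁ v₁ k₁ :: .st t a₂ v₂ k₂ :: R) k₂ <
      pos (L ++ .st t a₁ v₁ k₁ :: .st t a₂ v₂ k₂ :: R) k₁) :
    ∃ V, Bad P V ∧ dl [] V ≤ dl [] (L ++ .st t a₁ v₁ k₁ :: .st t a₂ v₂ k₂ :: R) ∧
      reorders (ev V) < reorders (ev (L ++ .st t a₁ v₁ k₁ :: .st t a₂ v₂ k₂ :: R)) := by
  -- Stores of a thread to one address reach the memory in the order of their issues.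
  have hne : a₁ ≠ a₂ := by
    rintro rfl
    have hV : Valid P (L ++ [.st t a₁ v₁ k₁] ++ .st t a₁ v₂ k₂ :: R) := by simpa using h.1
    have h1 : coms t a₁ (L ++ [.st t a₁ v₁ k₁]) ++ [(k₂, v₂)] <+:
      isus t a₁ (L ++ [.st t a₁ v₁ k₁]) := hV.memOK
    have h2 := (isus_pairwise hV t a₁).sublist h1.sublist
    have h3 := (List.pairwise_append.1 h2).2.2 (k₁, v₁) (mem_coms.2 (by simp)) (k₂, v₂) (by simp)
    simp only [List.append_assoc, List.cons_append, List.nil_append] at h3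
    exact lt_asymm h3 hlt
  have hi : ¬ Dep L (.st t a₁ v₁ k₁) (.st t a₂ v₂ k₂) := by
    rintro (h | ⟨hc, -⟩)
    · cases h
    · exact hne hc
  have hs := h.swap hi
  refine ⟨_, hs, (dl_swap h.1 hi).1, ?_⟩
  -- No non-store event changes its position, so the issue positions are the same and the two event
  -- lists differ by one transposition.
  have hev : ev (L ++ .st t a₂ v₂ k₂ :: .st t a₁ v₁ k₁ :: R) =
      relabel (pos (L ++ .st t a₁ v₁ k₁ :: .st t a₂ v₂ k₂ :: R))
        (L ++ .st t a₂ v₂ k₂ :: .st t a₁ v₁ k₁ :: R) :=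
    relabel_congr hs.1 hs.1.posTag (h.1.posTag.swap_stores rfl rfl)
  rw [reorders_eq hs.1.issBefore, reorders_eq h.1.issBefore, hev, ev, relabel_append,
    relabel_append, ro_append, ro_append]
  simp only [relabel, List.map_cons]
  refine Nat.add_lt_add_left (ro_swap_lt ?_ ?_ ?_ ?_) _
  exacts [rfl, rfl, rfl, hlt]

theorem exists_last {α : Type*} {p : α → Prop} {L : List α} (h : ∃ x ∈ L, p x) :
    ∃ A y γ, L = A ++ y :: γ ∧ p y ∧ ∀ x ∈ γ, ¬ p x := by
  induction L using List.reverseRecOn with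
  | nil => simp at h
  | append_singleton L x ih =>
    by_cases hx : p x
    · exact ⟨L, x, [], rfl, hx, by simp⟩
    · obtain ⟨A, y, γ, rfl, hy, hγ⟩ := ih (by
        obtain ⟨x', hx', hp⟩ := h
        rw [List.mem_append, List.mem_singleton] at hx'
        rcases hx' with hx' | rfl
        · exact ⟨x', hx', hp⟩
        · exact absurd hp hx)
      refine ⟨A, y, γ ++ [x], by simp, hy, fun x' hx' => ?_⟩
      rw [List.mem_append, List.mem_singleton] at hx'
      rcases hx' with hx' | rfl
      · exact hγ x' hx'
      · exact hx

/-- A violation with two adjacent stores of a thread does not minimize delays and reorders. -/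
theorem Bad.exists_cost_lt {P : Program DOM THRD REG LAB} (hP : P.FenceFree)
    {L R : List (TEvent DOM THRD)} {t : THRD} {a₁ v₁ a₂ v₂ : DOM} {k₁ k₂ : ℕ}
    (h : Bad P (L ++ .st t a₁ v₁ k₁ :: .st t a₂ v₂ k₂ :: R)) :
    ∃ V, Bad P V ∧ cost (ev V) < cost (ev (L ++ .st t a₁ v₁ k₁ :: .st t a₂ v₂ k₂ :: R)) := by
  have hi₁ : TEvent.isu t a₁ v₁ k₁ ∈ L := h.1.issue_mem_left rfl
  have hi₂ : TEvent.isu t a₂ v₂ k₂ ∈ L := by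
    have hV : Valid P (L ++ [.st t a₁ v₁ k₁] ++ .st t a₂ v₂ k₂ :: R) := by simpa using h.1
    have h1 : TEvent.isu t a₂ v₂ k₂ ∈ L ++ [.st t a₁ v₁ k₁] := hV.issue_mem_left rfl
    simpa using h1
  have hlt_of_dl : ∀ V, Bad P V →
      dl [] V < dl [] (L ++ .st t a₁ v₁ k₁ :: .st t a₂ v₂ k₂ :: R) →
      cost (ev V) < cost (ev (L ++ .st t a₁ v₁ k₁ :: .st t a₂ v₂ k₂ :: R)) := by
    intro V hV hlt
    rw [cost, cost, Prod.Lex.toLex_lt_toLex]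
    left
    rwa [hV.1.delays_ev, h.1.delays_ev]
  rcases lt_trichotomy (pos (L ++ .st t a₁ v₁ k₁ :: .st t a₂ v₂ k₂ :: R) k₁)
    (pos (L ++ .st t a₁ v₁ k₁ :: .st t a₂ v₂ k₂ :: R) k₂) with hlt | heq | hlt
  · obtain ⟨A, y, γ, rfl, ⟨hys, hyt⟩, hγ⟩ :=
      exists_last (p := fun e : TEvent DOM THRD => e.isStore = false ∧ e.thread = t)
        ⟨_, hi₁, rfl, rfl⟩
    have hγ' : ∀ e ∈ γ, e.isStore = false → e.thread ≠ t := fun e he h1 h2 => hγ e he ⟨h1, h2⟩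
    have hmem : ∀ a v k, TEvent.isu t a v k ∈ A ++ y :: γ → TEvent.isu t a v k ∈ A ++ [y] := by
      intro a v k hm
      simp only [List.mem_append, List.mem_cons, List.not_mem_nil, or_false] at hm ⊢
      rcases hm with hm | hm | hm
      · exact Or.inl hm
      · exact Or.inr hm
      · exact absurd rfl (hγ' _ hm rfl)
    -- The first issue is not `y`, because the second issue is later and no non-store event of `t`
    -- follows `y` before the stores.
    have hi₁ : TEvent.isu t a₁ v₁ k₁ ∈ A := by
      have h1 := hmem _ _ _ hi₁
      rw [List.mem_append, List.mem_singleton] at h1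
      refine h1.resolve_right ?_
      rintro rfl
      have e1 : A ++ .isu t a₁ v₁ k₁ :: γ ++ .st t a₁ v₁ k₁ :: .st t a₂ v₂ k₂ :: R =
          A ++ ([.isu t a₁ v₁ k₁] ++ (γ ++ .st t a₁ v₁ k₁ :: .st t a₂ v₂ k₂ :: R)) := by simp
      have hV := h.1
      rw [e1] at hV hlt
      have h2 := hV.le_pos (x := .isu t a₁ v₁ k₁) (by simp) rfl
      have h3 := hmem _ _ _ hi₂
      rw [← List.append_assoc] at hV hlt h2
      have h4 := hV.pos_lt h3 rfl
      simp only [TEvent.tag, List.length_append, List.length_singleton] at h2 h4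
      omega
    obtain ⟨V, hV, hV'⟩ := h.exists_lt_of_stores hP hys hyt hγ' hi₁ (hmem _ _ _ hi₂)
    exact ⟨V, hV, hlt_of_dl V hV hV'⟩
  -- Equal issue positions would make the two stores the same event, executed twice.
  · exfalso
    obtain rfl : k₁ = k₂ := h.1.pos_inj (h.1.tag_mem (List.mem_append_left _ hi₁))
      (h.1.tag_mem (List.mem_append_left _ hi₂)) heq
    have h1 := h.1.node_eq (List.mem_append_left _ hi₁) (List.mem_append_left _ hi₂) rfl rfl rfl
    simp only [TEvent.isu.injEq, true_and, and_true] at h1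
    obtain ⟨rfl, rfl⟩ := h1
    exact h.1.store_not_mem_right rfl (List.mem_cons_self ..)
  · obtain ⟨V, hV, hle, hro⟩ := h.exchange_stores hlt
    refine ⟨V, hV, ?_⟩
    rcases hle.lt_or_eq with hlt' | heq
    · exact hlt_of_dl V hV hlt'
    · rw [cost, cost, Prod.Lex.toLex_lt_toLex]
      right
      refine ⟨?_, Prod.Lex.toLex_lt_toLex.2 (Or.inl hro)⟩
      rwa [← hV.1.delays_ev, ← h.1.delays_ev] at heq

theorem TEvent.eq_st_of_isStore {x : TEvent DOM THRD} (h : x.act.IsStore) :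
    ∃ a v, x = .st x.act.thread a v x.tag := by
  obtain ⟨t, a, v, h⟩ := h
  cases x <;> simp [TEvent.act] at h
  exact ⟨_, _, rfl⟩

end Adjacent

end StoreAtomic

/-! ### The proposition for operational computations -/

theorem proposition4 {DOM THRD REG LAB : Type*} [Zero DOM] [DecidableEq DOM] [DecidableEq THRD]
    [DecidableEq REG] [Finite THRD]
    (P : StoreAtomic.Program DOM THRD REG LAB) (hP : P.FenceFree) :
    ¬ ∃ (τ₁ τ₂ : List (StoreAtomic.Event DOM THRD)) (st₁ st₂ : StoreAtomic.Event DOM THRD),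
      st₁.act.IsStore ∧ st₂.act.IsStore ∧ st₁.thread = st₂.thread ∧
        P.IsMinimalViolation (τ₁ ++ [st₁] ++ [st₂] ++ τ₂) := by
  rintro ⟨τ₁, τ₂, st₁, st₂, h₁, h₂, ht, hviol, hmin⟩
  obtain ⟨V, hV, hev, -⟩ := StoreAtomic.exists_valid hP hviol.1
  have hev' : StoreAtomic.ev V = τ₁ ++ st₁ :: st₂ :: τ₂ := by simpa using hev
  rw [StoreAtomic.ev, StoreAtomic.relabel, List.map_eq_append_iff] at hev'
  obtain ⟨L, W, rfl, -, hW⟩ := hev'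
  rw [List.map_eq_cons_iff] at hW
  obtain ⟨x₁, W, rfl, hx₁, hW⟩ := hW
  rw [List.map_eq_cons_iff] at hW
  obtain ⟨x₂, R, rfl, hx₂, -⟩ := hW
  subst hx₁ hx₂
  obtain ⟨a₁, v₁, e₁⟩ := StoreAtomic.TEvent.eq_st_of_isStore h₁
  obtain ⟨a₂, v₂, e₂⟩ := StoreAtomic.TEvent.eq_st_of_isStore h₂
  have ht : x₁.act.thread = x₂.act.thread := ht
  rw [← ht] at e₂
  have hbad : StoreAtomic.Bad P (L ++ x₁ :: x₂ :: R) := ⟨hV, by rwa [hev]⟩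
  generalize x₁.act.thread = t at e₁ e₂
  obtain ⟨V, hV', hlt⟩ : ∃ V, StoreAtomic.Bad P V ∧
      StoreAtomic.cost (StoreAtomic.ev V) <
        StoreAtomic.cost (StoreAtomic.ev (L ++ x₁ :: x₂ :: R)) := by
    rw [e₁, e₂] at hbad ⊢
    exact hbad.exists_cost_lt hP
  rw [hev] at hlt
  exact absurd (hmin _ hV'.2) (not_le.2 hlt)
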